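/- **Problem.** The input consists of an integer $n\ge 1$, an accuracy $\epsilon\in(0,1)$, a symmetric positive semi-definite matrix $A_0\in\mathbb R^{n\times n}$, and an online sequence of vectors $v_1,\dots,v_T\in\mathbb R^n$ (with $T$ not known in advance) that update $A_t = A_{t-1}-v_tv_t^{\top}$, with the promise that $A_t\succeq 0$ for all $0\le t\le T$. For every $t=0,\dots,T$ the algorithm must hold, after processing $v_t$ and before seeing $v_{t+1}$, a number $\lambda_t$ and a unit vector $w_t\in\mathbb R^n$ with $$\lambda_{\max}(A_t)\ \ge\ \lambda_t\ \ge\ (1-\epsilon)\,\lambda_{\max}(A_t),\qquad w_t^{\top}A_tw_t\ \ge\ (1-\epsilon)\,\lambda_{\max}(A_t),$$ where $\lambda_{\max}(A)=\max_{\|u\|=1}u^{\top}Au$. Matrices and vectors are given as lists of their nonzero entries, in an arbitrary order. The computational model is the real RAM with unit-cost exact real arithmetic ($+,-,\times,/,\sqrt{\ }$ and comparison), unit-cost addition, subtraction and comparison of integers, indirect addressing, and unit-cost independent samples from the standard normal distribution $N(0,1)$. **Theorem.** There are a single randomized algorithm (one fixed program, taking $n$, $\epsilon$ and $A_0$ as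 input) and an absolute constant $C$ such that for all $n\ge1$, all $\epsilon$ with $1/n<\epsilon<1$, all $A_0$ and all $v_1,\dots,v_T$ as above that are fixed in advance, independently of the algorithm's random samples (an oblivious adversary), the following holds with probability at least $1-1/n$: the algorithm's answers $(\lambda_t,w_t)$ are correct for all $t=0,\dots,T$ simultaneously, and its total running time over the initialization and all $T$ updates is at most $$C\cdot\frac{\log^{3}n\;\log^{6}\frac n\epsilon\;\max\!\left\{1,\log\frac{\lambda_{\max}(A_0)}{\lambda_{\max}(A_T)}\right\}}{\epsilon^{4}}\left(\mathrm{nnz}(A_0)+\sum_{t=1}^{T}\max\{1,\mathrm{nnz}(v_t)\}\right),$$ where $\mathrm{nnz}$ is the number of nonzero entries. If $\lambda_{\max}(A_T)=0$ the bound is read as $+\infty$; correctness (and termination) is still claimed. -/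

import Mathlib

open scoped Matrix

noncomputable section

/-! ## A randomized real RAM with unit-cost steps -/

namespace RealRAM

/-- Memory of the machine: scalar variables and one-dimensional arrays of unbounded length, holding
natural numbers (addresses, counters) or real numbers.  `pos` is the number of random samples that
have been consumed; programs cannot read it. -/
structure State where
  nv : ℕ → ℕ
  rv : ℕ → ℝ
  na : ℕ → ℕ → ℕ
  ra : ℕ → ℕ → ℝ
  pos : ℕ

/-- Elementary instructions.  The arguments are the (fixed) names of variables and arrays, except for
the literal constants `c` and `q`; array cells are addressed by the content of a natural-number
variable.  There is no rounding of reals to naturals and no multiplication of naturals. -/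
inductive Instr where
  /-- `x := c` -/
  | nConst (x c : ℕ)
  /-- `x := y + z` -/
  | nAdd (x y z : ℕ)
  /-- `x := y - z`, truncated at `0` -/
  | nSub (x y z : ℕ)
  /-- `x := a[i]`, arrays of naturals -/
  | nRead (x a i : ℕ)
  /-- `a[i] := x`, arrays of naturals -/
  | nWrite (a i x : ℕ)
  /-- `x := q` -/
  | rConst (x : ℕ) (q : ℚ)
  /-- real variable `x` := natural variable `y` -/
  | rOfNat (x y : ℕ)
  /-- `x := y + z` -/
  | rAdd (x y z : ℕ)
  /-- `x := y - z` -/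
  | rSub (x y z : ℕ)
  /-- `x := y * z` -/
  | rMul (x y z : ℕ)
  /-- `x := y / z`, with value `0` if `z` is `0` -/
  | rDiv (x y z : ℕ)
  /-- `x := √y`, with value `0` if `y` is negative -/
  | rSqrt (x y : ℕ)
  /-- `x := a[i]`, arrays of reals -/
  | rRead (x a i : ℕ)
  /-- `a[i] := x`, arrays of reals -/
  | rWrite (a i x : ℕ)
  /-- `x :=` a fresh sample of the standard normal distribution -/
  | gauss (x : ℕ)

namespace State

def setN (s : State) (x c : ℕ) : State := { s with nv := Function.update s.nv x c }

def setR (s : State) (x : ℕ) (r : ℝ) : State := { s with rv := Function.update s.rv x r }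

def setNA (s : State) (a i c : ℕ) : State :=
  { s with na := Function.update s.na a (Function.update (s.na a) i c) }

def setRA (s : State) (a i : ℕ) (r : ℝ) : State :=
  { s with ra := Function.update s.ra a (Function.update (s.ra a) i r) }

end State

/-- Effect of one instruction; `ω` is the sequence of random samples. -/
def Instr.exec (ω : ℕ → ℝ) : Instr → State → State
  | .nConst x c, s => s.setN x c
  | .nAdd x y z, s => s.setN x (s.nv y + s.nv z)
  | .nSub x y z, s => s.setN x (s.nv y - s.nv z)
  | .nRead x a i, s => s.setN x (s.na a (s.nv i))
  | .nWrite a i x, s => s.setNA a (s.nv i) (s.nv x)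
  | .rConst x q, s => s.setR x (q : ℝ)
  | .rOfNat x y, s => s.setR x (s.nv y : ℝ)
  | .rAdd x y z, s => s.setR x (s.rv y + s.rv z)
  | .rSub x y z, s => s.setR x (s.rv y - s.rv z)
  | .rMul x y z, s => s.setR x (s.rv y * s.rv z)
  | .rDiv x y z, s => s.setR x (s.rv y / s.rv z)
  | .rSqrt x y, s => s.setR x (Real.sqrt (s.rv y))
  | .rRead x a i, s => s.setR x (s.ra a (s.nv i))
  | .rWrite a i x, s => s.setRA a (s.nv i) (s.rv x)
  | .gauss x, s => { s.setR x (ω s.pos) with pos := s.pos + 1 }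

/-- Comparisons between two variables. -/
inductive Test where
  | nLt (x y : ℕ)
  | nLe (x y : ℕ)
  | rLt (x y : ℕ)
  | rLe (x y : ℕ)

def Test.Holds : Test → State → Prop
  | .nLt x y, s => s.nv x < s.nv y
  | .nLe x y, s => s.nv x ≤ s.nv y
  | .rLt x y, s => s.rv x < s.rv y
  | .rLe x y, s => s.rv x ≤ s.rv y

/-- Programs: finite syntactic objects, hence uniform in all input sizes. -/
inductive Cmd where
  | skip
  | instr (i : Instr)
  | seq (c d : Cmd)
  | ite (b : Test) (c d : Cmd)
  | loop (b : Test) (c : Cmd)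

/-- `Exec ω c s s' k`: with random samples `ω`, the program `c` started in state `s` halts in state
`s'` after exactly `k` steps.  Every instruction and every evaluation of a test is one step.
`loop b c` repeats `c` while `b` holds. -/
inductive Exec (ω : ℕ → ℝ) : Cmd → State → State → ℕ → Prop where
  | skip (s : State) : Exec ω .skip s s 1
  | instr (i : Instr) (s : State) : Exec ω (.instr i) s (i.exec ω s) 1
  | seq {c d : Cmd} {s s' s'' : State} {k l : ℕ} :
      Exec ω c s s' k → Exec ω d s' s'' l → Exec ω (.seq c d) s s'' (k + l)
  | iteTrue {b : Test} {c d : Cmd} {s s' : State} {k : ℕ} :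
      b.Holds s → Exec ω c s s' k → Exec ω (.ite b c d) s s' (k + 1)
  | iteFalse {b : Test} {c d : Cmd} {s s' : State} {k : ℕ} :
      ¬ b.Holds s → Exec ω d s s' k → Exec ω (.ite b c d) s s' (k + 1)
  | loopTrue {b : Test} {c : Cmd} {s s' s'' : State} {k l : ℕ} :
      b.Holds s → Exec ω c s s' k → Exec ω (.loop b c) s' s'' l →
      Exec ω (.loop b c) s s'' (k + l + 1)
  | loopFalse {b : Test} {c : Cmd} {s : State} :
      ¬ b.Holds s → Exec ω (.loop b c) s s 1

/-- The final state and the number of steps are determined by the start state and the samples. -/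
theorem Exec.unique {ω : ℕ → ℝ} {c : Cmd} {s s₁ s₂ : State} {k₁ k₂ : ℕ}
    (h₁ : Exec ω c s s₁ k₁) (h₂ : Exec ω c s s₂ k₂) : s₁ = s₂ ∧ k₁ = k₂ := by
  induction h₁ generalizing s₂ k₂ with
  | skip s => cases h₂; exact ⟨rfl, rfl⟩
  | instr i s => cases h₂; exact ⟨rfl, rfl⟩
  | seq _ _ ih₁ ih₂ =>
    cases h₂ with
    | seq h h' =>
      obtain ⟨rfl, rfl⟩ := ih₁ h
      obtain ⟨rfl, rfl⟩ := ih₂ h'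
      exact ⟨rfl, rfl⟩
  | iteTrue hb _ ih =>
    cases h₂ with
    | iteTrue _ h => obtain ⟨rfl, rfl⟩ := ih h; exact ⟨rfl, rfl⟩
    | iteFalse hb' _ => exact absurd hb hb'
  | iteFalse hb _ ih =>
    cases h₂ with
    | iteTrue hb' _ => exact absurd hb' hb
    | iteFalse _ h => obtain ⟨rfl, rfl⟩ := ih h; exact ⟨rfl, rfl⟩
  | loopTrue hb _ _ ih₁ ih₂ =>
    cases h₂ with
    | loopTrue _ h h' =>
      obtain ⟨rfl, rfl⟩ := ih₁ h
      obtain ⟨rfl, rfl⟩ := ih₂ h'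
      exact ⟨rfl, rfl⟩
    | loopFalse hb' => exact absurd hb hb'
  | loopFalse hb =>
    cases h₂ with
    | loopTrue hb' _ _ => exact absurd hb' hb
    | loopFalse _ => exact ⟨rfl, rfl⟩

/-- The law of the random samples: independent standard normal variables. -/
def sampleLaw : MeasureTheory.Measure (ℕ → ℝ) :=
  MeasureTheory.Measure.infinitePi fun _ : ℕ => ProbabilityTheory.gaussianReal 0 1

/-- A dynamic algorithm: a program that is run once on the initial input and a program that is run
after the arrival of each update; the memory is kept in between. -/
structure DynAlg where
  init : Cmd
  update : Cmd

end RealRAM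

/-! ## The decremental maximum eigenvalue / eigenvector problem -/

namespace DecEig

open RealRAM

/-- Number of nonzero entries of a vector. -/
def nnzVec {n : ℕ} (v : Fin n → ℝ) : ℕ := Nat.card {i : Fin n // v i ≠ 0}

/-- Number of nonzero entries of a matrix. -/
def nnzMat {n : ℕ} (A : Matrix (Fin n) (Fin n) ℝ) : ℕ :=
  Nat.card {p : Fin n × Fin n // A p.1 p.2 ≠ 0}

/-- The nonzero entries of a vector, listed in an arbitrary order. -/
abbrev VecListing {n : ℕ} (v : Fin n → ℝ) : Type := Fin (nnzVec v) ≃ {i : Fin n // v i ≠ 0}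

/-- The nonzero entries of a matrix, listed in an arbitrary order. -/
abbrev MatListing {n : ℕ} (A : Matrix (Fin n) (Fin n) ℝ) : Type :=
  Fin (nnzMat A) ≃ {p : Fin n × Fin n // A p.1 p.2 ≠ 0}

/-- Start state on input `n`, `ε`, `A`.  Variables: `n` in natural variable `0`, the number of nonzero
entries of `A` in natural variable `1`, `ε` in real variable `0`.  The `k`-th nonzero entry has its row
in natural array `0`, its column in natural array `1`, its value in real array `0`, each at index `k`.
All other cells are `0`. -/
def initState {n : ℕ} (ε : ℝ) (A : Matrix (Fin n) (Fin n) ℝ) (e : MatListing A) : State where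
  nv := fun x => if x = 0 then n else if x = 1 then nnzMat A else 0
  rv := fun x => if x = 0 then ε else 0
  na := fun a k =>
    if h : k < nnzMat A then
      if a = 0 then ((e ⟨k, h⟩).1.1 : ℕ) else if a = 1 then ((e ⟨k, h⟩).1.2 : ℕ) else 0
    else 0
  ra := fun a k =>
    if h : k < nnzMat A then
      if a = 0 then A (e ⟨k, h⟩).1.1 (e ⟨k, h⟩).1.2 else 0
    else 0
  pos := 0

/-- Arrival of an update vector `v`: the number of its nonzero entries is put into natural variable
`1`, their positions into natural array `0` and their values into real array `0`.  The rest of the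
memory is unchanged. -/
def loadUpdate {n : ℕ} (s : State) (v : Fin n → ℝ) (e : VecListing v) : State :=
  { s with
    nv := Function.update s.nv 1 (nnzVec v)
    na := Function.update s.na 0 fun k => if h : k < nnzVec v then ((e ⟨k, h⟩).1 : ℕ) else 0
    ra := Function.update s.ra 0 fun k => if h : k < nnzVec v then v (e ⟨k, h⟩).1 else 0 }

/-- The eigenvalue estimate held in memory: real variable `1`. -/
def outVal (s : State) : ℝ := s.rv 1

/-- The vector held in memory: the first `n` cells of real array `1`. -/
def outVec (n : ℕ) (s : State) : Fin n → ℝ := fun i => s.ra 1 i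

/-- The maximum eigenvalue of a symmetric matrix, `max uᵀ A u` over unit vectors `u`. -/
def lamMax {n : ℕ} (A : Matrix (Fin n) (Fin n) ℝ) : ℝ :=
  ⨆ u : {u : Fin n → ℝ // u ⬝ᵥ u = 1}, u.1 ⬝ᵥ (A *ᵥ u.1)

/-- The matrix after the first `t` updates `A ← A - v vᵀ`; the updates are `v 0, v 1, …`. -/
def matAt {n : ℕ} (A₀ : Matrix (Fin n) (Fin n) ℝ) (v : ℕ → Fin n → ℝ) (t : ℕ) :
    Matrix (Fin n) (Fin n) ℝ :=
  A₀ - ∑ i ∈ Finset.range t, Matrix.vecMulVec (v i) (v i)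

/-- `lam` is an `ε`-approximate maximum eigenvalue of `A`, and `w` an `ε`-approximate maximum
eigenvector. -/
def IsApprox {n : ℕ} (ε : ℝ) (A : Matrix (Fin n) (Fin n) ℝ) (lam : ℝ) (w : Fin n → ℝ) : Prop :=
  lam ≤ lamMax A ∧ (1 - ε) * lamMax A ≤ lam ∧
    w ⬝ᵥ w = 1 ∧ (1 - ε) * lamMax A ≤ w ⬝ᵥ (A *ᵥ w)

/-- The bound on the total time (without the implied constant). -/
def timeBound {n : ℕ} (ε : ℝ) (A₀ : Matrix (Fin n) (Fin n) ℝ) (v : ℕ → Fin n → ℝ) (T : ℕ) : ℝ :=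
  Real.log n ^ 3 * Real.log (n / ε) ^ 6 *
      max 1 (Real.log (lamMax A₀ / lamMax (matAt A₀ v T))) / ε ^ 4 *
    ((nnzMat A₀ : ℝ) + ∑ t ∈ Finset.range T, max 1 (nnzVec (v t) : ℝ))

/-- With random samples `ω`, the algorithm `P` handles the updates `v 0, …, v (T - 1)` correctly, in
total time at most `B`.  `s t` is the memory and `c t` the number of steps spent at time `t`. -/
def Succeeds (P : DynAlg) (ω : ℕ → ℝ) {n : ℕ} (ε : ℝ) (A₀ : Matrix (Fin n) (Fin n) ℝ)
    (e : MatListing A₀) (v : ℕ → Fin n → ℝ) (f : ∀ t, VecListing (v t)) (T : ℕ) (B : ℝ) : Prop :=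
  ∃ (s : ℕ → State) (c : ℕ → ℕ),
    Exec ω P.init (initState ε A₀ e) (s 0) (c 0) ∧
    (∀ t < T, Exec ω P.update (loadUpdate (s t) (v t) (f t)) (s (t + 1)) (c (t + 1))) ∧
    (∀ t ≤ T, IsApprox ε (matAt A₀ v t) (outVal (s t)) (outVec n (s t))) ∧
    -- if the final matrix is zero, the bound is infinite
    (0 < lamMax (matAt A₀ v T) → ((∑ t ∈ Finset.range (T + 1), c t : ℕ) : ℝ) ≤ B)

end DecEig

end

/-!
The algorithm is the power method with lazy recomputation.  It holds a unit vector `w` together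
with `wᵀ A w`, and recomputes `w` only when `wᵀ A w` has fallen below `1 - ε / 4` times its value
at the last recomputation.  A recomputation applies `A ^ K`, with `K` about `log n / ε`, to about
`log n` fresh Gaussian vectors, and keeps the longest image; log-convexity of the moments `gᵀ A ^ k
g` shows that it is a good approximate eigenvector (`rayleigh_of_power`), so that `w` is correct at
all times.

The point is that there are few recomputations, although the random vectors of a recomputation
influence when the next one happens.  Call a change from `A` to `A' ≤ A` small if `tr (A ^ 2K (A -
A'))` is at most a fraction of order `ε / log n` of `lamMax A * tr (A ^ 2K)`.  The updates are
fixed in advance, so the last time `τ` up to which the change stays small is not random.  For a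
Gaussian `g` and `y = A ^ K g`, the mean of `yᵀ (A - A_τ) y` is that small trace, and with high
probability no candidate exceeds the mean by more than a logarithmic factor (`GoodBlock`).  As `A -
A_t` increases with `t`, no recomputation happens up to time `τ` (`fresh_randomized`).  A
recomputation therefore means that the change was not small, and then `tr (A ^ (2K + 1))` has
dropped by a factor `1 - Ω(ε / log n)`: this uses `tr (B ^ (p + 1)) ≤ tr (A ^ p B)` for `0 ≤ B ≤ A`
(`trace_pow_succ_le`).  The trace lies between `lamMax ^ (2K + 1)` and `n * lamMax ^ (2K + 1)`,
which bounds the number of recomputations (`RunInv.cnt_le`).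

Gaussian quadratic forms are compared with a single squared normal variable by Jensen's inequality,
which needs no independence of the summands (`lintegral_exp_quad_le`).  The time of the `i`-th
recomputation depends only on earlier samples than its own block, so the failure probabilities add
up over `i` only (`measure_iUnion_selected_le`, `measure_not_goodRun_le`).  To have only
polynomially many `i`, the algorithm stops using randomness after `n ^ 16` recomputations; it then
starts the power method from all unit coordinate vectors and keeps the matrix in dense form.

The machine stores `A_t` as a list of operations `X[dst] += val * X[src]`, one for each entry of
`A_0` and two for each entry of an update, the inner product of the update vector with the argument
being accumulated in a cell of its own (`Rep`).  A multiplication by `A_t` thus costs time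
proportional to the number of entries listed so far, without ever forming the matrix.  If the limit
of `n ^ 16` recomputations is reached, their number alone exceeds the price of a dense update, so
that (number of recomputations) × (number of candidates) × `K` × (size of the input) bounds the
total time in all cases (`total_le`).

Only coordinates at which `A_0` has a nonzero diagonal entry matter, since all `A_t` vanish outside
of them; this avoids any cost proportional to `n`.
-/

namespace DecEig

open Matrix

/-! ### Traces and moments of positive semidefinite matrices -/

section Moments

variable {n : ℕ}

theorem quad_nonneg {A : Matrix (Fin n) (Fin n) ℝ} (hA : A.PosSemidef) (x : Fin n → ℝ) :
    0 ≤ x ⬝ᵥ (A *ᵥ x) := by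
  have := hA.dotProduct_mulVec_nonneg x
  simpa using this

theorem posSemidef_of_quad {A : Matrix (Fin n) (Fin n) ℝ} (hs : Aᵀ = A)
    (h : ∀ x : Fin n → ℝ, 0 ≤ x ⬝ᵥ (A *ᵥ x)) : A.PosSemidef :=
  Matrix.PosSemidef.of_dotProduct_mulVec_nonneg (by simpa [Matrix.IsHermitian] using hs)
    (by simpa using h)

theorem PosSemidef.transpose_eq {A : Matrix (Fin n) (Fin n) ℝ} (hA : A.PosSemidef) : Aᵀ = A := by
  simpa [Matrix.IsHermitian] using hA.isHermitian

theorem exists_eq_transpose_mul {A : Matrix (Fin n) (Fin n) ℝ} (hA : A.PosSemidef) :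
    ∃ B : Matrix (Fin n) (Fin n) ℝ, A = Bᵀ * B := by
  open scoped MatrixOrder in
  obtain ⟨B, hB⟩ := CStarAlgebra.nonneg_iff_eq_star_mul_self.mp hA.nonneg
  exact ⟨B, by simpa [Matrix.star_eq_conjTranspose] using hB⟩

theorem trace_transpose_mul_self_nonneg (B : Matrix (Fin n) (Fin n) ℝ) : 0 ≤ (Bᵀ * B).trace := by
  simp only [Matrix.trace, Matrix.diag, Matrix.mul_apply, Matrix.transpose_apply]
  exact Finset.sum_nonneg fun i _ => Finset.sum_nonneg fun j _ => mul_self_nonneg _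

/-- The form `(X, Y) ↦ tr (Xᵀ P Y R)` is positive semidefinite when `P` and `R` are. -/
theorem trace_sandwich_nonneg {P R : Matrix (Fin n) (Fin n) ℝ} (hP : P.PosSemidef)
    (hR : R.PosSemidef) (X : Matrix (Fin n) (Fin n) ℝ) : 0 ≤ (Xᵀ * P * X * R).trace := by
  obtain ⟨B, rfl⟩ := exists_eq_transpose_mul hP
  obtain ⟨D, rfl⟩ := exists_eq_transpose_mul hR
  have : (Xᵀ * (Bᵀ * B) * X * (Dᵀ * D)).trace = ((B * X * Dᵀ)ᵀ * (B * X * Dᵀ)).trace := by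
    rw [show Xᵀ * (Bᵀ * B) * X * (Dᵀ * D) = (Xᵀ * Bᵀ * B * X * Dᵀ) * D by
      simp only [Matrix.mul_assoc], Matrix.trace_mul_comm]
    simp only [Matrix.transpose_mul, Matrix.transpose_transpose, Matrix.mul_assoc]
  rw [this]
  exact trace_transpose_mul_self_nonneg _

theorem trace_mul_nonneg {P R : Matrix (Fin n) (Fin n) ℝ} (hP : P.PosSemidef)
    (hR : R.PosSemidef) : 0 ≤ (P * R).trace := by
  simpa using trace_sandwich_nonneg hP hR 1

theorem trace_mul_mono {P Q R : Matrix (Fin n) (Fin n) ℝ} (hP : P.PosSemidef)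
    (hQR : (R - Q).PosSemidef) : (P * Q).trace ≤ (P * R).trace := by
  have := trace_mul_nonneg hP hQR
  rw [Matrix.mul_sub, Matrix.trace_sub] at this
  linarith

/-- `tr (B ^ (p + 1)) ≤ tr (A ^ p B)` for `0 ≤ B ≤ A`, although `A` and `B` need not commute: the
sequence `s ↦ tr (A ^ s B ^ (p + 1 - s))` is convex, and its first increment is nonnegative. -/
theorem trace_pow_succ_le {A B : Matrix (Fin n) (Fin n) ℝ} (hA : A.PosSemidef) (hB : B.PosSemidef)
    (hAB : (A - B).PosSemidef) (p : ℕ) : (B ^ (p + 1)).trace ≤ (A ^ p * B).trace := by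
  have step : ∀ s r : ℕ, (A ^ s * B ^ (r + 2)).trace ≤ (A ^ (s + 1) * B ^ (r + 1)).trace →
      (A ^ (s + 1) * B ^ (r + 1)).trace ≤ (A ^ (s + 2) * B ^ r).trace := by
    intro s r h
    have key := trace_sandwich_nonneg (hA.pow s) (hB.pow r) (A - B)
    rw [PosSemidef.transpose_eq hAB] at key
    have e : ((A - B) * A ^ s * (A - B) * B ^ r).trace
        = (A ^ (s + 2) * B ^ r).trace - (A ^ (s + 1) * B ^ (r + 1)).trace
          - ((A ^ (s + 1) * B ^ (r + 1)).trace - (A ^ s * B ^ (r + 2)).trace) := by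
      have e1 : (A - B) * A ^ s * (A - B) * B ^ r
          = A ^ (s + 2) * B ^ r - A ^ (s + 1) * B ^ (r + 1) - (B * (A ^ (s + 1) * B ^ r)
            - B * (A ^ s * B ^ (r + 1))) := by
        rw [pow_succ' B r, show A ^ (s + 2) = A * A ^ s * A by rw [pow_succ, pow_succ'],
          show A ^ (s + 1) * (B * B ^ r) = A * A ^ s * B * B ^ r by
            rw [pow_succ']; simp only [Matrix.mul_assoc], pow_succ A s]
        noncomm_ring
      rw [e1, Matrix.trace_sub, Matrix.trace_sub, Matrix.trace_sub, Matrix.trace_mul_comm B,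
        Matrix.trace_mul_comm B, Matrix.mul_assoc, Matrix.mul_assoc, ← pow_succ, ← pow_succ]
    rw [e] at key
    linarith
  have first : ∀ r : ℕ, (A ^ 0 * B ^ (r + 1)).trace ≤ (A ^ 1 * B ^ r).trace := by
    intro r
    rw [pow_zero, one_mul, pow_one, pow_succ, Matrix.trace_mul_comm A]
    exact trace_mul_mono (hB.pow r) hAB
  have mono : ∀ s r : ℕ, (A ^ s * B ^ (r + 1)).trace ≤ (A ^ (s + 1) * B ^ r).trace := by
    intro s
    induction s with
    | zero => exact first
    | succ s ih => exact fun r => step s r (ih (r + 1))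
  have all : ∀ s r : ℕ, (B ^ (s + r)).trace ≤ (A ^ s * B ^ r).trace := by
    intro s
    induction s with
    | zero => intro r; simp
    | succ s ih =>
      intro r
      have := ih (r + 1)
      rw [show s + 1 + r = s + (r + 1) by ring]
      exact this.trans (mono s r)
  simpa using all p 1

theorem quad_transpose_mul (B : Matrix (Fin n) (Fin n) ℝ) (x : Fin n → ℝ) :
    x ⬝ᵥ ((Bᵀ * B) *ᵥ x) = (B *ᵥ x) ⬝ᵥ (B *ᵥ x) := by
  rw [← Matrix.mulVec_mulVec, Matrix.dotProduct_mulVec, Matrix.vecMul_transpose]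

theorem dotProduct_mulVec_symm {A : Matrix (Fin n) (Fin n) ℝ} (hA : Aᵀ = A) (x y : Fin n → ℝ) :
    x ⬝ᵥ (A *ᵥ y) = (A *ᵥ x) ⬝ᵥ y := by
  rw [Matrix.dotProduct_mulVec, ← Matrix.mulVec_transpose, hA]

/-- Moments `g ⬝ᵥ A ^ k g` are log-convex in `k`. -/
theorem moment_sq_le {A : Matrix (Fin n) (Fin n) ℝ} (hA : A.PosSemidef) (g : Fin n → ℝ) (k : ℕ) :
    (g ⬝ᵥ (A ^ (k + 1) *ᵥ g)) ^ 2 ≤ (g ⬝ᵥ (A ^ k *ᵥ g)) * (g ⬝ᵥ (A ^ (k + 2) *ᵥ g)) := by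
  have hs := PosSemidef.transpose_eq hA
  have h : ∀ c : ℝ, 0 ≤ (g ⬝ᵥ (A ^ k *ᵥ g)) * (c * c) + (-2 * (g ⬝ᵥ (A ^ (k + 1) *ᵥ g))) * c
      + g ⬝ᵥ (A ^ (k + 2) *ᵥ g) := by
    intro c
    have q := quad_nonneg (hA.pow k) (A *ᵥ g - c • g)
    have e1 : (A *ᵥ g) ⬝ᵥ (A ^ k *ᵥ g) = g ⬝ᵥ (A ^ (k + 1) *ᵥ g) := by
      rw [← dotProduct_mulVec_symm hs, Matrix.mulVec_mulVec, ← pow_succ']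
    have e2 : g ⬝ᵥ (A ^ k *ᵥ (A *ᵥ g)) = g ⬝ᵥ (A ^ (k + 1) *ᵥ g) := by
      rw [Matrix.mulVec_mulVec, ← pow_succ]
    have e3 : (A *ᵥ g) ⬝ᵥ (A ^ k *ᵥ (A *ᵥ g)) = g ⬝ᵥ (A ^ (k + 2) *ᵥ g) := by
      rw [← dotProduct_mulVec_symm hs, Matrix.mulVec_mulVec, Matrix.mulVec_mulVec,
        pow_succ A (k + 1), pow_succ']
    simp only [Matrix.mulVec_sub, Matrix.mulVec_smul, sub_dotProduct, dotProduct_sub,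
      smul_dotProduct, dotProduct_smul, smul_eq_mul, e1, e2, e3] at q
    linarith
  have := discrim_le_zero h
  rw [discrim] at this
  nlinarith

/-- If the last moment ratio is at most `μ`, so are all the earlier ones. -/
theorem moment_le_pow {A : Matrix (Fin n) (Fin n) ℝ} (hA : A.PosSemidef) (g : Fin n → ℝ) {μ : ℝ}
    (hμ : 0 ≤ μ) (N : ℕ) (h : g ⬝ᵥ (A ^ (N + 1) *ᵥ g) ≤ μ * (g ⬝ᵥ (A ^ N *ᵥ g))) :
    g ⬝ᵥ (A ^ N *ᵥ g) ≤ μ ^ N * (g ⬝ᵥ g) := by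
  induction N with
  | zero => simp
  | succ N ih =>
    have h0 := quad_nonneg (hA.pow N) g
    have h1 := quad_nonneg (hA.pow (N + 1)) g
    have sq := moment_sq_le hA g N
    have : g ⬝ᵥ (A ^ (N + 1) *ᵥ g) ≤ μ * (g ⬝ᵥ (A ^ N *ᵥ g)) := by
      rcases h1.eq_or_lt with h1 | h1
      · rw [← h1]; positivity
      · have : g ⬝ᵥ (A ^ (N + 1) *ᵥ g) * g ⬝ᵥ (A ^ (N + 1) *ᵥ g)
            ≤ (μ * g ⬝ᵥ (A ^ N *ᵥ g)) * g ⬝ᵥ (A ^ (N + 1) *ᵥ g) := by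
          calc _ = (g ⬝ᵥ (A ^ (N + 1) *ᵥ g)) ^ 2 := by ring
            _ ≤ _ := sq
            _ ≤ (g ⬝ᵥ (A ^ N *ᵥ g)) * (μ * (g ⬝ᵥ (A ^ (N + 1) *ᵥ g))) :=
              mul_le_mul_of_nonneg_left h h0
            _ = _ := by ring
        exact le_of_mul_le_mul_right this h1
    calc _ ≤ μ * (g ⬝ᵥ (A ^ N *ᵥ g)) := this
      _ ≤ μ * (μ ^ N * (g ⬝ᵥ g)) := mul_le_mul_of_nonneg_left (ih this) hμ
      _ = _ := by ring

theorem quad_pow_le {A : Matrix (Fin n) (Fin n) ℝ} (hA : A.PosSemidef) {u : Fin n → ℝ}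
    (hu : u ⬝ᵥ u = 1) (N : ℕ) : (u ⬝ᵥ (A *ᵥ u)) ^ N ≤ u ⬝ᵥ (A ^ N *ᵥ u) := by
  have ha := quad_nonneg hA u
  have ratio : ∀ k : ℕ, (u ⬝ᵥ (A *ᵥ u)) * (u ⬝ᵥ (A ^ k *ᵥ u)) ≤ u ⬝ᵥ (A ^ (k + 1) *ᵥ u) := by
    intro k
    induction k with
    | zero => simp [hu]
    | succ k ih =>
      have h0 := quad_nonneg (hA.pow k) u
      have h1 := quad_nonneg (hA.pow (k + 1)) u
      have h2 := quad_nonneg (hA.pow (k + 2)) u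
      have sq := moment_sq_le hA u k
      rcases h0.eq_or_lt with h0 | h0
      · rw [← h0, zero_mul] at sq
        have : u ⬝ᵥ (A ^ (k + 1) *ᵥ u) = 0 := by nlinarith
        rw [this, mul_zero]; exact h2
      · have : (u ⬝ᵥ (A ^ k *ᵥ u)) * ((u ⬝ᵥ (A *ᵥ u)) * (u ⬝ᵥ (A ^ (k + 1) *ᵥ u)))
            ≤ (u ⬝ᵥ (A ^ k *ᵥ u)) * (u ⬝ᵥ (A ^ (k + 2) *ᵥ u)) := by
          calc _ = ((u ⬝ᵥ (A *ᵥ u)) * (u ⬝ᵥ (A ^ k *ᵥ u))) * (u ⬝ᵥ (A ^ (k + 1) *ᵥ u)) := by ring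
            _ ≤ (u ⬝ᵥ (A ^ (k + 1) *ᵥ u)) * (u ⬝ᵥ (A ^ (k + 1) *ᵥ u)) :=
              mul_le_mul_of_nonneg_right ih h1
            _ = (u ⬝ᵥ (A ^ (k + 1) *ᵥ u)) ^ 2 := by ring
            _ ≤ _ := sq
        exact le_of_mul_le_mul_left this h0
  induction N with
  | zero => simp [hu]
  | succ N ih =>
    calc _ = (u ⬝ᵥ (A *ᵥ u)) * (u ⬝ᵥ (A *ᵥ u)) ^ N := by ring
      _ ≤ _ := mul_le_mul_of_nonneg_left ih ha
      _ ≤ _ := ratio N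

theorem quad_le_trace {A : Matrix (Fin n) (Fin n) ℝ} (hA : A.PosSemidef) (u : Fin n → ℝ) :
    u ⬝ᵥ (A *ᵥ u) ≤ A.trace * (u ⬝ᵥ u) := by
  obtain ⟨B, rfl⟩ := exists_eq_transpose_mul hA
  rw [quad_transpose_mul]
  have e : (Bᵀ * B).trace = ∑ r, ∑ i, B r i * B r i := by
    simp only [Matrix.trace, Matrix.diag, Matrix.mul_apply, Matrix.transpose_apply]
    exact Finset.sum_comm
  rw [e, dotProduct, Finset.sum_mul]
  refine Finset.sum_le_sum fun r _ => ?_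
  have := Finset.sum_mul_sq_le_sq_mul_sq Finset.univ (fun i => B r i) u
  simp only [Matrix.mulVec, dotProduct]
  calc _ = (∑ i, B r i * u i) ^ 2 := by ring
    _ ≤ _ := this
    _ = _ := by simp only [sq]

end Moments

/-! ### The maximum eigenvalue -/

section LamMax

variable {n : ℕ}

theorem bddAbove_quad (A : Matrix (Fin n) (Fin n) ℝ) :
    BddAbove (Set.range fun u : {u : Fin n → ℝ // u ⬝ᵥ u = 1} => u.1 ⬝ᵥ (A *ᵥ u.1)) := by
  refine ⟨∑ i, ∑ j, |A i j|, ?_⟩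
  rintro _ ⟨⟨u, hu⟩, rfl⟩
  have hb : ∀ i, |u i| ≤ 1 := by
    intro i
    have : u i * u i ≤ 1 := by
      rw [← hu, dotProduct]
      exact Finset.single_le_sum (f := fun i => u i * u i) (fun j _ => mul_self_nonneg _)
        (Finset.mem_univ i)
    exact abs_le_one_iff_mul_self_le_one.2 this
  simp only [dotProduct, Matrix.mulVec, Finset.mul_sum]
  refine Finset.sum_le_sum fun i _ => Finset.sum_le_sum fun j _ => ?_
  calc _ ≤ |u i * (A i j * u j)| := le_abs_self _
    _ = |u i| * (|A i j| * |u j|) := by rw [abs_mul, abs_mul]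
    _ ≤ 1 * (|A i j| * 1) := by
      gcongr
      · exact hb i
      · exact hb j
    _ = _ := by ring

theorem quad_le_lamMax_of_unit (A : Matrix (Fin n) (Fin n) ℝ) {u : Fin n → ℝ} (hu : u ⬝ᵥ u = 1) :
    u ⬝ᵥ (A *ᵥ u) ≤ lamMax A :=
  le_ciSup (bddAbove_quad A) ⟨u, hu⟩

theorem dotProduct_self_nonneg' (u : Fin n → ℝ) : 0 ≤ u ⬝ᵥ u :=
  Finset.sum_nonneg fun i _ => mul_self_nonneg (u i)

theorem smul_inv_sqrt_unit {u : Fin n → ℝ} (hu : 0 < u ⬝ᵥ u) :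
    ((√(u ⬝ᵥ u))⁻¹ • u) ⬝ᵥ ((√(u ⬝ᵥ u))⁻¹ • u) = 1 := by
  have h : √(u ⬝ᵥ u) * √(u ⬝ᵥ u) = u ⬝ᵥ u := Real.mul_self_sqrt hu.le
  have h0 : √(u ⬝ᵥ u) ≠ 0 := (Real.sqrt_pos.2 hu).ne'
  rw [smul_dotProduct, dotProduct_smul, smul_eq_mul, smul_eq_mul]
  field_simp
  rw [sq, h]

theorem quad_smul_inv_sqrt (A : Matrix (Fin n) (Fin n) ℝ) {u : Fin n → ℝ} (hu : 0 < u ⬝ᵥ u) :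
    ((√(u ⬝ᵥ u))⁻¹ • u) ⬝ᵥ (A *ᵥ ((√(u ⬝ᵥ u))⁻¹ • u)) = (u ⬝ᵥ (A *ᵥ u)) / (u ⬝ᵥ u) := by
  have h : √(u ⬝ᵥ u) * √(u ⬝ᵥ u) = u ⬝ᵥ u := Real.mul_self_sqrt hu.le
  rw [Matrix.mulVec_smul, smul_dotProduct, dotProduct_smul, smul_eq_mul, smul_eq_mul, ← mul_assoc,
    ← mul_inv, h, inv_mul_eq_div]

theorem quad_le_lamMax (A : Matrix (Fin n) (Fin n) ℝ) (u : Fin n → ℝ) :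
    u ⬝ᵥ (A *ᵥ u) ≤ lamMax A * (u ⬝ᵥ u) := by
  rcases (dotProduct_self_nonneg' u).eq_or_lt with h | h
  · have : u = 0 := dotProduct_self_eq_zero.1 h.symm
    simp [this]
  · have := quad_le_lamMax_of_unit A (smul_inv_sqrt_unit h)
    rw [quad_smul_inv_sqrt A h, div_le_iff₀ h] at this
    exact this

theorem unit_single [NeZero n] (i : Fin n) : (Pi.single i 1 : Fin n → ℝ) ⬝ᵥ Pi.single i 1 = 1 := by
  simp

theorem lamMax_le [NeZero n] {A : Matrix (Fin n) (Fin n) ℝ} {c : ℝ}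
    (h : ∀ u : Fin n → ℝ, u ⬝ᵥ u = 1 → u ⬝ᵥ (A *ᵥ u) ≤ c) : lamMax A ≤ c := by
  have : Nonempty {u : Fin n → ℝ // u ⬝ᵥ u = 1} := ⟨⟨Pi.single 0 1, unit_single 0⟩⟩
  exact ciSup_le fun u => h u.1 u.2

theorem lamMax_nonneg [NeZero n] {A : Matrix (Fin n) (Fin n) ℝ} (hA : A.PosSemidef) :
    0 ≤ lamMax A :=
  (quad_nonneg hA _).trans (quad_le_lamMax_of_unit A (unit_single 0))

theorem lamMax_mono [NeZero n] {A B : Matrix (Fin n) (Fin n) ℝ} (h : (A - B).PosSemidef) :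
    lamMax B ≤ lamMax A := by
  refine lamMax_le fun u hu => ?_
  have := quad_nonneg h u
  rw [Matrix.sub_mulVec, dotProduct_sub] at this
  have := quad_le_lamMax_of_unit A hu
  linarith

theorem posSemidef_lamMax_sub {A : Matrix (Fin n) (Fin n) ℝ} (hA : A.PosSemidef) :
    (lamMax A • (1 : Matrix (Fin n) (Fin n) ℝ) - A).PosSemidef := by
  refine posSemidef_of_quad ?_ fun x => ?_
  · rw [Matrix.transpose_sub, Matrix.transpose_smul, Matrix.transpose_one,
      PosSemidef.transpose_eq hA]
  · rw [Matrix.sub_mulVec, dotProduct_sub, Matrix.smul_mulVec, Matrix.one_mulVec, dotProduct_smul,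
      smul_eq_mul]
    linarith [quad_le_lamMax A x]

theorem trace_pow_nonneg {A : Matrix (Fin n) (Fin n) ℝ} (hA : A.PosSemidef) (N : ℕ) :
    0 ≤ (A ^ N).trace := by simpa using trace_mul_nonneg (hA.pow N) Matrix.PosSemidef.one

theorem trace_pow_succ_le_lamMax {A : Matrix (Fin n) (Fin n) ℝ} (hA : A.PosSemidef) (N : ℕ) :
    (A ^ (N + 1)).trace ≤ lamMax A * (A ^ N).trace := by
  have := trace_mul_mono (hA.pow N) (posSemidef_lamMax_sub hA)
  rw [Matrix.mul_smul, Matrix.mul_one, Matrix.trace_smul, smul_eq_mul, ← pow_succ] at this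
  exact this

theorem trace_pow_le [NeZero n] {A : Matrix (Fin n) (Fin n) ℝ} (hA : A.PosSemidef) (N : ℕ) :
    (A ^ N).trace ≤ n * lamMax A ^ N := by
  induction N with
  | zero => simp
  | succ N ih =>
    calc _ ≤ _ := trace_pow_succ_le_lamMax hA N
      _ ≤ lamMax A * (n * lamMax A ^ N) := mul_le_mul_of_nonneg_left ih (lamMax_nonneg hA)
      _ = _ := by ring

theorem lamMax_pow_le_trace [NeZero n] {A : Matrix (Fin n) (Fin n) ℝ} (hA : A.PosSemidef) (N : ℕ)
    (hN : N ≠ 0) : lamMax A ^ N ≤ (A ^ N).trace := by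
  have ht := trace_pow_nonneg hA N
  have : lamMax A ≤ ((A ^ N).trace) ^ ((N : ℝ)⁻¹) := by
    refine lamMax_le fun u hu => ?_
    have h1 := (quad_pow_le hA hu N).trans (quad_le_trace (hA.pow N) u)
    rw [hu, mul_one] at h1
    rw [← Real.pow_rpow_inv_natCast (quad_nonneg hA u) hN]
    exact Real.rpow_le_rpow (pow_nonneg (quad_nonneg hA u) N) h1 (by positivity)
  calc _ ≤ (((A ^ N).trace) ^ ((N : ℝ)⁻¹)) ^ N := pow_le_pow_left₀ (lamMax_nonneg hA) this N
    _ = _ := Real.rpow_inv_natCast_pow ht hN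

theorem eq_zero_of_lamMax_eq_zero {A : Matrix (Fin n) (Fin n) ℝ} (hA : A.PosSemidef)
    (h : lamMax A = 0) : A = 0 := by
  have := trace_pow_succ_le_lamMax hA 0
  rw [h, zero_mul, zero_add, pow_one] at this
  have h0 : A.trace = 0 := le_antisymm this (by simpa using trace_pow_nonneg hA 1)
  obtain ⟨B, rfl⟩ := exists_eq_transpose_mul hA
  have := (Matrix.trace_conjTranspose_mul_self_eq_zero_iff (A := B)).1 (by simpa using h0)
  simp [this]

/-- Power iteration: a starting vector whose image under `A ^ K` is not much shorter than
`lamMax A ^ K` has, after `K` steps, a Rayleigh quotient close to the maximum. -/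
theorem rayleigh_of_power {A : Matrix (Fin n) (Fin n) ℝ} (hA : A.PosSemidef) (g : Fin n → ℝ)
    (K : ℕ) {η c : ℝ} (hη1 : η ≤ 1) (hlam : 0 < lamMax A)
    (hc : Real.exp (-(2 * K * η)) * (g ⬝ᵥ g) < c)
    (hlow : c * lamMax A ^ (2 * K) ≤ (A ^ K *ᵥ g) ⬝ᵥ (A ^ K *ᵥ g)) :
    (1 - η) * lamMax A * ((A ^ K *ᵥ g) ⬝ᵥ (A ^ K *ᵥ g))
      ≤ (A ^ K *ᵥ g) ⬝ᵥ (A *ᵥ (A ^ K *ᵥ g)) := by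
  have hs := PosSemidef.transpose_eq (hA.pow K)
  have e0 : (A ^ K *ᵥ g) ⬝ᵥ (A ^ K *ᵥ g) = g ⬝ᵥ (A ^ (2 * K) *ᵥ g) := by
    rw [← dotProduct_mulVec_symm hs, Matrix.mulVec_mulVec, ← pow_add, two_mul]
  have e1 : (A ^ K *ᵥ g) ⬝ᵥ (A *ᵥ (A ^ K *ᵥ g)) = g ⬝ᵥ (A ^ (2 * K + 1) *ᵥ g) := by
    rw [← dotProduct_mulVec_symm hs, Matrix.mulVec_mulVec, Matrix.mulVec_mulVec, ← pow_succ,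
      ← pow_add]
    congr 3; ring
  rw [e0] at hlow ⊢
  rw [e1]
  by_contra! hcon
  have hμ : 0 ≤ (1 - η) * lamMax A := mul_nonneg (by linarith) hlam.le
  have h1 := moment_le_pow hA g hμ (2 * K) hcon.le
  have h2 : (1 - η) ^ (2 * K) ≤ Real.exp (-(2 * K * η)) := by
    calc _ ≤ (Real.exp (-η)) ^ (2 * K) :=
          pow_le_pow_left₀ (by linarith) (Real.one_sub_le_exp_neg η) _
      _ = _ := by rw [← Real.exp_nat_mul]; push_cast; ring_nf
  have h3 : c * lamMax A ^ (2 * K) ≤ (Real.exp (-(2 * K * η)) * (g ⬝ᵥ g)) * lamMax A ^ (2 * K) := by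
    calc _ ≤ _ := hlow
      _ ≤ _ := h1
      _ = ((1 - η) ^ (2 * K) * (g ⬝ᵥ g)) * lamMax A ^ (2 * K) := by rw [mul_pow]; ring
      _ ≤ _ := by
        gcongr
        exact dotProduct_self_nonneg' g
  have := le_of_mul_le_mul_right h3 (pow_pos hlam _)
  linarith

end LamMax

end DecEig

namespace DecEig

open MeasureTheory ProbabilityTheory RealRAM
open scoped ENNReal NNReal

/-! ### Quadratic forms of Gaussian vectors -/

instance : IsProbabilityMeasure sampleLaw := by
  unfold sampleLaw
  infer_instance

theorem iIndepFun_sample : iIndepFun (fun (i : ℕ) (ω : ℕ → ℝ) => ω i) sampleLaw :=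
  iIndepFun_infinitePi (X := fun _ x => x) (fun _ => measurable_id)

theorem map_sample (i : ℕ) : sampleLaw.map (fun ω : ℕ → ℝ => ω i) = gaussianReal 0 1 :=
  Measure.infinitePi_map_eval (fun _ : ℕ => gaussianReal 0 1) i

theorem map_sum_sample {d : ℕ} {ι : Fin d → ℕ} (hι : Function.Injective ι) (c : Fin d → ℝ) :
    sampleLaw.map (fun ω : ℕ → ℝ => ∑ k, c k * ω (ι k))
      = gaussianReal 0 (Real.toNNReal (∑ k, c k ^ 2)) := by
  have hind : iIndepFun (fun (k : Fin d) (ω : ℕ → ℝ) => c k * ω (ι k)) sampleLaw :=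
    (iIndepFun_sample.precomp hι).comp (fun k x => c k * x) (fun k => by fun_prop)
  have key : ∀ s : Finset (Fin d), sampleLaw.map (∑ k ∈ s, fun ω : ℕ → ℝ => c k * ω (ι k))
      = gaussianReal 0 (Real.toNNReal (∑ k ∈ s, c k ^ 2)) := by
    intro s
    induction s using Finset.induction_on with
    | empty =>
      simp only [Finset.sum_empty, Real.toNNReal_zero, gaussianReal_zero_var]
      rw [show (0 : (ℕ → ℝ) → ℝ) = fun _ => 0 from rfl, Measure.map_const]
      simp
    | insert a s ha ih =>
      rw [Finset.sum_insert ha, Finset.sum_insert ha,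
        Real.toNNReal_add (sq_nonneg _) (Finset.sum_nonneg fun _ _ => sq_nonneg _)]
      have h1 : sampleLaw.map (fun ω : ℕ → ℝ => c a * ω (ι a))
          = gaussianReal 0 (Real.toNNReal (c a ^ 2)) := by
        have := gaussianReal_map_const_mul (μ := 0) (v := 1) (c a)
        rw [← map_sample (ι a), Measure.map_map (by fun_prop) (by fun_prop)] at this
        rw [show (fun ω : ℕ → ℝ => c a * ω (ι a)) = (fun x => c a * x) ∘ fun ω : ℕ → ℝ => ω (ι a)
          from rfl, this]
        congr 1
        · simp
        · rw [mul_one]; ext; simp [sq_nonneg]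
      have hi := (hind.indepFun_finsetSum_of_notMem (fun k => by fun_prop) ha).symm
      have := gaussianReal_add_gaussianReal_of_indepFun hi h1 ih
      rw [this, add_zero]
  have := key Finset.univ
  rw [← this]
  congr 1
  ext ω
  simp

theorem lintegral_exp_sq_gaussian {θ : ℝ} (hθ : θ < 1 / 2) :
    ∫⁻ x, ENNReal.ofReal (Real.exp (θ * x ^ 2)) ∂(gaussianReal 0 1)
      = ENNReal.ofReal (√(1 - 2 * θ))⁻¹ := by
  rw [gaussianReal_of_var_ne_zero 0 one_ne_zero,
    lintegral_withDensity_eq_lintegral_mul _ (measurable_gaussianPDF 0 1) (by fun_prop)]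
  have e : ∀ x : ℝ, (gaussianPDF 0 1 * fun x => ENNReal.ofReal (Real.exp (θ * x ^ 2))) x
      = ENNReal.ofReal ((√(2 * Real.pi))⁻¹ * Real.exp (-(1 / 2 - θ) * x ^ 2)) := by
    intro x
    rw [Pi.mul_apply, gaussianPDF, ← ENNReal.ofReal_mul (gaussianPDFReal_nonneg _ _ _),
      gaussianPDFReal]
    congr 1
    rw [mul_assoc, ← Real.exp_add]
    simp only [NNReal.coe_one, mul_one, sub_zero]
    congr 2
    ring
  simp_rw [e]
  rw [← ofReal_integral_eq_lintegral_ofReal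
    ((integrable_exp_neg_mul_sq (by linarith)).const_mul _) (ae_of_all _ fun x => by positivity),
    integral_const_mul, integral_gaussian]
  congr 1
  rw [← Real.sqrt_inv, ← Real.sqrt_inv, ← Real.sqrt_mul (by positivity)]
  congr 1
  have : 1 - 2 * θ ≠ 0 := by linarith
  have : 1 / 2 - θ ≠ 0 := by linarith
  have := Real.pi_ne_zero
  field_simp

/-- For a quadratic form `Σ Xᵣ²` in centred Gaussian variables, dependent or not, the exponential
moment of `Σ Xᵣ² / E Σ Xᵣ²` is at most that of the square of one standard normal variable, by
Jensen's inequality for the weights `E Xᵣ² / E Σ Xᵣ²`. -/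
theorem lintegral_exp_quad_le {Ω : Type*} [MeasurableSpace Ω] {P : Measure Ω} {R : Type*}
    [Fintype R] {X : R → Ω → ℝ} {v : R → ℝ} (hm : ∀ r, Measurable (X r)) (hv : ∀ r, 0 ≤ v r)
    (hX : ∀ r, P.map (X r) = gaussianReal 0 (Real.toNNReal (v r)))
    (hF : 0 < ∑ r, v r) {θ : ℝ} (hθ : θ < 1 / 2) :
    ∫⁻ ω, ENNReal.ofReal (Real.exp (θ * ((∑ r, X r ω ^ 2) / ∑ r, v r))) ∂P
      ≤ ENNReal.ofReal (√(1 - 2 * θ))⁻¹ := by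
  set F := ∑ r, v r with hFdef
  have hw1 : ∑ r, v r / F = 1 := by rw [← Finset.sum_div, div_self hF.ne']
  have hzero : ∀ r, v r = 0 → ∀ᵐ ω ∂P, X r ω = 0 := by
    intro r hr
    have := hX r
    rw [hr, Real.toNNReal_zero, gaussianReal_zero_var] at this
    have h2 : ∀ᵐ x ∂(P.map (X r)), x = 0 := by rw [this, ae_dirac_eq]; simp
    exact ae_of_ae_map (hm r).aemeasurable h2
  have hpt : ∀ᵐ ω ∂P, ENNReal.ofReal (Real.exp (θ * ((∑ r, X r ω ^ 2) / F)))
      ≤ ∑ r, ENNReal.ofReal (v r / F) *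
        ENNReal.ofReal (Real.exp (θ * ((√(v r))⁻¹ * X r ω) ^ 2)) := by
    have hall : ∀ᵐ ω ∂P, ∀ r, v r = 0 → X r ω = 0 := by
      rw [ae_all_iff]
      intro r
      by_cases hr : v r = 0
      · filter_upwards [hzero r hr] with ω h _ using h
      · exact ae_of_all _ fun ω h => absurd h hr
    filter_upwards [hall] with ω hω
    have hj := convexOn_exp.map_sum_le (t := Finset.univ) (w := fun r => v r / F)
      (p := fun r => θ * ((√(v r))⁻¹ * X r ω) ^ 2) (fun r _ => div_nonneg (hv r) hF.le) hw1
      (fun r _ => Set.mem_univ _)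
    have e : ∑ r, (v r / F) • (θ * ((√(v r))⁻¹ * X r ω) ^ 2) = θ * ((∑ r, X r ω ^ 2) / F) := by
      rw [Finset.sum_div, Finset.mul_sum]
      refine Finset.sum_congr rfl fun r _ => ?_
      by_cases hr : v r = 0
      · rw [hω r hr, hr]; simp
      · rw [smul_eq_mul, mul_pow, inv_pow, Real.sq_sqrt (hv r)]
        field_simp
    rw [e] at hj
    calc _ ≤ ENNReal.ofReal (∑ r, (v r / F) • Real.exp (θ * ((√(v r))⁻¹ * X r ω) ^ 2)) :=
          ENNReal.ofReal_le_ofReal hj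
      _ = _ := by
        rw [ENNReal.ofReal_sum_of_nonneg fun r _ => by
          have := hv r
          positivity]
        refine Finset.sum_congr rfl fun r _ => ?_
        rw [smul_eq_mul, ENNReal.ofReal_mul (div_nonneg (hv r) hF.le)]
  calc _ ≤ ∫⁻ ω, ∑ r, ENNReal.ofReal (v r / F) *
        ENNReal.ofReal (Real.exp (θ * ((√(v r))⁻¹ * X r ω) ^ 2)) ∂P := lintegral_mono_ae hpt
    _ = ∑ r, ENNReal.ofReal (v r / F) *
        ∫⁻ ω, ENNReal.ofReal (Real.exp (θ * ((√(v r))⁻¹ * X r ω) ^ 2)) ∂P := by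
      rw [lintegral_finsetSum' _ fun r _ => by
        have := hm r
        fun_prop]
      refine Finset.sum_congr rfl fun r _ => ?_
      have := hm r
      rw [lintegral_const_mul _ (by fun_prop)]
    _ ≤ ∑ r, ENNReal.ofReal (v r / F) * ENNReal.ofReal (√(1 - 2 * θ))⁻¹ := by
      refine Finset.sum_le_sum fun r _ => ?_
      rcases (hv r).eq_or_lt with hr | hr
      · simp [← hr]
      · refine mul_le_mul_right (le_of_eq ?_) _
        rw [← lintegral_exp_sq_gaussian hθ]
        have h1 : P.map (fun ω => (√(v r))⁻¹ * X r ω) = gaussianReal 0 1 := by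
          rw [show (fun ω => (√(v r))⁻¹ * X r ω) = (fun x => (√(v r))⁻¹ * x) ∘ X r from rfl,
            ← Measure.map_map (by fun_prop) (hm r), hX r, gaussianReal_map_const_mul]
          congr 1
          · simp
          · ext
            rw [NNReal.coe_mul]
            simp only [NNReal.coe_mk, NNReal.coe_one, Real.coe_toNNReal _ hr.le, inv_pow,
              Real.sq_sqrt hr.le]
            exact inv_mul_cancel₀ hr.ne'
        have hmr := hm r
        rw [← h1, lintegral_map (by fun_prop) (by fun_prop)]
    _ = _ := by
      rw [← Finset.sum_mul, ← ENNReal.ofReal_sum_of_nonneg fun r _ => div_nonneg (hv r) hF.le, hw1,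
        ENNReal.ofReal_one, one_mul]

/-- Upper tail of a Gaussian quadratic form, by Markov's inequality for the exponential moment
`θ = 1 / 4`. -/
theorem measure_quad_gt_le {Ω : Type*} [MeasurableSpace Ω] {P : Measure Ω} [IsProbabilityMeasure P]
    {R : Type*} [Fintype R] {X : R → Ω → ℝ} {v : R → ℝ} (hm : ∀ r, Measurable (X r))
    (hv : ∀ r, 0 ≤ v r) (hX : ∀ r, P.map (X r) = gaussianReal 0 (Real.toNNReal (v r)))
    {s F : ℝ} (hs : 0 ≤ s) (hF : ∑ r, v r ≤ F) :
    P {ω | s * F < ∑ r, X r ω ^ 2} ≤ ENNReal.ofReal (2 * Real.exp (-(s / 4))) := by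
  have hF0 : 0 ≤ ∑ r, v r := Finset.sum_nonneg fun r _ => hv r
  rcases hF0.eq_or_lt with h0 | h0
  · have hz : ∀ r, v r = 0 := fun r =>
      (Finset.sum_eq_zero_iff_of_nonneg fun r _ => hv r).1 h0.symm r (Finset.mem_univ r)
    have hall : ∀ᵐ ω ∂P, ∀ r, X r ω = 0 := by
      rw [ae_all_iff]
      intro r
      have := hX r
      rw [hz r, Real.toNNReal_zero, gaussianReal_zero_var] at this
      have h2 : ∀ᵐ x ∂(P.map (X r)), x = 0 := by rw [this, ae_dirac_eq]; simp
      exact ae_of_ae_map (hm r).aemeasurable h2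
    have : P {ω | s * F < ∑ r, X r ω ^ 2} = 0 := by
      refine measure_mono_null ?_ hall
      intro ω hω
      simp only [Set.mem_compl_iff, Set.mem_ofPred_eq] at hω ⊢
      intro hcon
      have : ∑ r, X r ω ^ 2 = 0 := Finset.sum_eq_zero fun r _ => by simp [hcon r]
      rw [this] at hω
      have : 0 ≤ s * F := mul_nonneg hs (hF0.trans hF)
      linarith
    rw [this]
    exact zero_le
  · have h1 := lintegral_exp_quad_le hm hv hX h0 (θ := 1 / 4) (by norm_num)
    have h2 := mul_meas_ge_le_lintegral (μ := P)
      (f := fun ω => ENNReal.ofReal (Real.exp (1 / 4 * ((∑ r, X r ω ^ 2) / ∑ r, v r))))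
      (by fun_prop) (ENNReal.ofReal (Real.exp (s / 4)))
    have h3 : P {ω | s * F < ∑ r, X r ω ^ 2} ≤ P {ω | ENNReal.ofReal (Real.exp (s / 4))
        ≤ ENNReal.ofReal (Real.exp (1 / 4 * ((∑ r, X r ω ^ 2) / ∑ r, v r)))} := by
      refine measure_mono fun ω hω => ?_
      simp only [Set.mem_ofPred_eq] at hω ⊢
      refine ENNReal.ofReal_le_ofReal (Real.exp_le_exp.2 ?_)
      have : s ≤ (∑ r, X r ω ^ 2) / ∑ r, v r := by
        rw [le_div_iff₀ h0]
        exact (mul_le_mul_of_nonneg_left hF hs).trans hω.le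
      linarith
    have h4 : (√(1 - 2 * (1 / 4 : ℝ)))⁻¹ ≤ 2 := by
      rw [inv_le_comm₀ (by rw [Real.sqrt_pos]; norm_num) (by norm_num)]
      exact Real.le_sqrt_of_sq_le (by norm_num)
    have h5 : ENNReal.ofReal (2 * Real.exp (-(s / 4)))
        = ENNReal.ofReal 2 / ENNReal.ofReal (Real.exp (s / 4)) := by
      rw [← ENNReal.ofReal_div_of_pos (Real.exp_pos _), Real.exp_neg]
      rfl
    rw [h5]
    refine h3.trans ?_
    rw [ENNReal.le_div_iff_mul_le (Or.inl (by simp [Real.exp_pos])) (Or.inl ENNReal.ofReal_ne_top),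
      mul_comm]
    exact h2.trans (h1.trans (ENNReal.ofReal_le_ofReal h4))

/-- A Gaussian quadratic form is at least a tenth of its mean with probability `1 / 2`, by Markov's
inequality for the exponential moment `θ = -4`. -/
theorem measure_quad_lt_le {Ω : Type*} [MeasurableSpace Ω] {P : Measure Ω} [IsProbabilityMeasure P]
    {R : Type*} [Fintype R] {X : R → Ω → ℝ} {v : R → ℝ} (hm : ∀ r, Measurable (X r))
    (hv : ∀ r, 0 ≤ v r) (hX : ∀ r, P.map (X r) = gaussianReal 0 (Real.toNNReal (v r))) :
    P {ω | ∑ r, X r ω ^ 2 < (∑ r, v r) / 10} ≤ 1 / 2 := by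
  have hF0 : 0 ≤ ∑ r, v r := Finset.sum_nonneg fun r _ => hv r
  rcases hF0.eq_or_lt with h0 | h0
  · rw [← h0]
    have : {ω | ∑ r, X r ω ^ 2 < 0 / 10} = ∅ := by
      ext ω
      simp only [zero_div, Set.mem_ofPred_eq, Set.mem_empty_iff_false, iff_false, not_lt]
      positivity
    rw [this]
    simp
  · have h1 := lintegral_exp_quad_le hm hv hX h0 (θ := -4) (by norm_num)
    have h2 := mul_meas_ge_le_lintegral (μ := P)
      (f := fun ω => ENNReal.ofReal (Real.exp (-4 * ((∑ r, X r ω ^ 2) / ∑ r, v r))))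
      (by fun_prop) (ENNReal.ofReal (Real.exp (-(2 / 5))))
    have h3 : P {ω | ∑ r, X r ω ^ 2 < (∑ r, v r) / 10} ≤ P {ω | ENNReal.ofReal (Real.exp (-(2 / 5)))
        ≤ ENNReal.ofReal (Real.exp (-4 * ((∑ r, X r ω ^ 2) / ∑ r, v r)))} := by
      refine measure_mono fun ω hω => ?_
      simp only [Set.mem_ofPred_eq] at hω ⊢
      refine ENNReal.ofReal_le_ofReal (Real.exp_le_exp.2 ?_)
      have : (∑ r, X r ω ^ 2) / ∑ r, v r ≤ 1 / 10 := by
        rw [div_le_iff₀ h0]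
        linarith
      linarith
    have h4 : (√(1 - 2 * (-4 : ℝ)))⁻¹ = 1 / 3 := by
      rw [show (1 - 2 * (-4 : ℝ)) = 3 ^ 2 by norm_num, Real.sqrt_sq (by norm_num)]
      norm_num
    have h6 : Real.exp (2 / 5) ≤ 3 / 2 := by
      have h : Real.exp (2 / 5) ^ 5 ≤ (3 / 2) ^ 5 := by
        rw [← Real.exp_nat_mul]
        have : ((5 : ℕ) : ℝ) * (2 / 5) = 1 + 1 := by norm_num
        rw [this, Real.exp_add]
        have := Real.exp_one_lt_d9
        have := Real.exp_pos 1
        nlinarith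
      exact le_of_pow_le_pow_left₀ (by norm_num) (by norm_num) h
    have h5 : ENNReal.ofReal (1 / 3) / ENNReal.ofReal (Real.exp (-(2 / 5))) ≤ 1 / 2 := by
      rw [← ENNReal.ofReal_div_of_pos (Real.exp_pos _), Real.exp_neg, div_inv_eq_mul]
      calc _ ≤ ENNReal.ofReal (1 / 2) := ENNReal.ofReal_le_ofReal (by linarith)
        _ = _ := by rw [ENNReal.ofReal_div_of_pos (by norm_num)]; simp
    refine h3.trans (le_trans ?_ h5)
    rw [ENNReal.le_div_iff_mul_le (Or.inl (by simp [Real.exp_pos])) (Or.inl ENNReal.ofReal_ne_top),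
      mul_comm, ← h4]
    exact h2.trans h1

/-! ### Independence of disjoint blocks of samples -/

/-- The samples at the positions in `I`, all others replaced by `0`. -/
def maskSamples (I : Finset ℕ) (x : I → ℝ) : ℕ → ℝ := fun i => if h : i ∈ I then x ⟨i, h⟩ else 0

theorem measurable_maskSamples (I : Finset ℕ) : Measurable (maskSamples I) := by
  refine measurable_pi_iff.2 fun i => ?_
  unfold maskSamples
  by_cases h : i ∈ I
  · simp only [h, dif_pos]; fun_prop
  · simp only [h, dif_neg, not_false_eq_true]; fun_prop

/-- Events about disjoint sets of samples are independent. -/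
theorem measure_inter_of_disjoint {I J : Finset ℕ} (hIJ : Disjoint I J) {S R : Set (ℕ → ℝ)}
    (hS : MeasurableSet S) (hR : MeasurableSet R) (dS : DependsOn (· ∈ S) (I : Set ℕ))
    (dR : DependsOn (· ∈ R) (J : Set ℕ)) :
    sampleLaw (S ∩ R) = sampleLaw S * sampleLaw R := by
  have h := iIndepFun_sample.indepFun_finset I J hIJ (fun i => measurable_pi_apply i)
  have key : ∀ (K : Finset ℕ) (U : Set (ℕ → ℝ)), DependsOn (· ∈ U) (K : Set ℕ) →
      U = (fun (ω : ℕ → ℝ) (i : K) => ω i) ⁻¹' (maskSamples K ⁻¹' U) := by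
    intro K U hU
    ext ω
    rw [Set.mem_preimage, Set.mem_preimage]
    refine Eq.to_iff (hU fun i hi => ?_)
    simp only [maskSamples, Finset.mem_coe.1 hi, dif_pos]
  rw [key I S dS, key J R dR]
  exact h.measure_inter_preimage_eq_mul _ _ (measurable_maskSamples I hS)
    (measurable_maskSamples J hR)

/-- An event about a block of samples that is selected by the earlier samples has at most the
probability that it has for a fixed choice. -/
theorem measure_iUnion_selected_le {I J : Finset ℕ} (hIJ : Disjoint I J) (T : ℕ)
    {H B : ℕ → Set (ℕ → ℝ)} (hH : ∀ t, MeasurableSet (H t)) (hB : ∀ t, MeasurableSet (B t))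
    (dH : ∀ t, DependsOn (· ∈ H t) (I : Set ℕ)) (dB : ∀ t, DependsOn (· ∈ B t) (J : Set ℕ))
    (hdisj : Pairwise fun t t' => Disjoint (H t) (H t')) {q : ℝ≥0∞}
    (hq : ∀ t ≤ T, sampleLaw (B t) ≤ q) :
    sampleLaw (⋃ t ∈ Finset.range (T + 1), H t ∩ B t) ≤ q := by
  calc _ ≤ ∑ t ∈ Finset.range (T + 1), sampleLaw (H t ∩ B t) := measure_biUnion_finset_le _ _
    _ = ∑ t ∈ Finset.range (T + 1), sampleLaw (H t) * sampleLaw (B t) :=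
      Finset.sum_congr rfl fun t _ => measure_inter_of_disjoint hIJ (hH t) (hB t) (dH t) (dB t)
    _ ≤ ∑ t ∈ Finset.range (T + 1), sampleLaw (H t) * q := by
      refine Finset.sum_le_sum fun t ht => mul_le_mul_right (hq t ?_) _
      have := Finset.mem_range.1 ht
      omega
    _ = sampleLaw (⋃ t ∈ Finset.range (T + 1), H t) * q := by
      rw [← Finset.sum_mul, measure_biUnion_finset (fun t _ t' _ h => hdisj h) fun t _ => hH t]
    _ ≤ 1 * q := mul_le_mul_left prob_le_one _
    _ = q := one_mul q

/-! ### Blocks of Gaussian starting vectors -/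

section Blocks

variable {n d : ℕ}

/-- The random vector with independent standard normal entries on the coordinates enumerated by
`sup`, taken from the samples `b, …, b + d - 1`, and zeros elsewhere. -/
def gaussVec (sup : Fin d → Fin n) (ω : ℕ → ℝ) (b : ℕ) : Fin n → ℝ :=
  fun i => ∑ k : Fin d, if sup k = i then ω (b + k) else 0

theorem measurable_gaussVec (sup : Fin d → Fin n) (b : ℕ) :
    Measurable fun ω => gaussVec sup ω b := by
  refine measurable_pi_iff.2 fun i => Finset.measurable_sum _ fun k _ => ?_
  split_ifs <;> fun_prop

theorem gaussVec_congr (sup : Fin d → Fin n) {ω ω' : ℕ → ℝ} {b : ℕ}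
    (h : ∀ i, b ≤ i → i < b + d → ω i = ω' i) : gaussVec sup ω b = gaussVec sup ω' b := by
  funext i
  refine Finset.sum_congr rfl fun k _ => ?_
  rw [h (b + k) (by omega) (by omega)]

theorem mulVec_gaussVec (sup : Fin d → Fin n) (ω : ℕ → ℝ) (b : ℕ) (M : Matrix (Fin n) (Fin n) ℝ)
    (r : Fin n) : (M *ᵥ gaussVec sup ω b) r = ∑ k : Fin d, M r (sup k) * ω (b + k) := by
  simp only [Matrix.mulVec, dotProduct, gaussVec, Finset.mul_sum]
  rw [Finset.sum_comm]
  refine Finset.sum_congr rfl fun k _ => ?_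
  simp

/-- Squared Euclidean length of `M x`. -/
def sqLen (M : Matrix (Fin n) (Fin n) ℝ) (x : Fin n → ℝ) : ℝ := (M *ᵥ x) ⬝ᵥ (M *ᵥ x)

theorem measurable_sqLen (M : Matrix (Fin n) (Fin n) ℝ) : Measurable (sqLen M) := by
  unfold sqLen dotProduct Matrix.mulVec dotProduct
  fun_prop

theorem sqLen_gaussVec (sup : Fin d → Fin n) (ω : ℕ → ℝ) (b : ℕ) (M : Matrix (Fin n) (Fin n) ℝ) :
    sqLen M (gaussVec sup ω b) = ∑ r, (∑ k : Fin d, M r (sup k) * ω (b + k)) ^ 2 := by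
  simp only [sqLen, dotProduct, mulVec_gaussVec, sq]

theorem trace_gram (M : Matrix (Fin n) (Fin n) ℝ) : (Mᵀ * M).trace = ∑ r, ∑ i, M r i ^ 2 := by
  simp only [Matrix.trace, Matrix.diag, Matrix.mul_apply, Matrix.transpose_apply, sq]
  exact Finset.sum_comm

theorem sum_sup_le {sup : Fin d → Fin n} (hsup : Function.Injective sup) {f : Fin n → ℝ}
    (hf : ∀ i, 0 ≤ f i) : ∑ k, f (sup k) ≤ ∑ i, f i := by
  rw [← Finset.sum_image (f := f) (fun x _ y _ h => hsup h)]
  exact Finset.sum_le_sum_of_subset_of_nonneg (Finset.subset_univ _) fun i _ _ => hf i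

/-- A sum over the range of `sup` is the whole sum if `f` vanishes elsewhere. -/
theorem sum_sup_eq {ι : Type*} [Fintype ι] [DecidableEq ι] {sup : Fin d → ι}
    (hsup : Function.Injective sup) {f : ι → ℝ}
    (hf : ∀ i, (∀ k, sup k ≠ i) → f i = 0) : ∑ k, f (sup k) = ∑ i, f i := by
  rw [← Finset.sum_image (f := f) (fun x _ y _ h => hsup h)]
  refine Finset.sum_subset (Finset.subset_univ _) fun i _ hi => hf i fun k hk => hi ?_
  exact Finset.mem_image.2 ⟨k, Finset.mem_univ _, hk⟩

theorem measure_sqLen_gt_le {sup : Fin d → Fin n} (hsup : Function.Injective sup) (b : ℕ)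
    (M : Matrix (Fin n) (Fin n) ℝ) {s : ℝ} (hs : 0 ≤ s) :
    sampleLaw {ω | s * (Mᵀ * M).trace < sqLen M (gaussVec sup ω b)}
      ≤ ENNReal.ofReal (2 * Real.exp (-(s / 4))) := by
  simp only [sqLen_gaussVec]
  refine measure_quad_gt_le (v := fun r => ∑ k, M r (sup k) ^ 2) (fun r => by fun_prop)
    (fun r => Finset.sum_nonneg fun _ _ => sq_nonneg _)
    (fun r => map_sum_sample (ι := fun k => b + k) (fun k l h => by ext; simpa using h) _) hs ?_
  rw [trace_gram]
  exact Finset.sum_le_sum fun r _ => sum_sup_le hsup (f := fun i => M r i ^ 2) fun i => sq_nonneg _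

theorem measure_sqLen_lt_le {sup : Fin d → Fin n} (hsup : Function.Injective sup) (b : ℕ)
    {M : Matrix (Fin n) (Fin n) ℝ} (hM : ∀ i, (∀ k, sup k ≠ i) → ∀ r, M r i = 0) :
    sampleLaw {ω | sqLen M (gaussVec sup ω b) < (Mᵀ * M).trace / 10} ≤ 1 / 2 := by
  have e : (Mᵀ * M).trace = ∑ r, ∑ k, M r (sup k) ^ 2 := by
    rw [trace_gram]
    refine Finset.sum_congr rfl fun r _ => ?_
    exact (sum_sup_eq hsup (f := fun i => M r i ^ 2) fun i hi => by simp [hM i hi r]).symm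
  simp only [sqLen_gaussVec, e]
  exact measure_quad_lt_le (v := fun r => ∑ k, M r (sup k) ^ 2) (fun r => by fun_prop)
    (fun r => Finset.sum_nonneg fun _ _ => sq_nonneg _)
    (fun r => map_sum_sample (ι := fun k => b + k) (fun k l h => by ext; simpa using h) _)

/-- The block of `m` starting vectors beginning at sample `b` serves the matrices `M` and `N`: some
vector is not shortened too much by `M`, and no vector is too long or is stretched too much by `N`,
all in comparison with the mean squared lengths. -/
def GoodBlock (sup : Fin d → Fin n) (m b : ℕ) (s : ℝ) (M N : Matrix (Fin n) (Fin n) ℝ)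
    (ω : ℕ → ℝ) : Prop :=
  (∃ j < m, (Mᵀ * M).trace / 10 ≤ sqLen M (gaussVec sup ω (b + j * d))) ∧
    ∀ j < m, sqLen 1 (gaussVec sup ω (b + j * d)) ≤ s * n ∧
      sqLen N (gaussVec sup ω (b + j * d)) ≤ s * (Nᵀ * N).trace

theorem measurableSet_not_goodBlock (sup : Fin d → Fin n) (m b : ℕ) (s : ℝ)
    (M N : Matrix (Fin n) (Fin n) ℝ) : MeasurableSet {ω | ¬ GoodBlock sup m b s M N ω} := by
  have hg : ∀ (L : Matrix (Fin n) (Fin n) ℝ) (c : ℕ),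
      Measurable fun ω => sqLen L (gaussVec sup ω c) :=
    fun L c => (measurable_sqLen L).comp (measurable_gaussVec sup c)
  have e : {ω | ¬ GoodBlock sup m b s M N ω}
      = ((⋃ j ∈ Finset.range m,
          {ω | (Mᵀ * M).trace / 10 ≤ sqLen M (gaussVec sup ω (b + j * d))})
        ∩ ⋂ j ∈ Finset.range m, ({ω | sqLen 1 (gaussVec sup ω (b + j * d)) ≤ s * n}
          ∩ {ω | sqLen N (gaussVec sup ω (b + j * d)) ≤ s * (Nᵀ * N).trace}))ᶜ := by
    ext ω
    simp [GoodBlock]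
  rw [e]
  refine (MeasurableSet.inter ?_ ?_).compl
  · exact Finset.measurableSet_biUnion _ fun j _ => measurableSet_le measurable_const (hg _ _)
  · exact Finset.measurableSet_biInter _ fun j _ =>
      (measurableSet_le (hg _ _) measurable_const).inter
        (measurableSet_le (hg _ _) measurable_const)

theorem dependsOn_not_goodBlock (sup : Fin d → Fin n) (m b : ℕ) (s : ℝ)
    (M N : Matrix (Fin n) (Fin n) ℝ) :
    DependsOn (· ∈ {ω | ¬ GoodBlock sup m b s M N ω}) (Finset.Ico b (b + m * d) : Set ℕ) := by
  intro ω ω' h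
  have e : ∀ j < m, gaussVec sup ω (b + j * d) = gaussVec sup ω' (b + j * d) := by
    intro j hj
    refine gaussVec_congr sup fun i h1 h2 => h i ?_
    have : (j + 1) * d ≤ m * d := Nat.mul_le_mul_right d hj
    rw [add_mul, one_mul] at this
    simp only [Finset.coe_Ico, Set.mem_Ico]
    omega
  refine congrArg Not (propext (and_congr ?_ ?_))
  · exact exists_congr fun j => and_congr_right fun hj => by rw [e j hj]
  · exact forall_congr' fun j => forall_congr' fun hj => by rw [e j hj]

theorem measure_forall_sqLen_lt_le {sup : Fin d → Fin n} (hsup : Function.Injective sup) (b : ℕ)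
    {M : Matrix (Fin n) (Fin n) ℝ} (hM : ∀ i, (∀ k, sup k ≠ i) → ∀ r, M r i = 0) (m : ℕ) :
    sampleLaw {ω | ∀ j < m, sqLen M (gaussVec sup ω (b + j * d)) < (Mᵀ * M).trace / 10}
      ≤ (1 / 2) ^ m := by
  have hmeas : ∀ j, MeasurableSet
      {ω | sqLen M (gaussVec sup ω (b + j * d)) < (Mᵀ * M).trace / 10} := fun j =>
    measurableSet_lt ((measurable_sqLen M).comp (measurable_gaussVec sup _)) measurable_const
  induction m with
  | zero => simp
  | succ m ih =>
    have e : {ω : ℕ → ℝ | ∀ j < m + 1, sqLen M (gaussVec sup ω (b + j * d)) < (Mᵀ * M).trace / 10}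
        = {ω | ∀ j < m, sqLen M (gaussVec sup ω (b + j * d)) < (Mᵀ * M).trace / 10}
          ∩ {ω | sqLen M (gaussVec sup ω (b + m * d)) < (Mᵀ * M).trace / 10} := by
      ext ω
      simp only [Set.mem_ofPred_eq, Set.mem_inter_iff, Nat.lt_succ_iff_lt_or_eq]
      exact ⟨fun h => ⟨fun j hj => h j (Or.inl hj), h m (Or.inr rfl)⟩,
        fun h j hj => hj.elim (h.1 j) fun hj => hj ▸ h.2⟩
    rw [e, measure_inter_of_disjoint (I := Finset.range (b + m * d))
      (J := Finset.Ico (b + m * d) (b + m * d + d)), pow_succ]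
    · exact mul_le_mul' ih (measure_sqLen_lt_le hsup _ hM)
    · rw [Finset.disjoint_left]
      intro i hi hi'
      rw [Finset.mem_range] at hi
      rw [Finset.mem_Ico] at hi'
      omega
    · simp only [Set.ofPred_forall]
      exact MeasurableSet.iInter fun j => MeasurableSet.iInter fun _ => hmeas j
    · exact hmeas m
    · intro ω ω' h
      refine propext (forall_congr' fun j => forall_congr' fun hj => ?_)
      rw [gaussVec_congr sup fun i h1 h2 => h i ?_]
      have : (j + 1) * d ≤ m * d := Nat.mul_le_mul_right d hj
      rw [add_mul, one_mul] at this
      simp only [Finset.coe_range, Set.mem_Iio]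
      omega
    · intro ω ω' h
      have e : gaussVec sup ω (b + m * d) = gaussVec sup ω' (b + m * d) :=
        gaussVec_congr sup fun i h1 h2 => h i (by
          simp only [Finset.coe_Ico, Set.mem_Ico]
          omega)
      simp only [Set.mem_ofPred_eq, e]

theorem measure_not_goodBlock_le {sup : Fin d → Fin n} (hsup : Function.Injective sup) (m b : ℕ)
    {s : ℝ} (hs : 0 ≤ s) {M : Matrix (Fin n) (Fin n) ℝ} (N : Matrix (Fin n) (Fin n) ℝ)
    (hM : ∀ i, (∀ k, sup k ≠ i) → ∀ r, M r i = 0) :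
    sampleLaw {ω | ¬ GoodBlock sup m b s M N ω}
      ≤ ENNReal.ofReal ((1 / 2) ^ m + m * (4 * Real.exp (-(s / 4)))) := by
  have hsub : {ω | ¬ GoodBlock sup m b s M N ω}
      ⊆ {ω | ∀ j < m, sqLen M (gaussVec sup ω (b + j * d)) < (Mᵀ * M).trace / 10}
        ∪ ⋃ j ∈ Finset.range m,
          ({ω | s * ((1 : Matrix (Fin n) (Fin n) ℝ)ᵀ * 1).trace
              < sqLen 1 (gaussVec sup ω (b + j * d))}
            ∪ {ω | s * (Nᵀ * N).trace < sqLen N (gaussVec sup ω (b + j * d))}) := by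
    intro ω hω
    by_contra hcon
    simp only [Set.mem_union, Set.mem_iUnion, Set.mem_ofPred_eq, Finset.mem_range] at hcon
    push Not at hcon
    refine hω ⟨hcon.1, fun j hj => ⟨?_, (hcon.2 j hj).2⟩⟩
    have := (hcon.2 j hj).1
    simpa using this
  refine (measure_mono hsub).trans ((measure_union_le _ _).trans ?_)
  rw [ENNReal.ofReal_add (by positivity) (by positivity)]
  refine add_le_add ?_ ?_
  · refine (measure_forall_sqLen_lt_le hsup b hM m).trans (le_of_eq ?_)
    rw [ENNReal.ofReal_pow (by norm_num), ENNReal.ofReal_div_of_pos (by norm_num)]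
    simp
  · refine (measure_biUnion_finset_le _ _).trans ?_
    rw [ENNReal.ofReal_mul (Nat.cast_nonneg m), ENNReal.ofReal_natCast]
    calc _ ≤ ∑ _j ∈ Finset.range m, ENNReal.ofReal (4 * Real.exp (-(s / 4))) := by
          refine Finset.sum_le_sum fun j _ => (measure_union_le _ _).trans ?_
          refine (add_le_add (measure_sqLen_gt_le hsup _ 1 hs)
            (measure_sqLen_gt_le hsup _ N hs)).trans (le_of_eq ?_)
          rw [← ENNReal.ofReal_add (by positivity) (by positivity)]
          congr 1
          ring
      _ = _ := by simp

end Blocks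

/-! ### The dynamic power method -/

/-- Parameters of the dynamic power method: `sup` enumerates the `d` coordinates outside of which
the matrices vanish, `m` is the number of random starting vectors per recomputation, `K` the number
of power steps. -/
structure Params (n : ℕ) where
  d : ℕ
  m : ℕ
  K : ℕ
  sup : Fin d → Fin n
  ε : ℝ

/-- What the method remembers: the number of randomized recomputations so far, the current unit
vector, and the threshold below which its quadratic form must not fall. -/
structure AState (n : ℕ) where
  cnt : ℕ
  w : Fin n → ℝ
  thr : ℝ

section Algorithm

variable {n : ℕ} (p : Params n)

/-- Starting vectors of a recomputation: random ones, or, after `n ^ 16` randomized recomputations,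
the unit coordinate vectors. -/
def cand (ω : ℕ → ℝ) (cnt j : ℕ) : Fin n → ℝ :=
  if cnt < n ^ 16 then gaussVec p.sup ω (cnt * (p.m * p.d) + j * p.d)
  else fun i => if ∃ h : j < p.d, p.sup ⟨j, h⟩ = i then 1 else 0

/-- Number of starting vectors of a recomputation. -/
def numCand (cnt : ℕ) : ℕ := if cnt < n ^ 16 then p.m else p.d

/-- A longest vector among `y 0, …, y (j - 1)` together with its squared length, or zero. -/
noncomputable def best (y : ℕ → Fin n → ℝ) : ℕ → ℝ × (Fin n → ℝ)
  | 0 => (0, 0)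
  | j + 1 => if (best y j).1 < y j ⬝ᵥ y j then (y j ⬝ᵥ y j, y j) else best y j

/-- The normalized longest candidate; the old vector `w` if all candidates vanish. -/
noncomputable def pick (y : ℕ → Fin n → ℝ) (M : ℕ) (w : Fin n → ℝ) : Fin n → ℝ :=
  if 0 < (best y M).1 then fun i => (best y M).2 i / √(best y M).1 else w

/-- The vector found by a recomputation for `A`. -/
noncomputable def recompVec (ω : ℕ → ℝ) (A : Matrix (Fin n) (Fin n) ℝ) (cnt : ℕ)
    (w : Fin n → ℝ) : Fin n → ℝ :=
  pick (fun j => A ^ p.K *ᵥ cand p ω cnt j) (numCand p cnt) w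

/-- A recomputation for `A`. -/
noncomputable def recomp (ω : ℕ → ℝ) (A : Matrix (Fin n) (Fin n) ℝ) (st : AState n) : AState n where
  cnt := if st.cnt < n ^ 16 then st.cnt + 1 else st.cnt
  w := recompVec p ω A st.cnt st.w
  thr := (recompVec p ω A st.cnt st.w ⬝ᵥ (A *ᵥ recompVec p ω A st.cnt st.w)) * (1 - p.ε / 4)

/-- The current vector has become too bad. -/
def Trig (A : Matrix (Fin n) (Fin n) ℝ) (st : AState n) : Prop := st.w ⬝ᵥ (A *ᵥ st.w) < st.thr

open Classical in
noncomputable def stepState (ω : ℕ → ℝ) (A : Matrix (Fin n) (Fin n) ℝ) (st : AState n) :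
    AState n :=
  if Trig A st then recomp p ω A st else st

/-- `seqState t` is the memory before the matrix `A t` is processed.  The initial threshold is such
that the first matrix triggers a recomputation. -/
noncomputable def seqState [NeZero n] (A : ℕ → Matrix (Fin n) (Fin n) ℝ) (ω : ℕ → ℝ) : ℕ → AState n
  | 0 => ⟨0, Pi.single 0 1, Pi.single 0 1 ⬝ᵥ (A 0 *ᵥ Pi.single 0 1) + 1⟩
  | t + 1 => stepState p ω (A t) (seqState A ω t)

theorem best_spec (y : ℕ → Fin n → ℝ) (M : ℕ) :
    (best y M).1 = (best y M).2 ⬝ᵥ (best y M).2 ∧ (∀ j < M, y j ⬝ᵥ y j ≤ (best y M).1) ∧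
      (0 < (best y M).1 → ∃ j < M, (best y M).2 = y j) := by
  induction M with
  | zero => simp [best]
  | succ M ih =>
    obtain ⟨h1, h2, h3⟩ := ih
    rw [best]
    split_ifs with h
    · refine ⟨rfl, fun j hj => ?_, fun _ => ⟨M, by omega, rfl⟩⟩
      rcases Nat.lt_succ_iff_lt_or_eq.1 hj with hj | rfl
      · exact (h2 j hj).trans h.le
      · exact le_rfl
    · refine ⟨h1, fun j hj => ?_, fun h0 => ?_⟩
      · rcases Nat.lt_succ_iff_lt_or_eq.1 hj with hj | rfl
        · exact h2 j hj
        · exact not_lt.1 h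
      · obtain ⟨j, hj, e⟩ := h3 h0
        exact ⟨j, by omega, e⟩

theorem best_congr {y y' : ℕ → Fin n → ℝ} {M : ℕ} (h : ∀ j < M, y j = y' j) :
    best y M = best y' M := by
  induction M with
  | zero => rfl
  | succ M ih => rw [best, best, ih fun j hj => h j (by omega), h M (by omega)]

theorem pick_unit {y : ℕ → Fin n → ℝ} {M : ℕ} {w : Fin n → ℝ} (hw : w ⬝ᵥ w = 1) :
    pick y M w ⬝ᵥ pick y M w = 1 := by
  rw [pick]
  split_ifs with h
  · have e := (best_spec y M).1
    rw [e] at h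
    have := smul_inv_sqrt_unit h
    rw [← e] at this
    rw [← this]
    simp only [dotProduct, Pi.smul_apply, smul_eq_mul, div_eq_inv_mul]
  · exact hw

theorem pick_eq_smul {y : ℕ → Fin n → ℝ} {M : ℕ} {w : Fin n → ℝ} {c : ℝ} (hc : 0 < c)
    (h : ∃ j < M, c ≤ y j ⬝ᵥ y j) :
    ∃ j < M, c ≤ y j ⬝ᵥ y j ∧ pick y M w = (√(y j ⬝ᵥ y j))⁻¹ • y j := by
  obtain ⟨h1, h2, h3⟩ := best_spec y M
  obtain ⟨j, hj, hcj⟩ := h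
  have hb : c ≤ (best y M).1 := hcj.trans (h2 j hj)
  have h0 : 0 < (best y M).1 := hc.trans_le hb
  obtain ⟨i, hi, e⟩ := h3 h0
  rw [e] at h1
  refine ⟨i, hi, h1 ▸ hb, ?_⟩
  rw [pick, if_pos h0, h1, e]
  funext k
  simp [div_eq_inv_mul]

end Algorithm

/-! ### Measurability, and dependence on the samples -/

section Measurability

variable {n : ℕ} (p : Params n)

theorem measurable_quad (A : Matrix (Fin n) (Fin n) ℝ) :
    Measurable fun x : Fin n → ℝ => x ⬝ᵥ (A *ᵥ x) := by
  unfold dotProduct Matrix.mulVec dotProduct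
  fun_prop

theorem measurable_best {Ω : Type*} [MeasurableSpace Ω] {y : ℕ → Ω → Fin n → ℝ}
    (hy : ∀ j, Measurable (y j)) (M : ℕ) : Measurable fun ω => best (fun j => y j ω) M := by
  induction M with
  | zero => exact measurable_const
  | succ M ih =>
    have hq : Measurable fun ω => y M ω ⬝ᵥ y M ω := by
      have := hy M
      unfold dotProduct
      fun_prop
    exact Measurable.ite (measurableSet_lt ih.fst hq) (hq.prodMk (hy M)) ih

theorem measurable_pick {Ω : Type*} [MeasurableSpace Ω] {y : ℕ → Ω → Fin n → ℝ}
    (hy : ∀ j, Measurable (y j)) (M : ℕ) {w : Ω → Fin n → ℝ} (hw : Measurable w) :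
    Measurable fun ω => pick (fun j => y j ω) M (w ω) := by
  have hb := measurable_best hy M
  refine Measurable.ite (measurableSet_lt measurable_const hb.fst) ?_ hw
  refine measurable_pi_iff.2 fun i => ?_
  exact ((measurable_pi_apply i).comp hb.snd).div hb.fst.sqrt

theorem measurable_cand (k j : ℕ) : Measurable fun ω => cand p ω k j := by
  unfold cand
  split_ifs
  · exact measurable_gaussVec _ _
  · exact measurable_const

theorem measurable_recompVec_const (A : Matrix (Fin n) (Fin n) ℝ) (k : ℕ)
    {w : (ℕ → ℝ) → Fin n → ℝ} (hw : Measurable w) :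
    Measurable fun ω => recompVec p ω A k (w ω) := by
  have hy : ∀ j, Measurable fun ω => A ^ p.K *ᵥ cand p ω k j := fun j => by
    have := measurable_cand p k j
    unfold Matrix.mulVec dotProduct
    fun_prop
  exact measurable_pick hy (numCand p k) hw

theorem measurable_recompVec (A : Matrix (Fin n) (Fin n) ℝ) {c : (ℕ → ℝ) → ℕ} (hc : Measurable c)
    {w : (ℕ → ℝ) → Fin n → ℝ} (hw : Measurable w) :
    Measurable fun ω => recompVec p ω A (c ω) (w ω) := by
  have h : Measurable (Function.uncurry fun (k : ℕ) ω => recompVec p ω A k (w ω)) :=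
    measurable_from_prod_countable_right fun k => measurable_recompVec_const p A k hw
  have h2 : Measurable fun ω : ℕ → ℝ => (c ω, ω) := hc.prodMk measurable_id
  have h3 := h.comp h2
  simpa only [Function.comp_def, Function.uncurry_apply_pair] using h3

variable [NeZero n] (A : ℕ → Matrix (Fin n) (Fin n) ℝ)

theorem measurable_seqState (t : ℕ) :
    Measurable (fun ω => (seqState p A ω t).cnt) ∧ Measurable (fun ω => (seqState p A ω t).w) ∧
      Measurable (fun ω => (seqState p A ω t).thr) := by
  induction t with
  | zero => exact ⟨measurable_const, measurable_const, measurable_const⟩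
  | succ t ih =>
    obtain ⟨h1, h2, h3⟩ := ih
    have hT : MeasurableSet {ω | Trig (A t) (seqState p A ω t)} :=
      measurableSet_lt ((measurable_quad (A t)).comp h2) h3
    have hr := measurable_recompVec p (A t) h1 h2
    classical
    have e : ∀ {β : Type} (f : AState n → β) (ω : ℕ → ℝ), f (seqState p A ω (t + 1))
        = if ω ∈ {ω | Trig (A t) (seqState p A ω t)} then f (recomp p ω (A t) (seqState p A ω t))
          else f (seqState p A ω t) := by
      intro β f ω
      rw [seqState, stepState]
      simp only [Set.mem_ofPred_eq]
      split_ifs <;> rfl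
    refine ⟨?_, ?_, ?_⟩
    · simp only [e AState.cnt]
      refine Measurable.ite hT ?_ h1
      exact (measurable_of_countable fun k : ℕ => if k < n ^ 16 then k + 1 else k).comp h1
    · simp only [e AState.w]
      exact Measurable.ite hT hr h2
    · simp only [e AState.thr]
      exact Measurable.ite hT (((measurable_quad (A t)).comp hr).mul_const _) h3

/-- The event that the `i`-th randomized recomputation happens at time `t`. -/
def recompEvent (i t : ℕ) : Set (ℕ → ℝ) :=
  {ω | Trig (A t) (seqState p A ω t) ∧ (seqState p A ω t).cnt = i}

theorem measurableSet_recompEvent (i t : ℕ) : MeasurableSet (recompEvent p A i t) := by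
  obtain ⟨h1, h2, h3⟩ := measurable_seqState p A t
  exact (measurableSet_lt ((measurable_quad (A t)).comp h2) h3).inter
    (h1 (measurableSet_singleton i))

theorem cnt_mono (ω : ℕ → ℝ) : Monotone fun t => (seqState p A ω t).cnt := by
  refine monotone_nat_of_le_succ fun t => ?_
  rw [seqState, stepState]
  split_ifs
  · simp only [recomp]
    split_ifs <;> omega
  · exact le_rfl

theorem recompEvent_disjoint {i : ℕ} (hi : i < n ^ 16) :
    Pairwise fun t t' => Disjoint (recompEvent p A i t) (recompEvent p A i t') := by
  have key : ∀ t t', t < t' → Disjoint (recompEvent p A i t) (recompEvent p A i t') := by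
    intro t t' htt
    rw [Set.disjoint_left]
    rintro ω ⟨h1, h2⟩ ⟨-, h4⟩
    have := cnt_mono p A ω (show t + 1 ≤ t' from htt)
    simp only [h4] at this
    rw [seqState, stepState, if_pos h1] at this
    simp only [recomp, h2, if_pos hi] at this
    omega
  intro t t' htt
  rcases lt_or_gt_of_ne htt with h | h
  · exact key t t' h
  · exact (key t' t h).symm

/-- Whether the `i`-th randomized recomputation happens at time `t` is decided by the samples before
the `i`-th block: two runs that agree on these samples are in the same state until both have used
the `i`-th block. -/
theorem dependsOn_recompEvent (i t : ℕ) :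
    DependsOn (· ∈ recompEvent p A i t) (Finset.range (i * (p.m * p.d)) : Set ℕ) := by
  intro ω ω' h
  have key : ∀ t, seqState p A ω t = seqState p A ω' t ∨
      (i < (seqState p A ω t).cnt ∧ i < (seqState p A ω' t).cnt) := by
    intro t
    induction t with
    | zero => exact Or.inl rfl
    | succ t ih =>
      rcases ih with ih | ⟨ih, ih'⟩
      · rw [seqState, seqState, ← ih, stepState, stepState]
        by_cases hT : Trig (A t) (seqState p A ω t)
        · rw [if_pos hT, if_pos hT]
          set st := seqState p A ω t
          by_cases hc : st.cnt < n ^ 16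
          · rcases lt_or_ge st.cnt i with hi | hi
            · left
              have e : recompVec p ω (A t) st.cnt st.w = recompVec p ω' (A t) st.cnt st.w := by
                have hb : ∀ j < numCand p st.cnt, cand p ω st.cnt j = cand p ω' st.cnt j := by
                  intro j hj
                  rw [numCand, if_pos hc] at hj
                  rw [cand, cand, if_pos hc, if_pos hc]
                  refine gaussVec_congr _ fun k h1 h2 => h k ?_
                  have a1 : (j + 1) * p.d ≤ p.m * p.d := Nat.mul_le_mul_right _ hj
                  have a2 : (st.cnt + 1) * (p.m * p.d) ≤ i * (p.m * p.d) :=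
                    Nat.mul_le_mul_right _ hi
                  rw [add_mul, one_mul] at a1 a2
                  simp only [Finset.coe_range, Set.mem_Iio]
                  omega
                rw [recompVec, recompVec, pick, pick, best_congr fun j hj => by rw [hb j hj]]
              rw [recomp, recomp, e]
            · right
              simp only [recomp, if_pos hc]
              omega
          · left
            have e : recompVec p ω (A t) st.cnt st.w = recompVec p ω' (A t) st.cnt st.w := by
              simp only [recompVec, cand, if_neg hc]
            rw [recomp, recomp, e]
        · rw [if_neg hT, if_neg hT]
          exact Or.inl rfl
      · right
        exact ⟨lt_of_lt_of_le ih (cnt_mono p A ω (Nat.le_succ t)),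
          lt_of_lt_of_le ih' (cnt_mono p A ω' (Nat.le_succ t))⟩
  simp only [recompEvent, Set.mem_ofPred_eq]
  rcases key t with h | ⟨h1, h2⟩
  · rw [h]
  · exact propext ⟨fun h => absurd h.2 h1.ne', fun h => absurd h.2 h2.ne'⟩

end Measurability

/-! ### Analysis on good samples -/

section Analysis

variable {n : ℕ} (p : Params n)

theorem transpose_pow_mul_pow {A : Matrix (Fin n) (Fin n) ℝ} (hA : A.PosSemidef) (K : ℕ) :
    (A ^ K)ᵀ * A ^ K = A ^ (2 * K) := by
  rw [PosSemidef.transpose_eq (hA.pow K), ← pow_add, two_mul]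

/-- A matrix with Gram matrix `D`, if there is one. -/
noncomputable def gramRoot (D : Matrix (Fin n) (Fin n) ℝ) : Matrix (Fin n) (Fin n) ℝ :=
  open Classical in if h : ∃ B : Matrix (Fin n) (Fin n) ℝ, D = Bᵀ * B then h.choose else 0

theorem gramRoot_spec {D : Matrix (Fin n) (Fin n) ℝ} (hD : D.PosSemidef) :
    (gramRoot D)ᵀ * gramRoot D = D := by
  rw [gramRoot, dif_pos (exists_eq_transpose_mul hD)]
  exact (exists_eq_transpose_mul hD).choose_spec.symm

theorem sqLen_gramRoot_mul {D : Matrix (Fin n) (Fin n) ℝ} (hD : D.PosSemidef)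
    (M : Matrix (Fin n) (Fin n) ℝ) (x : Fin n → ℝ) :
    sqLen (gramRoot D * M) x = (M *ᵥ x) ⬝ᵥ (D *ᵥ (M *ᵥ x)) := by
  conv_rhs => rw [← gramRoot_spec hD, quad_transpose_mul]
  rw [sqLen, Matrix.mulVec_mulVec]

theorem trace_gramRoot_mul {D A : Matrix (Fin n) (Fin n) ℝ} (hD : D.PosSemidef)
    (hA : A.PosSemidef) (K : ℕ) :
    ((gramRoot D * A ^ K)ᵀ * (gramRoot D * A ^ K)).trace = (A ^ (2 * K) * D).trace := by
  rw [Matrix.transpose_mul, PosSemidef.transpose_eq (hA.pow K), Matrix.mul_assoc,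
    Matrix.trace_mul_comm, ← Matrix.mul_assoc (gramRoot D)ᵀ, gramRoot_spec hD, Matrix.mul_assoc,
    ← pow_add, ← two_mul, Matrix.trace_mul_comm]

/-- The change from `A` to `A'` is small in the mean, over the random starting vector. -/
def SmallDrop (s : ℝ) (A A' : Matrix (Fin n) (Fin n) ℝ) : Prop :=
  (A ^ (2 * p.K) * (A - A')).trace
    < 1 / (80 * s) * p.ε * lamMax A * (A ^ (2 * p.K)).trace

open Classical in
/-- The last time up to `T` at which the change since time `t` is still small in the mean; `0` if
there is none. -/
noncomputable def lastSmall (s : ℝ) (A : ℕ → Matrix (Fin n) (Fin n) ℝ) (T t : ℕ) : ℕ :=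
  Nat.findGreatest (fun t' => t ≤ t' ∧ SmallDrop p s (A t) (A t')) T

/-- The `i`-th block of samples is good for a recomputation at time `t`. -/
def GoodAt (s : ℝ) (A : ℕ → Matrix (Fin n) (Fin n) ℝ) (T i t : ℕ) (ω : ℕ → ℝ) : Prop :=
  GoodBlock p.sup p.m (i * (p.m * p.d)) s (A t ^ p.K)
    (gramRoot (A t - A (lastSmall p s A T t)) * A t ^ p.K) ω

/-- Every randomized recomputation finds a block of samples that is good for its time. -/
def GoodRun [NeZero n] (s : ℝ) (A : ℕ → Matrix (Fin n) (Fin n) ℝ) (T : ℕ) (ω : ℕ → ℝ) : Prop :=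
  ∀ i < n ^ 16, ∀ t ≤ T, ω ∈ recompEvent p A i t → GoodAt p s A T i t ω

variable {p} {s : ℝ} {A : ℕ → Matrix (Fin n) (Fin n) ℝ} {T : ℕ}

theorem pow_col_eq_zero {B : Matrix (Fin n) (Fin n) ℝ} {i : Fin n} (h : ∀ r, B r i = 0) {K : ℕ}
    (hK : 0 < K) (r : Fin n) : (B ^ K) r i = 0 := by
  obtain ⟨k, rfl⟩ := Nat.exists_eq_succ_of_ne_zero hK.ne'
  rw [Nat.succ_eq_add_one, pow_succ, Matrix.mul_apply]
  exact Finset.sum_eq_zero fun j _ => by rw [h j, mul_zero]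

/-- The union bound is over the numbers of the recomputations, not over time: for each number, the
time of the recomputation is selected by the earlier samples, and hence costs no probability.  This
is why the bound does not depend on `T`. -/
theorem measure_not_goodRun_le [NeZero n] (hsup : Function.Injective p.sup) (hs : 0 ≤ s)
    (hK : 0 < p.K) (hz : ∀ t ≤ T, ∀ i, (∀ k, p.sup k ≠ i) → ∀ r, A t r i = 0) :
    sampleLaw {ω | ¬ GoodRun p s A T ω}
      ≤ (n ^ 16 : ℕ) * ENNReal.ofReal ((1 / 2) ^ p.m + p.m * (4 * Real.exp (-(s / 4)))) := by
  have hsub : {ω | ¬ GoodRun p s A T ω} ⊆ ⋃ i ∈ Finset.range (n ^ 16),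
      ⋃ t ∈ Finset.range (T + 1), recompEvent p A i t ∩ {ω | ¬ GoodAt p s A T i t ω} := by
    intro ω hω
    simp only [GoodRun, Set.mem_ofPred_eq] at hω
    push Not at hω
    obtain ⟨i, hi, t, ht, h1, h2⟩ := hω
    simp only [Set.mem_iUnion, Finset.mem_range]
    exact ⟨i, hi, t, by omega, h1, h2⟩
  refine (measure_mono hsub).trans ((measure_biUnion_finset_le _ _).trans ?_)
  calc _ ≤ ∑ _i ∈ Finset.range (n ^ 16),
        ENNReal.ofReal ((1 / 2) ^ p.m + p.m * (4 * Real.exp (-(s / 4)))) := by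
        refine Finset.sum_le_sum fun i hi => ?_
        refine measure_iUnion_selected_le (I := Finset.range (i * (p.m * p.d)))
          (J := Finset.Ico (i * (p.m * p.d)) (i * (p.m * p.d) + p.m * p.d)) ?_ T
          (fun t => measurableSet_recompEvent p A i t)
          (fun t => measurableSet_not_goodBlock _ _ _ _ _ _)
          (fun t => dependsOn_recompEvent p A i t)
          (fun t => dependsOn_not_goodBlock _ _ _ _ _ _)
          (recompEvent_disjoint p A (Finset.mem_range.1 hi)) fun t ht => ?_
        · rw [Finset.disjoint_left]
          intro k hk hk'
          rw [Finset.mem_range] at hk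
          rw [Finset.mem_Ico] at hk'
          omega
        · exact measure_not_goodBlock_le hsup _ _ hs _ fun i hi r =>
            pow_col_eq_zero (hz t ht i hi) hK r
    _ = _ := by simp

/-- The vector `w` is as good for `A` as a recomputation should make it. -/
def FreshFor (ε : ℝ) (A : Matrix (Fin n) (Fin n) ℝ) (w : Fin n → ℝ) : Prop :=
  w ⬝ᵥ w = 1 ∧ (1 - ε / 8) * lamMax A ≤ w ⬝ᵥ (A *ᵥ w)

theorem fresh_of_power [NeZero n] {B : Matrix (Fin n) (Fin n) ℝ} (hB : B.PosSemidef)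
    (hlam : 0 < lamMax B) {ε : ℝ} (hε1 : ε < 1) {g : Fin n → ℝ} {K : ℕ} {c : ℝ} (hc0 : 0 < c)
    (hc : Real.exp (-(2 * K * (ε / 8))) * (g ⬝ᵥ g) < c)
    (hlow : c * lamMax B ^ (2 * K) ≤ (B ^ K *ᵥ g) ⬝ᵥ (B ^ K *ᵥ g)) :
    FreshFor ε B ((√((B ^ K *ᵥ g) ⬝ᵥ (B ^ K *ᵥ g)))⁻¹ • (B ^ K *ᵥ g)) := by
  have hpos : 0 < (B ^ K *ᵥ g) ⬝ᵥ (B ^ K *ᵥ g) := lt_of_lt_of_le (by positivity) hlow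
  refine ⟨smul_inv_sqrt_unit hpos, ?_⟩
  rw [quad_smul_inv_sqrt B hpos, le_div_iff₀ hpos]
  exact rayleigh_of_power hB g K (by linarith) hlam hc hlow

theorem fresh_of_lamMax_eq_zero {B : Matrix (Fin n) (Fin n) ℝ} (hB : B.PosSemidef)
    (hlam : lamMax B = 0) {ε : ℝ} {w : Fin n → ℝ} (hw : w ⬝ᵥ w = 1) : FreshFor ε B w := by
  refine ⟨hw, ?_⟩
  rw [hlam, mul_zero]
  exact quad_nonneg hB w

/-- Starting from all unit coordinate vectors, the power method needs no luck. -/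
theorem fresh_deterministic [NeZero n] (hsup : Function.Injective p.sup)
    {B : Matrix (Fin n) (Fin n) ℝ} (hB : B.PosSemidef)
    (hz : ∀ i, (∀ k, p.sup k ≠ i) → ∀ r, B r i = 0) (hK : 0 < p.K) (hε1 : p.ε < 1)
    (hexp : Real.exp (-(2 * p.K * (p.ε / 8))) * n < 1) (ω : ℕ → ℝ) {cnt : ℕ}
    (hcnt : ¬ cnt < n ^ 16) {w : Fin n → ℝ} (hw : w ⬝ᵥ w = 1) :
    FreshFor p.ε B (recompVec p ω B cnt w) := by
  rcases (lamMax_nonneg hB).eq_or_lt with h0 | hlam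
  · exact fresh_of_lamMax_eq_zero hB h0.symm (pick_unit hw)
  have hn : (0 : ℝ) < n := by exact_mod_cast NeZero.pos n
  have hcand : ∀ k : Fin p.d, cand p ω cnt k = Pi.single (p.sup k) 1 := by
    intro k
    rw [cand, if_neg hcnt]
    funext i
    simp only [k.2, exists_true_left, Fin.eta, Pi.single_apply, eq_comm]
  have hex : ∃ j < numCand p cnt, 1 / n * lamMax B ^ (2 * p.K)
      ≤ (B ^ p.K *ᵥ cand p ω cnt j) ⬝ᵥ (B ^ p.K *ᵥ cand p ω cnt j) := by
    by_contra! hcon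
    rw [numCand, if_neg hcnt] at hcon
    have htr : ∑ k : Fin p.d, (B ^ p.K *ᵥ cand p ω cnt k) ⬝ᵥ (B ^ p.K *ᵥ cand p ω cnt k)
        = (B ^ (2 * p.K)).trace := by
      rw [← transpose_pow_mul_pow hB, trace_gram, Finset.sum_comm,
        ← sum_sup_eq hsup (f := fun i => ∑ r, (B ^ p.K) r i ^ 2)]
      · refine Finset.sum_congr rfl fun k _ => ?_
        rw [hcand k, Matrix.mulVec_single_one]
        simp [dotProduct, sq, Matrix.col]
      · intro i hi
        exact Finset.sum_eq_zero fun r _ => by rw [pow_col_eq_zero (hz i hi) hK]; simp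
    have hle := lamMax_pow_le_trace hB (2 * p.K) (by omega)
    have hlt : (B ^ (2 * p.K)).trace ≤ p.d * (1 / n * lamMax B ^ (2 * p.K)) := by
      rw [← htr]
      calc _ ≤ ∑ _k : Fin p.d, 1 / n * lamMax B ^ (2 * p.K) :=
            Finset.sum_le_sum fun k _ => (hcon k k.2).le
        _ = _ := by simp
    have hd : (p.d : ℝ) ≤ n := by
      have := Fintype.card_le_of_injective _ hsup
      simp only [Fintype.card_fin] at this
      exact_mod_cast this
    have hpw := pow_pos hlam (2 * p.K)
    rcases Nat.eq_zero_or_pos p.d with hd0 | hd0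
    · rw [hd0] at hlt
      simp only [Nat.cast_zero, zero_mul] at hlt
      linarith
    · have : (B ^ (2 * p.K)).trace < p.d * (1 / n * lamMax B ^ (2 * p.K)) := by
        rw [← htr]
        calc _ < ∑ _k : Fin p.d, 1 / n * lamMax B ^ (2 * p.K) :=
              Finset.sum_lt_sum_of_nonempty ⟨⟨0, hd0⟩, Finset.mem_univ _⟩
                fun k _ => hcon k k.2
          _ = _ := by simp
      have h2 : p.d * (1 / n * lamMax B ^ (2 * p.K)) ≤ lamMax B ^ (2 * p.K) := by
        calc _ = (p.d / n) * lamMax B ^ (2 * p.K) := by ring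
          _ ≤ 1 * lamMax B ^ (2 * p.K) := by
            gcongr
            rw [div_le_one hn]
            exact hd
          _ = _ := one_mul _
      linarith
  have hc0 : 0 < 1 / n * lamMax B ^ (2 * p.K) := by positivity
  obtain ⟨j, hj, hcj, e⟩ := pick_eq_smul (w := w) hc0 hex
  rw [recompVec, e]
  refine fresh_of_power hB hlam hε1 (c := 1 / n) (by positivity) ?_ hcj
  rw [numCand, if_neg hcnt] at hj
  rw [show j = ((⟨j, hj⟩ : Fin p.d) : ℕ) from rfl, hcand, unit_single, mul_one, lt_div_iff₀ hn]
  exact hexp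

/-- A randomized recomputation on a good block yields a good vector, and this vector stays good
until the trace of the power `2 K + 1` has dropped by the factor `1 - ε / (80 s)`. -/
theorem fresh_randomized [NeZero n] (hpsd : ∀ t ≤ T, (A t).PosSemidef)
    (hmono : ∀ t t', t ≤ t' → t' ≤ T → (A t - A t').PosSemidef)
    (hK : 0 < p.K) (hε0 : 0 < p.ε) (hε1 : p.ε < 1) (hs : 0 < s)
    (hexp : Real.exp (-(2 * p.K * (p.ε / 8))) * (s * n) < 1 / 10) {ω : ℕ → ℝ} {cnt : ℕ}
    (hcnt : cnt < n ^ 16) {w : Fin n → ℝ} (hw : w ⬝ᵥ w = 1) {t : ℕ} (ht : t ≤ T)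
    (hgood : GoodAt p s A T cnt t ω) :
    FreshFor p.ε (A t) (recompVec p ω (A t) cnt w) ∧ ∀ t', t ≤ t' → t' ≤ T →
      recompVec p ω (A t) cnt w ⬝ᵥ (A t' *ᵥ recompVec p ω (A t) cnt w)
        < (recompVec p ω (A t) cnt w ⬝ᵥ (A t *ᵥ recompVec p ω (A t) cnt w)) * (1 - p.ε / 4) →
      (A t' ^ (2 * p.K + 1)).trace
        ≤ (1 - 1 / (80 * s) * p.ε) * (A t ^ (2 * p.K + 1)).trace := by
  have hB := hpsd t ht
  rcases (lamMax_nonneg hB).eq_or_lt with h0 | hlam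
  · refine ⟨fresh_of_lamMax_eq_zero hB h0.symm (pick_unit hw), fun t' h1 h2 h3 => ?_⟩
    have e := eq_zero_of_lamMax_eq_zero hB h0.symm
    have := quad_nonneg (hpsd t' h2) (recompVec p ω (A t) cnt w)
    rw [e] at h3 this
    simp only [Matrix.zero_mulVec, dotProduct_zero, zero_mul] at h3
    linarith
  obtain ⟨⟨j₀, hj₀, hlow⟩, hup⟩ := hgood
  set τ := lastSmall p s A T t with hτ
  set tr := (A t ^ (2 * p.K)).trace with htr
  have hlamtr := lamMax_pow_le_trace hB (2 * p.K) (by omega)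
  rw [← htr] at hlamtr
  have htr0 : 0 < tr := lt_of_lt_of_le (pow_pos hlam _) hlamtr
  rw [transpose_pow_mul_pow hB, ← htr] at hlow
  have hcand : ∀ j, cand p ω cnt j = gaussVec p.sup ω (cnt * (p.m * p.d) + j * p.d) := fun j => by
    rw [cand, if_pos hcnt]
  have hnum : numCand p cnt = p.m := by rw [numCand, if_pos hcnt]
  obtain ⟨j, hj, hcj, e⟩ := pick_eq_smul (y := fun j => A t ^ p.K *ᵥ cand p ω cnt j)
    (M := numCand p cnt) (w := w) (c := tr / 10) (by positivity)
    ⟨j₀, hnum ▸ hj₀, by simpa only [hcand, sqLen] using hlow⟩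
  rw [hnum] at hj
  obtain ⟨hg1, hg2⟩ := hup j hj
  rw [← hcand] at hg1 hg2
  have hg1' : cand p ω cnt j ⬝ᵥ cand p ω cnt j ≤ s * n := by
    simpa only [sqLen, Matrix.one_mulVec] using hg1
  have hfresh : FreshFor p.ε (A t) (recompVec p ω (A t) cnt w) := by
    rw [recompVec, e]
    refine fresh_of_power hB hlam hε1 (c := 1 / 10) (by norm_num) ?_ ?_
    · exact lt_of_le_of_lt (mul_le_mul_of_nonneg_left hg1' (Real.exp_pos _).le) hexp
    · linarith
  refine ⟨hfresh, fun t' h1 h2 h3 => ?_⟩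
  have hpos : 0 < (A t ^ p.K *ᵥ cand p ω cnt j) ⬝ᵥ (A t ^ p.K *ᵥ cand p ω cnt j) :=
    lt_of_lt_of_le (by positivity) hcj
  have hray := hfresh.2
  rw [recompVec, e] at h3 hray
  set y := A t ^ p.K *ᵥ cand p ω cnt j with hy
  rw [quad_smul_inv_sqrt _ hpos] at hray
  rw [quad_smul_inv_sqrt _ hpos, quad_smul_inv_sqrt _ hpos, div_mul_eq_mul_div,
    div_lt_div_iff_of_pos_right hpos] at h3
  rw [le_div_iff₀ hpos] at hray
  have hDy : p.ε / 8 * lamMax (A t) * (y ⬝ᵥ y) < y ⬝ᵥ ((A t - A t') *ᵥ y) := by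
    rw [Matrix.sub_mulVec, dotProduct_sub]
    have hly : 0 < lamMax (A t) * (y ⬝ᵥ y) := mul_pos hlam hpos
    have hhalf : 1 / 2 * (lamMax (A t) * (y ⬝ᵥ y)) ≤ y ⬝ᵥ (A t *ᵥ y) := by
      refine le_trans ?_ hray
      rw [mul_assoc (1 - p.ε / 8)]
      exact mul_le_mul_of_nonneg_right (by linarith) hly.le
    have := mul_le_mul_of_nonneg_left hhalf hε0.le
    linarith
  -- Up to the time `τ`, a good block rules out the drop of the quadratic form found in `hDy`.
  have hlarge : ¬ SmallDrop p s (A t) (A t') := by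
    classical
    intro hsm
    have hle : t' ≤ τ := Nat.le_findGreatest h2 ⟨h1, hsm⟩
    have hτs : t ≤ τ ∧ SmallDrop p s (A t) (A τ) :=
      Nat.findGreatest_spec (P := fun t' => t ≤ t' ∧ SmallDrop p s (A t) (A t')) h2 ⟨h1, hsm⟩
    have hτT : τ ≤ T := Nat.findGreatest_le T
    have hD := hmono t τ hτs.1 hτT
    rw [sqLen_gramRoot_mul hD, trace_gramRoot_mul hD hB, ← hy] at hg2
    have hsmall := hτs.2
    rw [SmallDrop, ← htr] at hsmall
    have hmon := quad_nonneg (hmono t' τ hle hτT) y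
    rw [Matrix.sub_mulVec, dotProduct_sub] at hmon
    rw [Matrix.sub_mulVec, dotProduct_sub] at hg2 hDy
    have c1 : s * (A t ^ (2 * p.K) * (A t - A τ)).trace < p.ε / 8 * lamMax (A t) * (tr / 10) := by
      calc _ < s * (1 / (80 * s) * p.ε * lamMax (A t) * tr) := mul_lt_mul_of_pos_left hsmall hs
        _ = _ := by field_simp; norm_num
    have c2 : p.ε / 8 * lamMax (A t) * (tr / 10) ≤ p.ε / 8 * lamMax (A t) * (y ⬝ᵥ y) :=
      mul_le_mul_of_nonneg_left hcj (by positivity)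
    linarith
  rw [SmallDrop, not_lt, ← htr, Matrix.mul_sub, Matrix.trace_sub, ← pow_succ] at hlarge
  have h4 := trace_pow_succ_le hB (hpsd t' h2) (hmono t t' h1 h2) (2 * p.K)
  have h5 := trace_pow_succ_le_lamMax hB (2 * p.K)
  rw [← htr] at h5
  have h6 : 1 / (80 * s) * p.ε * (A t ^ (2 * p.K + 1)).trace
      ≤ 1 / (80 * s) * p.ε * (lamMax (A t) * tr) := mul_le_mul_of_nonneg_left h5 (by positivity)
  linarith

/-- Invariant of the method after time `t`, on good samples; `t₀` is the time of the last
recomputation.  The field `trace` says that all randomized recomputations after the first one were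
paid for, the field `next` that the next one will be. -/
structure RunInv (s : ℝ) (A : ℕ → Matrix (Fin n) (Fin n) ℝ) (p : Params n) (T t t₀ : ℕ)
    (st : AState n) : Prop where
  le : t₀ ≤ t
  fresh : FreshFor p.ε (A t₀) st.w
  thr : st.thr = (st.w ⬝ᵥ (A t₀ *ᵥ st.w)) * (1 - p.ε / 4)
  good : st.thr ≤ st.w ⬝ᵥ (A t *ᵥ st.w)
  cnt_pos : 1 ≤ st.cnt
  trace : (A t₀ ^ (2 * p.K + 1)).trace
    ≤ (1 - 1 / (80 * s) * p.ε) ^ (st.cnt - 1) * (A 0 ^ (2 * p.K + 1)).trace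
  next : st.cnt < n ^ 16 → ∀ t', t₀ ≤ t' → t' ≤ T → st.w ⬝ᵥ (A t' *ᵥ st.w) < st.thr →
    (A t' ^ (2 * p.K + 1)).trace ≤ (1 - 1 / (80 * s) * p.ε) * (A t₀ ^ (2 * p.K + 1)).trace

theorem trace_pow_succ_mono {B B' : Matrix (Fin n) (Fin n) ℝ} (hB : B.PosSemidef)
    (hB' : B'.PosSemidef) (h : (B - B').PosSemidef) (N : ℕ) :
    (B' ^ (N + 1)).trace ≤ (B ^ (N + 1)).trace :=
  (trace_pow_succ_le hB hB' h N).trans (by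
    rw [pow_succ B]
    exact trace_mul_mono (hB.pow N) h)

theorem exists_runInv [NeZero n] (hn2 : 2 ≤ n) (hsup : Function.Injective p.sup)
    (hpsd : ∀ t ≤ T, (A t).PosSemidef)
    (hmono : ∀ t t', t ≤ t' → t' ≤ T → (A t - A t').PosSemidef)
    (hz : ∀ t ≤ T, ∀ i, (∀ k, p.sup k ≠ i) → ∀ r, A t r i = 0)
    (hK : 0 < p.K) (hε0 : 0 < p.ε) (hε1 : p.ε < 1) (hs : 1 ≤ s)
    (hexp : Real.exp (-(2 * p.K * (p.ε / 8))) * (s * n) < 1 / 10) {ω : ℕ → ℝ}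
    (hgood : GoodRun p s A T ω) {t : ℕ} (ht : t ≤ T) :
    ∃ t₀, RunInv s A p T t t₀ (seqState p A ω (t + 1)) := by
  have hexp' : Real.exp (-(2 * p.K * (p.ε / 8))) * n < 1 := by
    have h1 : Real.exp (-(2 * p.K * (p.ε / 8))) * n
        ≤ Real.exp (-(2 * p.K * (p.ε / 8))) * (s * n) :=
      mul_le_mul_of_nonneg_left (le_mul_of_one_le_left (Nat.cast_nonneg n) hs) (Real.exp_pos _).le
    linarith
  have hκ : 0 ≤ 1 - 1 / (80 * s) * p.ε := by
    have : 1 / (80 * s) * p.ε ≤ 1 * 1 := by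
      refine mul_le_mul ?_ hε1.le hε0.le zero_le_one
      rw [div_le_one (by linarith)]
      linarith
    linarith
  -- A recomputation at time `t` establishes the invariant.
  have key : ∀ t ≤ T, ∀ st : AState n, st.w ⬝ᵥ st.w = 1 →
      (st.cnt < n ^ 16 → GoodAt p s A T st.cnt t ω) →
      (st.cnt < n ^ 16 → (A t ^ (2 * p.K + 1)).trace
        ≤ (1 - 1 / (80 * s) * p.ε) ^ st.cnt * (A 0 ^ (2 * p.K + 1)).trace) →
      (¬ st.cnt < n ^ 16 → (A t ^ (2 * p.K + 1)).trace
        ≤ (1 - 1 / (80 * s) * p.ε) ^ (st.cnt - 1) * (A 0 ^ (2 * p.K + 1)).trace) →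
      RunInv s A p T t t (recomp p ω (A t) st) := by
    intro t ht st hw hg htr1 htr2
    have hthr : ∀ w : Fin n → ℝ, 0 ≤ w ⬝ᵥ (A t *ᵥ w) →
        (w ⬝ᵥ (A t *ᵥ w)) * (1 - p.ε / 4) ≤ w ⬝ᵥ (A t *ᵥ w) := fun w hw => by nlinarith
    by_cases hc : st.cnt < n ^ 16
    · obtain ⟨h1, h2⟩ := fresh_randomized hpsd hmono hK hε0 hε1 (by linarith) hexp hc hw ht (hg hc)
      refine ⟨le_rfl, h1, rfl, hthr _ (quad_nonneg (hpsd t ht) _), ?_, ?_, fun _ => h2⟩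
      · simp only [recomp, if_pos hc]; omega
      · simp only [recomp, if_pos hc, Nat.add_sub_cancel]; exact htr1 hc
    · have h1 := fresh_deterministic hsup (hpsd t ht) (hz t ht) hK hε1 hexp' ω hc hw
      refine ⟨le_rfl, h1, rfl, hthr _ (quad_nonneg (hpsd t ht) _), ?_, ?_, fun h => ?_⟩
      · simp only [recomp, if_neg hc]
        have : 1 ≤ n ^ 16 := Nat.one_le_pow _ _ (by omega)
        omega
      · simp only [recomp, if_neg hc]; exact htr2 hc
      · simp only [recomp, if_neg hc] at h
        exact absurd h hc
  induction t with
  | zero =>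
    have hT : Trig (A 0) (seqState p A ω 0) := by
      simp only [Trig, seqState]
      linarith
    have h16 : 0 < n ^ 16 := Nat.pow_pos (by omega)
    refine ⟨0, ?_⟩
    rw [seqState, stepState, if_pos hT]
    refine key 0 ht _ (unit_single 0) (fun hc => hgood _ hc 0 ht ⟨hT, rfl⟩) (fun _ => ?_)
      fun hc => absurd h16 hc
    simp [seqState]
  | succ t ih =>
    obtain ⟨t₀, h⟩ := ih (by omega)
    rw [seqState, stepState]
    split_ifs with hT
    · refine ⟨t + 1, key (t + 1) ht _ h.fresh.1 (fun hc => hgood _ hc _ ht ⟨hT, rfl⟩)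
        (fun hc => ?_) fun hc => ?_⟩
      · have h1 := h.next hc (t + 1) (by have := h.le; omega) ht hT
        have h2 := mul_le_mul_of_nonneg_left h.trace hκ
        have h3 := h.cnt_pos
        calc _ ≤ _ := h1
          _ ≤ _ := h2
          _ = (1 - 1 / (80 * s) * p.ε) ^ ((seqState p A ω (t + 1)).cnt - 1 + 1)
              * (A 0 ^ (2 * p.K + 1)).trace := by ring
          _ = _ := by rw [Nat.sub_add_cancel h3]
      · have hle : t₀ ≤ t + 1 := by have := h.le; omega
        exact (trace_pow_succ_mono (hpsd t₀ (by omega)) (hpsd _ ht) (hmono _ _ hle ht) _).trans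
          h.trace
    · refine ⟨t₀, ⟨?_, h.fresh, h.thr, not_lt.1 hT, h.cnt_pos, h.trace, h.next⟩⟩
      have := h.le
      omega

theorem RunInv.isApprox [NeZero n] (hpsd : ∀ t ≤ T, (A t).PosSemidef)
    (hmono : ∀ t t', t ≤ t' → t' ≤ T → (A t - A t').PosSemidef) (hε0 : 0 < p.ε) (hε1 : p.ε < 1)
    {t t₀ : ℕ} {st : AState n} (ht : t ≤ T) (h : RunInv s A p T t t₀ st) :
    IsApprox p.ε (A t) (st.w ⬝ᵥ (A t *ᵥ st.w)) st.w := by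
  have h1 := h.good
  have h2 := h.fresh.2
  have h0 := h.le
  have h3 := lamMax_mono (hmono t₀ t h.le ht)
  have h4 := lamMax_nonneg (hpsd t ht)
  rw [h.thr] at h1
  have h5 : (1 - p.ε / 8) * lamMax (A t) ≤ st.w ⬝ᵥ (A t₀ *ᵥ st.w) :=
    (mul_le_mul_of_nonneg_left h3 (by linarith)).trans h2
  have h6 : (1 - p.ε / 8) * lamMax (A t) * (1 - p.ε / 4)
      ≤ (st.w ⬝ᵥ (A t₀ *ᵥ st.w)) * (1 - p.ε / 4) := mul_le_mul_of_nonneg_right h5 (by linarith)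
  have h7 : (1 - p.ε) * lamMax (A t) ≤ (1 - p.ε / 8) * lamMax (A t) * (1 - p.ε / 4) := by
    have : 0 ≤ lamMax (A t) * p.ε := mul_nonneg h4 hε0.le
    nlinarith [mul_nonneg this hε0.le]
  exact ⟨quad_le_lamMax_of_unit _ h.fresh.1, by linarith, h.fresh.1, by linarith⟩

/-- The number of randomized recomputations is bounded by the decrease of the maximum eigenvalue. -/
theorem RunInv.cnt_le [NeZero n] (hpsd : ∀ t ≤ T, (A t).PosSemidef)
    (hmono : ∀ t t', t ≤ t' → t' ≤ T → (A t - A t').PosSemidef) (hε0 : 0 < p.ε) (hε1 : p.ε < 1)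
    (hs : 1 ≤ s) {t₀ : ℕ} {st : AState n} (h : RunInv s A p T T t₀ st)
    (hpos : 0 < lamMax (A T)) :
    ((st.cnt : ℝ) - 1) * (1 / (80 * s) * p.ε)
      ≤ Real.log n + (2 * p.K + 1) * Real.log (lamMax (A 0) / lamMax (A T)) := by
  set κ := 1 / (80 * s) * p.ε with hκ
  have hn : (0 : ℝ) < n := by exact_mod_cast NeZero.pos n
  have hκ1 : κ < 1 := by
    have : 1 / (80 * s) ≤ 1 := by
      rw [div_le_one (by linarith)]
      linarith
    nlinarith
  have h0 := hpsd 0 (Nat.zero_le T)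
  have hl0 : 0 < lamMax (A 0) := hpos.trans_le (lamMax_mono (hmono 0 T (Nat.zero_le T) le_rfl))
  have c1 := lamMax_pow_le_trace (hpsd T le_rfl) (2 * p.K + 1) (by omega)
  have c2 := trace_pow_succ_mono (hpsd t₀ h.le) (hpsd T le_rfl) (hmono t₀ T h.le le_rfl) (2 * p.K)
  have c3 := h.trace
  have c4 := trace_pow_le h0 (2 * p.K + 1)
  have c5 : (1 - κ) ^ (st.cnt - 1) ≤ Real.exp (-(((st.cnt : ℝ) - 1) * κ)) := by
    calc _ ≤ (Real.exp (-κ)) ^ (st.cnt - 1) :=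
          pow_le_pow_left₀ (by linarith) (Real.one_sub_le_exp_neg κ) _
      _ = _ := by
        rw [← Real.exp_nat_mul, Nat.cast_sub h.cnt_pos]
        push_cast
        ring_nf
  have c6 : lamMax (A T) ^ (2 * p.K + 1)
      ≤ Real.exp (-(((st.cnt : ℝ) - 1) * κ)) * (n * lamMax (A 0) ^ (2 * p.K + 1)) := by
    refine c1.trans (c2.trans (c3.trans ?_))
    exact mul_le_mul c5 c4 (trace_pow_nonneg h0 _) (Real.exp_pos _).le
  have c7 := Real.log_le_log (pow_pos hpos _) c6
  rw [Real.log_mul (Real.exp_pos _).ne' (by positivity), Real.log_exp,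
    Real.log_mul hn.ne' (by positivity), Real.log_pow, Real.log_pow] at c7
  rw [Real.log_div hl0.ne' hpos.ne']
  push_cast at c7
  linarith

end Analysis

end DecEig

namespace RealRAM

/-! ### Reasoning about programs -/

/-- From state `s`, the program `c` halts after at most `B` steps in a state that satisfies `Q`. -/
def Runs (ω : ℕ → ℝ) (c : Cmd) (s : State) (B : ℕ) (Q : State → Prop) : Prop :=
  ∃ s' k, Exec ω c s s' k ∧ k ≤ B ∧ Q s'

/-- The instruction does not write the natural variable `x`. -/
def Instr.keepsN (x : ℕ) : Instr → Bool
  | .nConst y _ => y != x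
  | .nAdd y _ _ => y != x
  | .nSub y _ _ => y != x
  | .nRead y _ _ => y != x
  | _ => true

/-- The instruction does not write the real variable `x`. -/
def Instr.keepsR (x : ℕ) : Instr → Bool
  | .rConst y _ => y != x
  | .rOfNat y _ => y != x
  | .rAdd y _ _ => y != x
  | .rSub y _ _ => y != x
  | .rMul y _ _ => y != x
  | .rDiv y _ _ => y != x
  | .rSqrt y _ => y != x
  | .rRead y _ _ => y != x
  | .gauss y => y != x
  | _ => true

/-- The instruction does not write into the natural array `a`. -/
def Instr.keepsNA (a : ℕ) : Instr → Bool
  | .nWrite b _ _ => b != a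
  | _ => true

/-- The instruction does not write into the real array `a`. -/
def Instr.keepsRA (a : ℕ) : Instr → Bool
  | .rWrite b _ _ => b != a
  | _ => true

/-- The instruction does not consume a random sample. -/
def Instr.keepsPos : Instr → Bool
  | .gauss _ => false
  | _ => true

/-- Every instruction in the program satisfies `f`. -/
def Cmd.all (f : Instr → Bool) : Cmd → Bool
  | .skip => true
  | .instr i => f i
  | .seq c d => c.all f && d.all f
  | .ite _ c d => c.all f && d.all f
  | .loop _ c => c.all f

/-- The parts of the memory that no instruction of `c` writes agree in `s` and `s'`. -/
structure Frame (c : Cmd) (s s' : State) : Prop where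
  nv : ∀ x, c.all (Instr.keepsN x) = true → s'.nv x = s.nv x
  rv : ∀ x, c.all (Instr.keepsR x) = true → s'.rv x = s.rv x
  na : ∀ a, c.all (Instr.keepsNA a) = true → s'.na a = s.na a
  ra : ∀ a, c.all (Instr.keepsRA a) = true → s'.ra a = s.ra a
  pos : c.all Instr.keepsPos = true → s'.pos = s.pos

theorem Frame.refl (c : Cmd) (s : State) : Frame c s s :=
  ⟨fun _ _ => rfl, fun _ _ => rfl, fun _ _ => rfl, fun _ _ => rfl, fun _ => rfl⟩

theorem Frame.trans {c : Cmd} {s s' s'' : State} (h : Frame c s s') (h' : Frame c s' s'') :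
    Frame c s s'' :=
  ⟨fun x hx => (h'.nv x hx).trans (h.nv x hx), fun x hx => (h'.rv x hx).trans (h.rv x hx),
    fun x hx => (h'.na x hx).trans (h.na x hx), fun x hx => (h'.ra x hx).trans (h.ra x hx),
    fun hx => (h'.pos hx).trans (h.pos hx)⟩

theorem Frame.of_imp {c d : Cmd} {s s' : State} (h : Frame c s s')
    (hcd : ∀ f : Instr → Bool, d.all f = true → c.all f = true) : Frame d s s' :=
  ⟨fun x hx => h.nv x (hcd _ hx), fun x hx => h.rv x (hcd _ hx), fun x hx => h.na x (hcd _ hx),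
    fun x hx => h.ra x (hcd _ hx), fun hx => h.pos (hcd _ hx)⟩

section SimpLemmas

variable (s : State) (x c a i : ℕ) (r : ℝ)

@[simp] theorem State.setN_nv : (s.setN x c).nv = Function.update s.nv x c := rfl
@[simp] theorem State.setN_rv : (s.setN x c).rv = s.rv := rfl
@[simp] theorem State.setN_na : (s.setN x c).na = s.na := rfl
@[simp] theorem State.setN_ra : (s.setN x c).ra = s.ra := rfl
@[simp] theorem State.setN_pos : (s.setN x c).pos = s.pos := rfl
@[simp] theorem State.setR_nv : (s.setR x r).nv = s.nv := rfl
@[simp] theorem State.setR_rv : (s.setR x r).rv = Function.update s.rv x r := rfl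
@[simp] theorem State.setR_na : (s.setR x r).na = s.na := rfl
@[simp] theorem State.setR_ra : (s.setR x r).ra = s.ra := rfl
@[simp] theorem State.setR_pos : (s.setR x r).pos = s.pos := rfl
@[simp] theorem State.setNA_nv : (s.setNA a i c).nv = s.nv := rfl
@[simp] theorem State.setNA_rv : (s.setNA a i c).rv = s.rv := rfl
@[simp] theorem State.setNA_na :
    (s.setNA a i c).na = Function.update s.na a (Function.update (s.na a) i c) := rfl
@[simp] theorem State.setNA_ra : (s.setNA a i c).ra = s.ra := rfl
@[simp] theorem State.setNA_pos : (s.setNA a i c).pos = s.pos := rfl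
@[simp] theorem State.setRA_nv : (s.setRA a i r).nv = s.nv := rfl
@[simp] theorem State.setRA_rv : (s.setRA a i r).rv = s.rv := rfl
@[simp] theorem State.setRA_na : (s.setRA a i r).na = s.na := rfl
@[simp] theorem State.setRA_ra :
    (s.setRA a i r).ra = Function.update s.ra a (Function.update (s.ra a) i r) := rfl
@[simp] theorem State.setRA_pos : (s.setRA a i r).pos = s.pos := rfl

end SimpLemmas

theorem Instr.frame (ω : ℕ → ℝ) (i : Instr) (s : State) : Frame (.instr i) s (i.exec ω s) := by
  constructor
  · intro x hx
    cases i <;> first | rfl | exact Function.update_of_ne (bne_iff_ne.1 hx).symm _ _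
  · intro x hx
    cases i <;> first | rfl | exact Function.update_of_ne (bne_iff_ne.1 hx).symm _ _
  · intro x hx
    cases i <;> first | rfl | exact Function.update_of_ne (bne_iff_ne.1 hx).symm _ _
  · intro x hx
    cases i <;> first | rfl | exact Function.update_of_ne (bne_iff_ne.1 hx).symm _ _
  · intro hx
    cases i <;> first | rfl | exact absurd hx Bool.false_ne_true

theorem Exec.frame {ω : ℕ → ℝ} {c : Cmd} {s s' : State} {k : ℕ} (h : Exec ω c s s' k) :
    Frame c s s' := by
  induction h with
  | skip s => exact Frame.refl _ s
  | instr i s => exact Instr.frame ω i s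
  | seq _ _ ih₁ ih₂ =>
    refine Frame.trans (ih₁.of_imp fun f hf => ?_) (ih₂.of_imp fun f hf => ?_)
    · exact (Bool.and_eq_true_iff.1 hf).1
    · exact (Bool.and_eq_true_iff.1 hf).2
  | iteTrue _ _ ih => exact ih.of_imp fun f hf => (Bool.and_eq_true_iff.1 hf).1
  | iteFalse _ _ ih => exact ih.of_imp fun f hf => (Bool.and_eq_true_iff.1 hf).2
  | loopTrue _ _ _ ih₁ ih₂ =>
    refine Frame.trans (ih₁.of_imp fun f hf => ?_) ih₂
    exact hf
  | loopFalse _ => exact Frame.refl _ _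

section Rules

variable {ω : ℕ → ℝ} {c d : Cmd} {s : State} {B B' : ℕ} {Q Q' : State → Prop}

/-- Consequence rule; the memory that `c` does not write is known to be unchanged. -/
theorem Runs.mono (h : Runs ω c s B Q) (hB : B ≤ B') (hQ : ∀ s', Frame c s s' → Q s' → Q' s') :
    Runs ω c s B' Q' := by
  obtain ⟨s', k, he, hk, hq⟩ := h
  exact ⟨s', k, he, hk.trans hB, hQ s' he.frame hq⟩

theorem Runs.skip (h : Q s) : Runs ω .skip s 1 Q := ⟨s, 1, .skip s, le_rfl, h⟩

theorem Runs.instr {i : Instr} (h : Q (i.exec ω s)) : Runs ω (.instr i) s 1 Q :=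
  ⟨_, 1, .instr i s, le_rfl, h⟩

theorem Runs.seq (h : Runs ω c s B fun s' => Runs ω d s' B' Q) :
    Runs ω (.seq c d) s (B + B') Q := by
  obtain ⟨s', k, he, hk, s'', k', he', hk', hq⟩ := h
  exact ⟨s'', k + k', .seq he he', by omega, hq⟩

/-- Sequencing, with the specification of the first part and the frame of its run at hand. -/
theorem Runs.seq' {R : State → Prop} (h : Runs ω c s B R)
    (h' : ∀ s', Frame c s s' → R s' → Runs ω d s' B' Q) : Runs ω (.seq c d) s (B + B') Q :=
  Runs.seq (h.mono le_rfl h')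

theorem Runs.ite {b : Test} (h : b.Holds s → Runs ω c s B Q) (h' : ¬ b.Holds s → Runs ω d s B Q) :
    Runs ω (.ite b c d) s (B + 1) Q := by
  by_cases hb : b.Holds s
  · obtain ⟨s', k, he, hk, hq⟩ := h hb
    exact ⟨s', k + 1, .iteTrue hb he, by omega, hq⟩
  · obtain ⟨s', k, he, hk, hq⟩ := h' hb
    exact ⟨s', k + 1, .iteFalse hb he, by omega, hq⟩

/-- A loop that is known to make `N` iterations. -/
theorem Runs.while {b : Test} {N : ℕ} {Inv : ℕ → State → Prop} (h0 : Inv 0 s)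
    (hend : ∀ s', Inv N s' → ¬ b.Holds s')
    (step : ∀ k < N, ∀ s', Inv k s' → b.Holds s' ∧ Runs ω c s' B (Inv (k + 1))) :
    Runs ω (.loop b c) s (N * (B + 1) + 1) (Inv N) := by
  have key : ∀ j k s, k + j = N → Inv k s → Runs ω (.loop b c) s (j * (B + 1) + 1) (Inv N) := by
    intro j
    induction j with
    | zero =>
      intro k s hk hi
      rw [add_zero] at hk
      subst hk
      exact ⟨s, 1, .loopFalse (hend s hi), by omega, hi⟩
    | succ j ih =>
      intro k s hk hi
      obtain ⟨hb, s', l, he, hl, hi'⟩ := step k (by omega) s hi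
      obtain ⟨s'', l', he', hl', hq⟩ := ih (k + 1) s' (by omega) hi'
      refine ⟨s'', l + l' + 1, .loopTrue hb he he', ?_, hq⟩
      rw [Nat.add_mul]
      omega
  exact key N 0 s (by omega) h0

/-- A sequence of instructions. -/
def Cmd.block : List Instr → Cmd
  | [] => .skip
  | i :: l => .seq (.instr i) (Cmd.block l)

theorem Runs.block {l : List Instr} (h : Q (l.foldl (fun s i => i.exec ω s) s)) :
    Runs ω (Cmd.block l) s (l.length + 1) Q := by
  induction l generalizing s with
  | nil => exact Runs.skip h
  | cons i l ih =>
    have : Runs ω (.seq (.instr i) (Cmd.block l)) s (1 + (l.length + 1)) Q :=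
      Runs.seq (Runs.instr (ih h))
    exact this.mono (by simp only [List.length_cons]; omega) fun _ _ h => h

/-- `for i < b do c`; natural variable `2` is assumed to hold `1`. -/
def Cmd.forUp (i b : ℕ) (c : Cmd) : Cmd :=
  .seq (.instr (.nConst i 0)) (.loop (.nLt i b) (.seq c (.instr (.nAdd i i 2))))

theorem Runs.forUp {i b : ℕ} {N : ℕ} {Inv : ℕ → State → Prop} (hb : s.nv b = N) (h2 : s.nv 2 = 1)
    (hib : (i != b && i != 2 && c.all (Instr.keepsN b) && c.all (Instr.keepsN i)
      && c.all (Instr.keepsN 2)) = true)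
    (hInv : ∀ k s' l, Inv k s' → Inv k (s'.setN i l)) (h0 : Inv 0 s)
    (step : ∀ k < N, ∀ s', Frame (Cmd.forUp i b c) s s' → s'.nv i = k → s'.nv 2 = 1 → Inv k s' →
      Runs ω c s' B (Inv (k + 1))) :
    Runs ω (Cmd.forUp i b c) s (N * (B + 2) + 2) (Inv N) := by
  simp only [Bool.and_eq_true, bne_iff_ne, ne_eq] at hib
  obtain ⟨⟨⟨⟨hib, hi2⟩, kb⟩, ki⟩, k2⟩ := hib
  have e : N * (B + 2) + 2 = 1 + (N * (B + 1 + 1) + 1) := by ring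
  rw [e]
  refine Runs.seq (Runs.instr ?_)
  have hw : Runs ω (.loop (.nLt i b) (.seq c (.instr (.nAdd i i 2)))) ((Instr.nConst i 0).exec ω s)
      (N * (B + 1 + 1) + 1) (fun s' => Frame (Cmd.forUp i b c) s s' ∧ s'.nv i = N ∧ Inv N s') := by
    refine Runs.while (Inv := fun k s' => Frame (Cmd.forUp i b c) s s' ∧ s'.nv i = k ∧ Inv k s')
      ⟨?_, by simp [Instr.exec], hInv _ _ _ h0⟩ ?_ ?_
    · exact (Instr.frame ω _ s).of_imp fun f hf => (Bool.and_eq_true_iff.1 hf).1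
    · rintro s' ⟨hf, hi, -⟩
      have hb' : s'.nv b = N := (hf.nv b (by
        simp only [Cmd.forUp, Cmd.all, kb, Instr.keepsN, Bool.and_eq_true, bne_iff_ne, ne_eq]
        exact ⟨hib, trivial, hib⟩)).trans hb
      simp [Test.Holds, hi, hb']
    · rintro k hk s' ⟨hf, hi, hinv⟩
      have hb' : s'.nv b = N := (hf.nv b (by
        simp only [Cmd.forUp, Cmd.all, kb, Instr.keepsN, Bool.and_eq_true, bne_iff_ne, ne_eq]
        exact ⟨hib, trivial, hib⟩)).trans hb
      have h2' : s'.nv 2 = 1 := (hf.nv 2 (by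
        simp only [Cmd.forUp, Cmd.all, k2, Instr.keepsN, Bool.and_eq_true, bne_iff_ne, ne_eq]
        exact ⟨hi2, trivial, hi2⟩)).trans h2
      refine ⟨by simp [Test.Holds, hi, hb', hk], ?_⟩
      refine Runs.seq' (step k hk s' hf hi h2' hinv) fun s'' hf' hinv' => Runs.instr ?_
      have e1 : s''.nv i = k := (hf'.nv i ki).trans hi
      have e2 : s''.nv 2 = 1 := (hf'.nv 2 k2).trans h2'
      refine ⟨?_, ?_, ?_⟩
      · refine hf.trans ((hf'.of_imp fun f hf => ?_).trans
          ((Instr.frame ω (.nAdd i i 2) s'').of_imp fun f hf => ?_))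
        · exact (Bool.and_eq_true_iff.1 (Bool.and_eq_true_iff.1 hf).2).1
        · exact (Bool.and_eq_true_iff.1 (Bool.and_eq_true_iff.1 hf).2).2
      · simp [Instr.exec, e1, e2]
      · exact hInv _ _ _ hinv'
  exact hw.mono le_rfl fun s' _ h => h.2.2

end Rules

/-- Runs of a dynamic algorithm: invariants and time bounds for the single updates give a run that
satisfies them at all times.  `load t` is the arrival of the `t`-th update. -/
theorem exists_run {ω : ℕ → ℝ} {P : DynAlg} {s₀ : State} {load : ℕ → State → State}
    {Inv : ℕ → State → Prop} {b : ℕ → ℕ} {T : ℕ} (h0 : Runs ω P.init s₀ (b 0) (Inv 0))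
    (hstep : ∀ t < T, ∀ s, Inv t s → Runs ω P.update (load t s) (b (t + 1)) (Inv (t + 1))) :
    ∃ (s : ℕ → State) (c : ℕ → ℕ), Exec ω P.init s₀ (s 0) (c 0) ∧
      (∀ t < T, Exec ω P.update (load t (s t)) (s (t + 1)) (c (t + 1))) ∧
      ∀ t ≤ T, Inv t (s t) ∧ c t ≤ b t := by
  obtain ⟨s₁, k₁, he₁, hk₁, hi₁⟩ := h0
  have hch : ∀ (t : ℕ) (s : State), ∃ r : State × ℕ, t < T → Inv t s →
      Exec ω P.update (load t s) r.1 r.2 ∧ r.2 ≤ b (t + 1) ∧ Inv (t + 1) r.1 := by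
    intro t s
    by_cases h : t < T ∧ Inv t s
    · obtain ⟨s', k, he, hk, hi⟩ := hstep t h.1 s h.2
      exact ⟨(s', k), fun _ _ => ⟨he, hk, hi⟩⟩
    · exact ⟨(s, 0), fun h1 h2 => absurd ⟨h1, h2⟩ h⟩
  choose F hF using hch
  let σ : ℕ → State × ℕ := fun t => Nat.rec (s₁, k₁) (fun t r => F t r.1) t
  have hσ : ∀ t ≤ T, Inv t (σ t).1 ∧ (σ t).2 ≤ b t := by
    intro t
    induction t with
    | zero => exact fun _ => ⟨hi₁, hk₁⟩
    | succ t ih =>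
      intro ht
      have := hF t (σ t).1 ht (ih (by omega)).1
      exact ⟨this.2.2, this.2.1⟩
  exact ⟨fun t => (σ t).1, fun t => (σ t).2, he₁,
    fun t ht => (hF t (σ t).1 ht (hσ t ht.le).1).1, hσ⟩

/-- Consecutive writes of the values `f 0, …, f (k - 1)` to the cells `idx 0, …, idx (k - 1)`. -/
def writes {α : Type*} (idx : ℕ → ℕ) (f : ℕ → α) : ℕ → (ℕ → α) → ℕ → α
  | 0, X => X
  | k + 1, X => Function.update (writes idx f k X) (idx k) (f k)

theorem writes_of_ne {α : Type*} {idx : ℕ → ℕ} {f : ℕ → α} {k : ℕ} {X : ℕ → α} {c : ℕ}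
    (h : ∀ l < k, idx l ≠ c) : writes idx f k X c = X c := by
  induction k with
  | zero => rfl
  | succ k ih =>
    rw [writes, Function.update_of_ne (h k (by omega)).symm, ih fun l hl => h l (by omega)]

/-- If all writes to the cell `c` write the value `r`, then `c` holds `r` or is untouched. -/
theorem writes_of_eq {α : Type*} {idx : ℕ → ℕ} {f : ℕ → α} {k : ℕ} {X : ℕ → α} {c : ℕ} {r : α}
    (h : ∀ l < k, idx l = c → f l = r) (hex : ∃ l < k, idx l = c) : writes idx f k X c = r := by
  induction k with
  | zero => obtain ⟨l, hl, -⟩ := hex; omega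
  | succ k ih =>
    rw [writes]
    by_cases hk : idx k = c
    · subst hk
      rw [Function.update_self, h k (by omega) rfl]
    · rw [Function.update_of_ne (Ne.symm hk)]
      obtain ⟨l, hl, e⟩ := hex
      refine ih (fun l hl => h l (by omega)) ⟨l, ?_, e⟩
      rcases Nat.lt_succ_iff_lt_or_eq.1 hl with hl | rfl
      · exact hl
      · exact absurd e hk

theorem writes_shift {α : Type*} {f : ℕ → α} {a k q : ℕ} {X : ℕ → α} (hq : q < k) :
    writes (fun l => a + l) f k X (a + q) = f q :=
  writes_of_eq (fun l _ e => by rw [Nat.add_left_cancel e]) ⟨q, hq, rfl⟩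

theorem writes_shift_of_lt {α : Type*} {f : ℕ → α} {a k q : ℕ} {X : ℕ → α} (hq : q < a) :
    writes (fun l => a + l) f k X q = X q :=
  writes_of_ne fun l _ => by omega

/-! ### Lists of elementary linear operations -/

/-- The `k` operations number `a, …, a + k - 1`; operation `q` adds `val q * X (src q)` to the cell
`dst q`. -/
def opsRun (dst src : ℕ → ℕ) (val : ℕ → ℝ) (a : ℕ) : ℕ → (ℕ → ℝ) → ℕ → ℝ
  | 0, X => X
  | k + 1, X => Function.update (opsRun dst src val a k X) (dst (a + k))
      (opsRun dst src val a k X (dst (a + k))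
        + val (a + k) * opsRun dst src val a k X (src (a + k)))

section Ops

variable {dst src : ℕ → ℕ} {val : ℕ → ℝ} {a k : ℕ} {X : ℕ → ℝ}

theorem opsRun_add (dst src : ℕ → ℕ) (val : ℕ → ℝ) (a k l : ℕ) (X : ℕ → ℝ) :
    opsRun dst src val a (k + l) X
      = opsRun dst src val (a + k) l (opsRun dst src val a k X) := by
  induction l with
  | zero => rfl
  | succ l ih => rw [← add_assoc, opsRun, ih, opsRun, add_assoc a k l]

theorem opsRun_congr {dst' src' : ℕ → ℕ} {val' : ℕ → ℝ}
    (h : ∀ q < a + k, dst q = dst' q ∧ src q = src' q ∧ val q = val' q) :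
    opsRun dst src val a k X = opsRun dst' src' val' a k X := by
  induction k with
  | zero => rfl
  | succ k ih =>
    obtain ⟨h1, h2, h3⟩ := h (a + k) (by omega)
    rw [opsRun, opsRun, ih fun q hq => h q (by omega), h1, h2, h3]

theorem opsRun_of_ne {c : ℕ} (h : ∀ q < a + k, dst q ≠ c) :
    opsRun dst src val a k X c = X c := by
  induction k with
  | zero => rfl
  | succ k ih =>
    rw [opsRun, Function.update_of_ne (h (a + k) (by omega)).symm, ih fun q hq => h q (by omega)]

/-- A batch of operations that does not read what it writes. -/
theorem opsRun_batch (h : ∀ q < k, ∀ q' < k, src (a + q) ≠ dst (a + q')) (c : ℕ) :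
    opsRun dst src val a k X c
      = X c + ∑ q ∈ Finset.range k,
        if dst (a + q) = c then val (a + q) * X (src (a + q)) else 0 := by
  induction k generalizing c with
  | zero => simp [opsRun]
  | succ k ih =>
    have ih' := ih fun q hq q' hq' => h q (by omega) q' (by omega)
    have hs : opsRun dst src val a k X (src (a + k)) = X (src (a + k)) := by
      rw [ih', Finset.sum_eq_zero, add_zero]
      intro q hq
      rw [if_neg]
      exact (h k (by omega) q (by have := Finset.mem_range.1 hq; omega)).symm
    rw [opsRun, Finset.sum_range_succ, ← add_assoc, ← ih' c, hs]
    by_cases hc : dst (a + k) = c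
    · rw [if_pos hc, ← hc, Function.update_self]
    · rw [if_neg hc, Function.update_of_ne (Ne.symm hc), add_zero]

end Ops

end RealRAM

namespace DecEig

open RealRAM

variable {n : ℕ}

/-- The operation list represents the matrix `B` on the coordinates enumerated by `p.sup`: after
clearing all cells that are written, and running the list, the cells `n + i` hold `B x`, where `x`
is the content of the first `n` cells.  All cells used lie below `zc`. -/
structure Rep (p : Params n) (B : Matrix (Fin n) (Fin n) ℝ) (len : ℕ) (dst src : ℕ → ℕ)
    (val : ℕ → ℝ) (zc : ℕ) : Prop where
  zc_ge : n + n ≤ zc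
  bnd : ∀ q < len, n ≤ dst q ∧ dst q < zc ∧ src q < zc
  sem : ∀ (X : ℕ → ℝ) (k : Fin p.d),
    opsRun dst src val 0 len (writes dst (fun _ => 0) len X) (n + p.sup k)
      = ∑ j : Fin n, B (p.sup k) j * X j

/-! ### The program

Natural variables: `0` dimension, `1` length of the input, `2` the constant one, `3` length of the
operation list, `4` number of support coordinates, `5`, `9`, `11` loop counters, `6`, `7`, `8`
scratch, `10` number of power steps, `12` number of random candidates, `13` first unused cell of the
work array, `14` number of candidates, `16` length of the second operation list.

Real variables: `0` accuracy, `1` value of the quadratic form at the current vector, `2` threshold,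
`3` number of randomized recomputations, `4` its limit `n ^ 16`, `5`, `6` scratch, `7` squared
length of the candidate, `8` best squared length, `9` the constant zero.

Natural arrays: `0`, `1` input, `2`, `3` targets and sources of the operations, `4` support
coordinates, `5`, `6` targets and sources of the second operation list.

Real arrays: `0` input, `1` current vector, `2` work array, `3` coefficients of the operations,
`4` best candidate, `5` coefficients of the second operation list.

In the work array, the cells below `n` hold the argument `x` of a multiplication, the next `n` cells
its result `y`, and each later cell the inner product of `x` with one update vector.  A program that
only copies a variable adds zero to it. -/

open Instr Cmd Test in
/-- Clears all targets of operations. -/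
def clearCmd : Cmd := forUp 5 3 (block [nRead 6 2 5, rConst 5 0, rWrite 2 6 5])

open Instr Cmd Test in
/-- Runs the operation list. -/
def applyCmd : Cmd := forUp 5 3 (block [nRead 6 2 5, nRead 7 3 5, rRead 5 3 5, rRead 6 2 7,
  rMul 5 5 6, rRead 6 2 6, rAdd 6 6 5, rWrite 2 6 6])

/-- Multiplication of the vector in the work array by the represented matrix. -/
def mulCmd : Cmd := .seq clearCmd applyCmd

open Instr Cmd Test in
/-- Copies the result of a multiplication to its argument. -/
def copyBackCmd : Cmd := forUp 5 4 (block [nRead 6 4 5, nAdd 7 6 0, rRead 5 2 7, rWrite 2 6 5])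

/-- Multiplies the vector in the work array by the power of the represented matrix. -/
def powerCmd : Cmd := .forUp 9 10 (.seq mulCmd copyBackCmd)

open Instr Cmd Test in
/-- Writes a starting vector: a random one, or, once the limit of randomized recomputations is
reached, the unit vector of the support coordinate whose number is in variable `11`. -/
def sampleCmd : Cmd := forUp 5 4 (seq (instr (nRead 6 4 5)) (seq
  (ite (rLt 3 4) (instr (gauss 5))
    (ite (nLe 5 11) (ite (nLe 11 5) (instr (rConst 5 1)) (instr (rConst 5 0)))
      (instr (rConst 5 0))))
  (instr (rWrite 2 6 5))))

open Instr Cmd Test in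
/-- Squared length of the vector in the work array. -/
def normCmd : Cmd := seq (instr (rConst 7 0))
  (forUp 5 4 (block [nRead 6 4 5, rRead 5 2 6, rMul 5 5 5, rAdd 7 7 5]))

open Instr Cmd Test in
/-- Keeps the candidate in the work array if it is longer than the best one so far. -/
def keepCmd : Cmd := ite (rLt 8 7)
  (seq (instr (rAdd 8 7 9)) (forUp 5 4 (block [nRead 6 4 5, rRead 5 2 6, rWrite 4 6 5]))) skip

/-- Determines the longest candidate. -/
def candidatesCmd : Cmd :=
  .forUp 11 14 (.seq sampleCmd (.seq powerCmd (.seq normCmd keepCmd)))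

open Instr Cmd Test in
/-- Normalizes the best candidate into the output array. -/
def outputCmd : Cmd := ite (rLt 9 8)
  (seq (block [rSqrt 6 8, nConst 6 0, rWrite 1 6 9])
    (forUp 5 4 (block [nRead 6 4 5, rRead 5 4 6, rDiv 5 5 6, rWrite 1 6 5]))) skip

open Instr Cmd Test in
/-- Evaluates the quadratic form at the output vector. -/
def quadCmd : Cmd := seq (forUp 5 4 (block [nRead 6 4 5, rRead 5 1 6, rWrite 2 6 5])) (seq mulCmd
  (seq (instr (rConst 1 0))
    (forUp 5 4 (block [nRead 6 4 5, nAdd 7 6 0, rRead 5 2 6, rRead 6 2 7, rMul 5 5 6,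
      rAdd 1 1 5]))))

open Instr Cmd Test in
/-- Sets the threshold, and counts the recomputation if it was a randomized one. -/
def thresholdCmd : Cmd := seq (block [rConst 5 (1 / 4), rMul 5 0 5, rConst 6 1, rSub 5 6 5,
  rMul 2 1 5]) (ite (rLt 3 4) (instr (rAdd 3 3 6)) skip)

open Instr Cmd Test in
/-- A recomputation. -/
def recompCmd : Cmd := seq (ite (rLt 3 4) (block [nConst 6 0, nAdd 14 12 6])
    (block [nConst 6 0, nAdd 14 4 6])) (seq (instr (rConst 8 0))
  (seq candidatesCmd (seq outputCmd (seq quadCmd thresholdCmd))))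

/-! ### Correctness of the subroutines -/

/-- The constants kept in memory. -/
structure Static (p : Params n) (s : State) : Prop where
  dim : s.nv 0 = n
  one : s.nv 2 = 1
  d : s.nv 4 = p.d
  K : s.nv 10 = p.K
  m : s.nv 12 = p.m
  eps : s.rv 0 = p.ε
  cap : s.rv 4 = (n : ℝ) ^ 16
  zero : s.rv 9 = 0
  sup : ∀ k : Fin p.d, s.na 4 k = p.sup k

/-- The program writes none of the constants. -/
def keepsStatic (c : Cmd) : Bool :=
  c.all (Instr.keepsN 0) && c.all (Instr.keepsN 2) && c.all (Instr.keepsN 4)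
    && c.all (Instr.keepsN 10) && c.all (Instr.keepsN 12) && c.all (Instr.keepsR 0)
    && c.all (Instr.keepsR 4) && c.all (Instr.keepsR 9) && c.all (Instr.keepsNA 4)

theorem Static.frame {p : Params n} {c : Cmd} {s s' : State} (h : Static p s) (hf : Frame c s s')
    (hc : keepsStatic c = true) : Static p s' := by
  simp only [keepsStatic, Bool.and_eq_true] at hc
  obtain ⟨⟨⟨⟨⟨⟨⟨⟨h0, h2⟩, h4⟩, h10⟩, h12⟩, r0⟩, r4⟩, r9⟩, a4⟩ := hc
  exact ⟨(hf.nv 0 h0).trans h.dim, (hf.nv 2 h2).trans h.one, (hf.nv 4 h4).trans h.d,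
    (hf.nv 10 h10).trans h.K, (hf.nv 12 h12).trans h.m, (hf.rv 0 r0).trans h.eps,
    (hf.rv 4 r4).trans h.cap, (hf.rv 9 r9).trans h.zero, fun k => by rw [hf.na 4 a4]; exact h.sup k⟩

/-- The operation list in memory represents `B`. -/
def OpsRep (p : Params n) (B : Matrix (Fin n) (Fin n) ℝ) (s : State) : Prop :=
  Rep p B (s.nv 3) (s.na 2) (s.na 3) (s.ra 3) (s.nv 13)

/-- The program does not write the operation list. -/
def keepsOps (c : Cmd) : Bool :=
  c.all (Instr.keepsN 3) && c.all (Instr.keepsN 13) && c.all (Instr.keepsNA 2)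
    && c.all (Instr.keepsNA 3) && c.all (Instr.keepsRA 3)

theorem OpsRep.frame {p : Params n} {B : Matrix (Fin n) (Fin n) ℝ} {c : Cmd} {s s' : State}
    (h : OpsRep p B s) (hf : Frame c s s') (hc : keepsOps c = true) : OpsRep p B s' := by
  simp only [keepsOps, Bool.and_eq_true] at hc
  obtain ⟨⟨⟨⟨h3, h13⟩, a2⟩, a3⟩, r3⟩ := hc
  rw [OpsRep, hf.nv 3 h3, hf.nv 13 h13, hf.na 2 a2, hf.na 3 a3, hf.ra 3 r3]
  exact h

/-- The vector in the work array. -/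
def workVec (n : ℕ) (s : State) : Fin n → ℝ := fun i => s.ra 2 i

/-- Vectors supported on the coordinates enumerated by `p.sup`. -/
def Supported (p : Params n) (x : Fin n → ℝ) : Prop := ∀ i, (∀ k, p.sup k ≠ i) → x i = 0

section Subroutines

variable {p : Params n} {B : Matrix (Fin n) (Fin n) ℝ} {ω : ℕ → ℝ} {s : State}

theorem runs_clear (h1 : s.nv 2 = 1) : Runs ω clearCmd s (s.nv 3 * 6 + 2)
    fun s' => s'.ra 2 = writes (s.na 2) (fun _ => 0) (s.nv 3) (s.ra 2) := by
  refine Runs.forUp (B := 4) (Inv := fun k s' => s'.ra 2 = writes (s.na 2) (fun _ => 0) k (s.ra 2))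
    rfl h1 rfl (fun _ _ _ h => h) rfl fun k hk s' hf hi _ hinv => ?_
  refine Runs.block ?_
  have hd := hf.na 2 rfl
  simp [Instr.exec, hinv, hi, hd, writes]

theorem runs_apply (h1 : s.nv 2 = 1) : Runs ω applyCmd s (s.nv 3 * 11 + 2)
    fun s' => s'.ra 2 = opsRun (s.na 2) (s.na 3) (s.ra 3) 0 (s.nv 3) (s.ra 2) := by
  refine Runs.forUp (B := 9)
    (Inv := fun k s' => s'.ra 2 = opsRun (s.na 2) (s.na 3) (s.ra 3) 0 k (s.ra 2))
    rfl h1 rfl (fun _ _ _ h => h) rfl fun k hk s' hf hi _ hinv => ?_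
  refine Runs.block ?_
  have h2 := hf.na 2 rfl
  have h3 := hf.na 3 rfl
  have h4 := hf.ra 3 rfl
  simp [Instr.exec, hinv, hi, h2, h3, h4, opsRun]

theorem runs_mul (hs : Static p s) (hB : OpsRep p B s) :
    Runs ω mulCmd s (s.nv 3 * 17 + 4) fun s' => workVec n s' = workVec n s ∧
      ∀ k : Fin p.d, s'.ra 2 (n + p.sup k) = (B *ᵥ workVec n s) (p.sup k) := by
  rw [show s.nv 3 * 17 + 4 = (s.nv 3 * 6 + 2) + (s.nv 3 * 11 + 2) by ring]
  refine Runs.seq' (runs_clear hs.one) fun s₁ hf₁ h₁ => ?_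
  have e3 := hf₁.nv 3 rfl
  rw [← e3]
  refine (runs_apply ((hf₁.nv 2 rfl).trans hs.one)).mono le_rfl fun s₂ hf₂ h₂ => ?_
  rw [hf₁.na 2 rfl, hf₁.na 3 rfl, hf₁.ra 3 rfl, e3, h₁] at h₂
  constructor
  · funext i
    have hne : ∀ q < 0 + s.nv 3, s.na 2 q ≠ i := by
      intro q hq
      have := (hB.bnd q (by omega)).1
      omega
    rw [workVec, h₂, opsRun_of_ne hne, writes_of_ne fun l hl => hne l (by omega)]
    rfl
  · intro k
    rw [h₂, hB.sem]
    rfl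

theorem mulVec_supported (hB : ∀ i, (∀ k, p.sup k ≠ i) → ∀ r, B r i = 0) (hsym : Bᵀ = B)
    (x : Fin n → ℝ) : Supported p (B *ᵥ x) := by
  intro i hi
  rw [Matrix.mulVec, dotProduct]
  refine Finset.sum_eq_zero fun j _ => ?_
  rw [← hsym, Matrix.transpose_apply, hB i hi, zero_mul]

theorem runs_copyBack (hs : Static p s) :
    Runs ω copyBackCmd s (p.d * 7 + 2) fun s' =>
      (∀ k : Fin p.d, workVec n s' (p.sup k) = s.ra 2 (n + p.sup k)) ∧
      ∀ i, (∀ k, p.sup k ≠ i) → workVec n s' i = workVec n s i := by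
  have hlt : ∀ l < p.d, s.na 4 l < n := fun l hl => by rw [hs.sup ⟨l, hl⟩]; exact (p.sup _).2
  refine (Runs.forUp (B := 5) (Inv := fun k s' => s'.ra 2
      = writes (s.na 4) (fun l => s.ra 2 (n + s.na 4 l)) k (s.ra 2)) hs.d hs.one rfl
    (fun _ _ _ h => h) rfl fun k hk s' hf hi _ hinv => ?_).mono le_rfl fun s' _ h => ?_
  · refine Runs.block ?_
    have h2 := hf.na 4 rfl
    have h0 := (hf.nv 0 rfl).trans hs.dim
    have e : writes (s.na 4) (fun l => s.ra 2 (n + s.na 4 l)) k (s.ra 2) (n + s.na 4 k)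
        = s.ra 2 (n + s.na 4 k) := writes_of_ne fun l hl => by
      have := hlt l (by omega)
      omega
    simp [Instr.exec, hinv, hi, h2, h0, writes, add_comm _ n, e]
  · constructor
    · intro k
      rw [workVec, h]
      refine writes_of_eq (fun l hl e => ?_) ⟨k, k.2, hs.sup k⟩
      rw [e]
    · intro i hi
      rw [workVec, h]
      refine writes_of_ne fun l hl e => hi ⟨l, hl⟩ ?_
      ext
      rw [← hs.sup ⟨l, hl⟩, e]

theorem runs_power (hs : Static p s) (hB : OpsRep p B s)
    (hsym : Bᵀ = B) (hz : ∀ i, (∀ k, p.sup k ≠ i) → ∀ r, B r i = 0)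
    (hx : Supported p (workVec n s)) :
    Runs ω powerCmd s (p.K * (s.nv 3 * 17 + 4 + (p.d * 7 + 2) + 2) + 2)
      fun s' => workVec n s' = B ^ p.K *ᵥ workVec n s ∧ Supported p (workVec n s') := by
  refine (Runs.forUp (B := s.nv 3 * 17 + 4 + (p.d * 7 + 2))
    (Inv := fun k s' => workVec n s' = B ^ k *ᵥ workVec n s ∧ Supported p (workVec n s'))
    hs.K hs.one rfl (fun _ _ _ h => h) ⟨by simp, hx⟩ fun k hk s' hf hi _ hinv => ?_)
  have hs' := hs.frame hf rfl
  have hB' := hB.frame hf rfl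
  rw [← hf.nv 3 rfl]
  refine Runs.seq' (runs_mul hs' hB') fun s₁ hf₁ h₁ => ?_
  refine (runs_copyBack (hs'.frame hf₁ rfl)).mono le_rfl fun s₂ hf₂ h₂ => ?_
  have key : workVec n s₂ = B *ᵥ workVec n s' := by
    funext i
    by_cases hi : ∃ k, p.sup k = i
    · obtain ⟨k, rfl⟩ := hi
      rw [h₂.1, h₁.2]
    · push Not at hi
      rw [h₂.2 i hi, h₁.1, hinv.2 i hi, mulVec_supported hz hsym _ i hi]
  refine ⟨?_, ?_⟩
  · rw [key, hinv.1, Matrix.mulVec_mulVec, pow_succ']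
  · rw [key]
    exact mulVec_supported hz hsym _

theorem sum_range_sup (hs : Static p s) (f : ℕ → ℝ) :
    ∑ l ∈ Finset.range p.d, f (s.na 4 l) = ∑ k : Fin p.d, f (p.sup k) := by
  rw [Finset.sum_range]
  exact Finset.sum_congr rfl fun k _ => by rw [hs.sup k]

theorem runs_norm (hs : Static p s) (hsup : Function.Injective p.sup)
    (hx : Supported p (workVec n s)) :
    Runs ω normCmd s (1 + (p.d * 7 + 2)) fun s' => s'.rv 7 = workVec n s ⬝ᵥ workVec n s := by
  refine Runs.seq' (R := fun s' => s' = (Instr.rConst 7 0).exec ω s) (Runs.instr rfl) ?_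
  rintro s' hf rfl
  have hs' := hs.frame hf rfl
  refine (Runs.forUp (B := 5) (Inv := fun k s' => s'.rv 7
      = ∑ l ∈ Finset.range k, s.ra 2 (s.na 4 l) * s.ra 2 (s.na 4 l))
    hs'.d hs'.one rfl (fun _ _ _ h => h) (by simp [Instr.exec])
    fun k hk s' hf hi _ hinv => ?_).mono le_rfl fun s' _ h => ?_
  · refine Runs.block ?_
    have h2 := hf.na 4 rfl
    have h3 := hf.ra 2 rfl
    simp [Instr.exec, hinv, hi, h2, h3, Finset.sum_range_succ]
  · rw [h, sum_range_sup hs fun c => s.ra 2 c * s.ra 2 c]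
    exact sum_sup_eq hsup (f := fun i => workVec n s i * workVec n s i) fun i hi => by
      rw [hx i hi, zero_mul]

/-- Position of the sample stream before the `j`-th candidate of a recomputation. -/
def samplePos (p : Params n) (cnt j : ℕ) : ℕ :=
  if cnt < n ^ 16 then cnt * (p.m * p.d) + j * p.d else min cnt (n ^ 16) * (p.m * p.d)

theorem holds_cap (hs : Static p s) {cnt : ℕ} (hc : s.rv 3 = cnt) :
    (Test.rLt 3 4).Holds s ↔ cnt < n ^ 16 := by
  rw [Test.Holds, hc, hs.cap]
  exact_mod_cast Iff.rfl

theorem runs_sample (hs : Static p s) (hsup : Function.Injective p.sup) {cnt : ℕ}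
    (hc : s.rv 3 = cnt) (hpos : s.pos = samplePos p cnt (s.nv 11))
    (hx : Supported p (workVec n s)) :
    Runs ω sampleCmd s (p.d * 8 + 2) fun s' => workVec n s' = cand p ω cnt (s.nv 11) ∧
      Supported p (workVec n s') ∧ s'.pos = samplePos p cnt (s.nv 11 + 1) := by
  set f : ℕ → ℝ := fun l => if cnt < n ^ 16 then ω (s.pos + l) else if l = s.nv 11 then 1 else 0
    with hf
  refine (Runs.forUp (B := 6) (Inv := fun k s' => s'.ra 2 = writes (s.na 4) f k (s.ra 2) ∧
      s'.pos = if cnt < n ^ 16 then s.pos + k else s.pos)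
    hs.d hs.one rfl (fun _ _ _ h => h) ⟨rfl, by simp⟩
    fun k hk s' hfr hi _ hinv => ?_).mono le_rfl fun s' hfr h => ?_
  · have hs' := hs.frame hfr rfl
    have hc' : s'.rv 3 = cnt := (hfr.rv 3 rfl).trans hc
    have h11 : s'.nv 11 = s.nv 11 := hfr.nv 11 rfl
    refine Runs.seq' (R := fun t => t.nv 6 = s.na 4 k) (B := 1) (B' := 4 + 1) (Runs.instr ?_)
      fun s₁ hf₁ h₁ => ?_
    · simp [Instr.exec, hi, hfr.na 4 rfl]
    have hs₁ := hs'.frame hf₁ rfl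
    have hc₁ : s₁.rv 3 = cnt := (hf₁.rv 3 rfl).trans hc'
    have e5 : s₁.nv 5 = k := (hf₁.nv 5 rfl).trans hi
    have e11 : s₁.nv 11 = s.nv 11 := (hf₁.nv 11 rfl).trans h11
    have ep : s₁.pos = if cnt < n ^ 16 then s.pos + k else s.pos := (hf₁.pos rfl).trans hinv.2
    refine Runs.seq' (R := fun t => t.rv 5 = f k ∧
      t.pos = if cnt < n ^ 16 then s.pos + (k + 1) else s.pos) (B := 3 + 1) ?_ fun s₂ hf₂ h₂ => ?_
    · refine Runs.ite (fun hb => ?_) fun hb => ?_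
      · rw [holds_cap hs₁ hc₁] at hb
        refine Runs.mono (B := 1) (Runs.instr ?_) (by omega) fun _ _ h => h
        rw [if_pos hb] at ep
        constructor
        · simp [Instr.exec, hf, hb, ep]
        · simp [Instr.exec, hb, ep, add_assoc]
      · rw [holds_cap hs₁ hc₁] at hb
        rw [if_neg hb] at ep
        refine Runs.ite (B := 2) (fun hb1 => Runs.ite (B := 1) (fun hb2 => Runs.instr ?_)
          fun hb2 => Runs.instr ?_)
          fun hb1 => (Runs.mono (B := 1) (Runs.instr ?_) (by omega) fun _ _ h => h)
        all_goals simp only [Test.Holds, e5, e11] at hb1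
        · simp only [Test.Holds, e5, e11] at hb2
          have : k = s.nv 11 := by omega
          simp [Instr.exec, hf, hb, this, ep]
        · simp only [Test.Holds, e5, e11] at hb2
          have : ¬ k = s.nv 11 := by omega
          simp [Instr.exec, hf, hb, this, ep]
        · have : ¬ k = s.nv 11 := by omega
          simp [Instr.exec, hf, hb, this, ep]
    · refine Runs.instr ⟨?_, h₂.2⟩
      have e6 : s₂.nv 6 = s.na 4 k := (hf₂.nv 6 rfl).trans h₁
      have er : s₂.ra 2 = writes (s.na 4) f k (s.ra 2) :=
        ((hf₂.ra 2 rfl).trans (hf₁.ra 2 rfl)).trans hinv.1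
      simp [Instr.exec, er, e6, h₂.1, writes]
  · obtain ⟨h1, h2⟩ := h
    have hval : ∀ k : Fin p.d, workVec n s' (p.sup k) = f k := by
      intro k
      rw [workVec, h1]
      refine writes_of_eq (fun l hl e => ?_) ⟨k, k.2, hs.sup k⟩
      rw [hs.sup ⟨l, hl⟩] at e
      have := hsup (Fin.ext e)
      rw [← this]
    have hz : ∀ i, (∀ k, p.sup k ≠ i) → workVec n s' i = 0 := by
      intro i hi
      rw [← hx i hi, workVec, h1]
      refine writes_of_ne fun l hl e => hi ⟨l, hl⟩ ?_
      ext
      rw [← hs.sup ⟨l, hl⟩, e]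
    refine ⟨?_, hz, ?_⟩
    · funext i
      by_cases hi : ∃ k, p.sup k = i
      · obtain ⟨k, rfl⟩ := hi
        rw [hval, cand]
        split_ifs with hcap
        · rw [gaussVec, Finset.sum_eq_single k]
          · simp only [hf, if_pos hcap, hpos, samplePos, if_true]
          · intro l _ hl
            rw [if_neg fun e => hl (hsup e)]
          · intro h
            exact absurd (Finset.mem_univ k) h
        · simp only [hf, if_neg hcap]
          congr 1
          refine propext ⟨fun e => ⟨e ▸ k.2, ?_⟩, ?_⟩
          · congr 1
            ext
            exact e.symm
          · rintro ⟨h, e⟩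
            exact (congrArg Fin.val (hsup e)).symm
      · push Not at hi
        rw [hz i hi, cand]
        split_ifs with hcap
        · rw [gaussVec]
          exact (Finset.sum_eq_zero fun k _ => if_neg (hi k)).symm
        · refine (if_neg ?_).symm
          rintro ⟨h, e⟩
          exact hi _ e
    · rw [h2, hpos, samplePos, samplePos]
      split_ifs
      · ring
      · rfl

theorem runs_keep (hs : Static p s) : Runs ω keepCmd s (1 + (p.d * 6 + 2) + 1) fun s' =>
    (s.rv 8 < s.rv 7 → s'.rv 8 = s.rv 7 ∧ ∀ k : Fin p.d, s'.ra 4 (p.sup k) = s.ra 2 (p.sup k)) ∧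
    (¬ s.rv 8 < s.rv 7 → s'.rv 8 = s.rv 8 ∧ s'.ra 4 = s.ra 4) := by
  refine Runs.ite (fun hb => ?_) fun hb => ?_
  · refine Runs.seq' (R := fun t => t.rv 8 = s.rv 7) (Runs.instr ?_) fun s₁ hf₁ h₁ => ?_
    · simp [Instr.exec, hs.zero]
    have hs₁ := hs.frame hf₁ rfl
    refine (Runs.forUp (B := 4) (Inv := fun k s' => s'.rv 8 = s.rv 7 ∧
        s'.ra 4 = writes (s.na 4) (fun l => s.ra 2 (s.na 4 l)) k (s.ra 4))
      hs₁.d hs₁.one rfl (fun _ _ _ h => h) ⟨h₁, hf₁.ra 4 rfl⟩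
      fun k hk s' hfr hi _ hinv => ?_).mono le_rfl fun s' hfr h => ?_
    · refine Runs.block ?_
      have e4 := (hfr.na 4 rfl).trans (hf₁.na 4 rfl)
      have e2 := (hfr.ra 2 rfl).trans (hf₁.ra 2 rfl)
      simp [Instr.exec, hi, e4, e2, hinv.1, hinv.2, writes]
    · refine ⟨fun _ => ⟨h.1, fun k => ?_⟩, fun h => absurd hb h⟩
      rw [h.2]
      exact writes_of_eq (fun l hl e => by rw [e]) ⟨k, k.2, hs.sup k⟩
  · exact (Runs.skip (Q := fun s' => s' = s) rfl).mono (by omega) fun s' _ h => by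
      subst h
      exact ⟨fun h => absurd h hb, fun _ => ⟨rfl, rfl⟩⟩

/-- Steps for one candidate. -/
def candTime (d K len : ℕ) : ℕ :=
  (d * 8 + 2) + ((K * (len * 17 + 4 + (d * 7 + 2) + 2) + 2) + ((1 + (d * 7 + 2))
    + (1 + (d * 6 + 2) + 1)))

theorem runs_candidates (hs : Static p s) (hB : OpsRep p B s) (hsup : Function.Injective p.sup)
    (hsym : Bᵀ = B) (hz : ∀ i, (∀ k, p.sup k ≠ i) → ∀ r, B r i = 0) {cnt : ℕ}
    (hc : s.rv 3 = cnt) (hpos : s.pos = samplePos p cnt 0) (hx : Supported p (workVec n s))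
    (hM : s.nv 14 = numCand p cnt) (hb : s.rv 8 = 0) :
    Runs ω candidatesCmd s (numCand p cnt * (candTime p.d p.K (s.nv 3) + 2) + 2) fun s' =>
      s'.rv 8 = (best (fun j => B ^ p.K *ᵥ cand p ω cnt j) (numCand p cnt)).1 ∧
      (0 < (best (fun j => B ^ p.K *ᵥ cand p ω cnt j) (numCand p cnt)).1 → ∀ k : Fin p.d,
        s'.ra 4 (p.sup k)
          = (best (fun j => B ^ p.K *ᵥ cand p ω cnt j) (numCand p cnt)).2 (p.sup k)) ∧
      Supported p (workVec n s') ∧ s'.pos = samplePos p cnt (numCand p cnt) := by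
  set y : ℕ → Fin n → ℝ := fun j => B ^ p.K *ᵥ cand p ω cnt j with hy
  refine Runs.forUp (Inv := fun j s' => s'.rv 8 = (best y j).1 ∧
      (0 < (best y j).1 → ∀ k : Fin p.d, s'.ra 4 (p.sup k) = (best y j).2 (p.sup k)) ∧
      Supported p (workVec n s') ∧ s'.pos = samplePos p cnt j)
    hM hs.one rfl (fun _ _ _ h => h) ⟨by simp [best, hb], by simp [best], hx, hpos⟩
    fun j hj s' hf hi _ hinv => ?_
  obtain ⟨i1, i2, i3, i4⟩ := hinv
  have hs' := hs.frame hf rfl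
  have hB' := hB.frame hf rfl
  have hc' : s'.rv 3 = cnt := (hf.rv 3 rfl).trans hc
  refine Runs.seq' (runs_sample hs' hsup hc' (hi ▸ i4) i3) fun s₁ hf₁ h₁ => ?_
  rw [hi] at h₁
  obtain ⟨a1, a2, a3⟩ := h₁
  have hs₁ := hs'.frame hf₁ rfl
  have hB₁ := hB'.frame hf₁ rfl
  rw [← (hf₁.nv 3 rfl).trans (hf.nv 3 rfl)]
  refine Runs.seq' (runs_power hs₁ hB₁ hsym hz a2) fun s₂ hf₂ h₂ => ?_
  obtain ⟨b1, b2⟩ := h₂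
  have hs₂ := hs₁.frame hf₂ rfl
  refine Runs.seq' (runs_norm hs₂ hsup b2) fun s₃ hf₃ h₃ => ?_
  have hs₃ := hs₂.frame hf₃ rfl
  have hyj : workVec n s₂ = y j := by rw [b1, a1]
  refine (runs_keep hs₃).mono le_rfl fun s₄ hf₄ h₄ => ?_
  have e8 : s₃.rv 8 = (best y j).1 :=
    ((hf₃.rv 8 rfl).trans ((hf₂.rv 8 rfl).trans (hf₁.rv 8 rfl))).trans i1
  have e4 : s₃.ra 4 = s'.ra 4 := (hf₃.ra 4 rfl).trans ((hf₂.ra 4 rfl).trans (hf₁.ra 4 rfl))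
  have e2 : s₃.ra 2 = s₂.ra 2 := hf₃.ra 2 rfl
  rw [e8, h₃, hyj, e4, e2] at h₄
  have hw : workVec n s₄ = workVec n s₂ := by
    funext i
    rw [workVec, workVec, (hf₄.ra 2 rfl).trans e2]
  refine ⟨?_, ?_, hw ▸ b2, ?_⟩
  · rw [best]
    by_cases h : (best y j).1 < y j ⬝ᵥ y j
    · rw [if_pos h, (h₄.1 h).1]
    · rw [if_neg h, (h₄.2 h).1]
  · rw [best]
    by_cases h : (best y j).1 < y j ⬝ᵥ y j
    · rw [if_pos h]
      intro _ k
      rw [(h₄.1 h).2 k, ← hyj]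
      rfl
    · rw [if_neg h, (h₄.2 h).2]
      exact i2
  · rw [(hf₄.pos rfl).trans ((hf₃.pos rfl).trans (hf₂.pos rfl)), a3]

/-- Outside of the support, only the cell `0` of the output vector is ever nonzero. -/
def OutSupported (p : Params n) (w : Fin n → ℝ) : Prop :=
  ∀ i : Fin n, (i : ℕ) ≠ 0 → (∀ k, p.sup k ≠ i) → w i = 0

theorem runs_output (hs : Static p s) {y : ℕ → Fin n → ℝ} {M : ℕ}
    (hy : ∀ j, Supported p (y j)) (h8 : s.rv 8 = (best y M).1)
    (hb : 0 < (best y M).1 → ∀ k : Fin p.d, s.ra 4 (p.sup k) = (best y M).2 (p.sup k))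
    (hw : OutSupported p (outVec n s)) :
    Runs ω outputCmd s (4 + (p.d * 7 + 2) + 1) fun s' => outVec n s' = pick y M (outVec n s) ∧
      OutSupported p (outVec n s') := by
  refine Runs.ite (fun h => ?_) fun h => ?_
  · rw [Test.Holds, hs.zero, h8] at h
    refine Runs.seq' (R := fun t => t.rv 6 = √(best y M).1 ∧
      t.ra 1 = Function.update (s.ra 1) 0 0) (Runs.block ?_) fun s₁ hf₁ h₁ => ?_
    · simp [Instr.exec, h8, hs.zero]
    have hs₁ := hs.frame hf₁ rfl
    refine (Runs.forUp (B := 5) (Inv := fun k s' => s'.ra 1 = writes (s.na 4)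
        (fun l => s.ra 4 (s.na 4 l) / √(best y M).1) k (Function.update (s.ra 1) 0 0))
      hs₁.d hs₁.one rfl (fun _ _ _ h => h) h₁.2
      fun k hk s' hfr hi _ hinv => ?_).mono le_rfl fun s' hfr h' => ?_
    · refine Runs.block ?_
      have e4 := (hfr.na 4 rfl).trans (hf₁.na 4 rfl)
      have e2 := (hfr.ra 4 rfl).trans (hf₁.ra 4 rfl)
      have e6 := (hfr.rv 6 rfl).trans h₁.1
      simp [Instr.exec, hi, e4, e2, e6, hinv, writes]
    · have hsupp : Supported p (best y M).2 := by
        obtain ⟨j, -, e⟩ := (best_spec y M).2.2 h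
        rw [e]
        exact hy j
      have hout : ∀ i, (∀ k, p.sup k ≠ i) → outVec n s' i = 0 := by
        intro i hi
        rw [outVec, h', writes_of_ne]
        · by_cases h0 : (i : ℕ) = 0
          · rw [h0, Function.update_self]
          · rw [Function.update_of_ne h0]
            exact hw i h0 hi
        · intro l hl e
          refine hi ⟨l, hl⟩ ?_
          ext
          rw [← hs.sup ⟨l, hl⟩, e]
      refine ⟨?_, fun i _ hi => hout i hi⟩
      funext i
      rw [pick, if_pos h]
      by_cases hi : ∃ k, p.sup k = i
      · obtain ⟨k, rfl⟩ := hi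
        rw [← hb h k, outVec, h']
        exact writes_of_eq (fun l hl e => by rw [e]) ⟨k, k.2, hs.sup k⟩
      · push Not at hi
        rw [hout i hi, hsupp i hi, zero_div]
  · rw [Test.Holds, hs.zero, h8] at h
    exact (Runs.skip (Q := fun s' => s' = s) rfl).mono (by omega) fun s' _ h' => by
      subst h'
      rw [pick, if_neg h]
      exact ⟨rfl, hw⟩

theorem mulVec_congr_supported (hz : ∀ i, (∀ k, p.sup k ≠ i) → ∀ r, B r i = 0) {x x' : Fin n → ℝ}
    (h : ∀ k, x (p.sup k) = x' (p.sup k)) : B *ᵥ x = B *ᵥ x' := by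
  funext r
  simp only [Matrix.mulVec, dotProduct]
  refine Finset.sum_congr rfl fun i _ => ?_
  by_cases hi : ∃ k, p.sup k = i
  · obtain ⟨k, rfl⟩ := hi
    rw [h k]
  · push Not at hi
    rw [hz i hi, zero_mul, zero_mul]

theorem runs_quad (hs : Static p s) (hB : OpsRep p B s) (hsup : Function.Injective p.sup)
    (hsym : Bᵀ = B) (hz : ∀ i, (∀ k, p.sup k ≠ i) → ∀ r, B r i = 0)
    (hx : Supported p (workVec n s)) :
    Runs ω quadCmd s ((p.d * 6 + 2) + ((s.nv 3 * 17 + 4) + (1 + (p.d * 9 + 2)))) fun s' =>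
      s'.rv 1 = outVec n s ⬝ᵥ (B *ᵥ outVec n s) ∧ Supported p (workVec n s') := by
  refine Runs.seq' (R := fun t => (∀ k, workVec n t (p.sup k) = outVec n s (p.sup k)) ∧
    Supported p (workVec n t)) ((Runs.forUp (B := 4) (Inv := fun k s' => s'.ra 2
      = writes (s.na 4) (fun l => s.ra 1 (s.na 4 l)) k (s.ra 2))
      hs.d hs.one rfl (fun _ _ _ h => h) rfl
      fun k hk s' hfr hi _ hinv => ?_).mono le_rfl fun s' hfr h => ?_) fun s₁ hf₁ h₁ => ?_
  · refine Runs.block ?_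
    have e4 := hfr.na 4 rfl
    have e1 := hfr.ra 1 rfl
    simp [Instr.exec, hi, e4, e1, hinv, writes]
  · refine ⟨fun k => ?_, fun i hi => ?_⟩
    · rw [workVec, h]
      exact writes_of_eq (fun l hl e => by rw [e, outVec]) ⟨k, k.2, hs.sup k⟩
    · rw [← hx i hi, workVec, h]
      refine writes_of_ne fun l hl e => hi ⟨l, hl⟩ ?_
      ext
      rw [← hs.sup ⟨l, hl⟩, e]
  have hs₁ := hs.frame hf₁ rfl
  have hB₁ := hB.frame hf₁ rfl
  rw [← hf₁.nv 3 rfl]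
  refine Runs.seq' (runs_mul hs₁ hB₁) fun s₂ hf₂ h₂ => ?_
  have hs₂ := hs₁.frame hf₂ rfl
  refine Runs.seq' (R := fun t => t = (Instr.rConst 1 0).exec ω s₂) (Runs.instr rfl) ?_
  rintro s₃ hf₃ rfl
  have hs₃ := hs₂.frame hf₃ rfl
  refine (Runs.forUp (B := 7) (Inv := fun k s' => s'.rv 1
      = ∑ l ∈ Finset.range k, s₂.ra 2 (s₂.na 4 l) * s₂.ra 2 (n + s₂.na 4 l))
    hs₃.d hs₃.one rfl (fun _ _ _ h => h) (by simp [Instr.exec])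
    fun k hk s' hf hi _ hinv => ?_).mono le_rfl fun s' hf h => ?_
  · refine Runs.block ?_
    have e4 := hf.na 4 rfl
    have e2 := hf.ra 2 rfl
    have e0 := (hs₃.frame hf rfl).dim
    simp only [Instr.exec, State.setR_na, State.setR_ra] at e4 e2
    simp [Instr.exec, hinv, hi, e4, e2, e0, Finset.sum_range_succ, add_comm _ n]
  · refine ⟨?_, ?_⟩
    · rw [h, sum_range_sup hs₂ fun c => s₂.ra 2 c * s₂.ra 2 (n + c)]
      have e : ∀ k : Fin p.d, s₂.ra 2 (p.sup k) * s₂.ra 2 (n + p.sup k)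
          = outVec n s (p.sup k) * (B *ᵥ outVec n s) (p.sup k) := by
        intro k
        rw [h₂.2, mulVec_congr_supported hz h₁.1]
        congr 1
        rw [← h₁.1 k, ← h₂.1]
        rfl
      simp only [e]
      exact sum_sup_eq hsup (f := fun i => outVec n s i * (B *ᵥ outVec n s) i) fun i hi => by
        rw [mulVec_supported hz hsym _ i hi, mul_zero]
    · have e : workVec n s' = workVec n s₁ := by
        rw [← h₂.1]
        funext i
        rw [workVec, hf.ra 2 rfl]
        rfl
      rw [e]
      exact h₁.2

theorem runs_threshold (hs : Static p s) {cnt : ℕ} (hc : s.rv 3 = cnt) :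
    Runs ω thresholdCmd s (6 + (1 + 1)) fun s' => s'.rv 2 = s.rv 1 * (1 - p.ε / 4) ∧
      s'.rv 3 = ((if cnt < n ^ 16 then cnt + 1 else cnt : ℕ) : ℝ) := by
  refine Runs.seq' (R := fun t => t.rv 2 = s.rv 1 * (1 - p.ε / 4) ∧ t.rv 6 = 1) (Runs.block ?_)
    fun s₁ hf₁ h₁ => ?_
  · simp [Instr.exec, hs.eps]
    left
    ring
  have hs₁ := hs.frame hf₁ rfl
  have hc₁ : s₁.rv 3 = cnt := (hf₁.rv 3 rfl).trans hc
  refine Runs.ite (fun h => Runs.instr ?_) fun h => Runs.skip ?_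
  · rw [holds_cap hs₁ hc₁] at h
    rw [if_pos h]
    simp [Instr.exec, hc₁, h₁.1, h₁.2]
  · rw [holds_cap hs₁ hc₁] at h
    rw [if_neg h]
    exact ⟨h₁.1, hc₁⟩

/-- The memory holds the state `st` of the dynamic power method for the matrix `B`. -/
structure Holds (p : Params n) (B : Matrix (Fin n) (Fin n) ℝ) (st : AState n) (s : State) :
    Prop where
  static : Static p s
  ops : OpsRep p B s
  work : Supported p (workVec n s)
  cnt : s.rv 3 = st.cnt
  cnt_le : st.cnt ≤ n ^ 16
  pos : s.pos = samplePos p st.cnt 0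
  vec : outVec n s = st.w
  supp : OutSupported p (outVec n s)
  thr : s.rv 2 = st.thr

/-- Steps for a recomputation. -/
def recompTime (d K M len : ℕ) : ℕ :=
  4 + (1 + ((M * (candTime d K len + 2) + 2) + ((4 + (d * 7 + 2) + 1)
    + (((d * 6 + 2) + ((len * 17 + 4) + (1 + (d * 9 + 2)))) + (6 + (1 + 1))))))

theorem runs_recomp (hsup : Function.Injective p.sup) (hK : 0 < p.K)
    (hsym : Bᵀ = B) (hz : ∀ i, (∀ k, p.sup k ≠ i) → ∀ r, B r i = 0) {st : AState n}
    (h : Holds p B st s) :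
    Runs ω recompCmd s (recompTime p.d p.K (numCand p st.cnt) (s.nv 3)) fun s' =>
      Holds p B (recomp p ω B st) s' ∧
        s'.rv 1 = (recomp p ω B st).w ⬝ᵥ (B *ᵥ (recomp p ω B st).w) := by
  have hs := h.static
  refine Runs.seq' (R := fun t => t.nv 14 = numCand p st.cnt) (B := 3 + 1)
    (Runs.ite (fun hb => Runs.block ?_) fun hb => Runs.block ?_) fun s₁ hf₁ h₁ => ?_
  · rw [holds_cap hs h.cnt] at hb
    simp [Instr.exec, hs.m, numCand, hb]
  · rw [holds_cap hs h.cnt] at hb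
    simp [Instr.exec, hs.d, numCand, hb]
  have hs₁ := hs.frame hf₁ rfl
  refine Runs.seq' (R := fun t => t.rv 8 = 0) (Runs.instr (by simp [Instr.exec]))
    fun s₂ hf₂ h₂ => ?_
  have hs₂ := hs₁.frame hf₂ rfl
  have w₂ : workVec n s₂ = workVec n s := by
    funext i
    rw [workVec, hf₂.ra 2 rfl, hf₁.ra 2 rfl]
    rfl
  have l₂ : s₂.nv 3 = s.nv 3 := (hf₂.nv 3 rfl).trans (hf₁.nv 3 rfl)
  rw [← l₂]
  have hB₂ := (h.ops.frame hf₁ rfl).frame hf₂ rfl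
  refine Runs.seq' (runs_candidates hs₂ hB₂ hsup hsym hz
    (((hf₂.rv 3 rfl).trans (hf₁.rv 3 rfl)).trans h.cnt)
    (((hf₂.pos rfl).trans (hf₁.pos rfl)).trans h.pos) (w₂ ▸ h.work)
    ((hf₂.nv 14 rfl).trans h₁) h₂) fun s₃ hf₃ h₃ => ?_
  have hs₃ := hs₂.frame hf₃ rfl
  have hB₃ := hB₂.frame hf₃ rfl
  obtain ⟨c1, c2, c3, c4⟩ := h₃
  have o₃ : outVec n s₃ = outVec n s := by
    funext i
    rw [outVec, hf₃.ra 1 rfl, hf₂.ra 1 rfl, hf₁.ra 1 rfl]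
    rfl
  have l₃ : s₃.nv 3 = s₂.nv 3 := hf₃.nv 3 rfl
  refine Runs.seq' (runs_output hs₃ (fun j => ?_) c1 c2 (o₃ ▸ h.supp)) fun s₄ hf₄ h₄ => ?_
  · obtain ⟨k, hk⟩ := Nat.exists_eq_succ_of_ne_zero hK.ne'
    rw [hk, Nat.succ_eq_add_one, pow_succ', ← Matrix.mulVec_mulVec]
    exact mulVec_supported hz hsym _
  have hs₄ := hs₃.frame hf₄ rfl
  have hB₄ := hB₃.frame hf₄ rfl
  rw [o₃, h.vec] at h₄
  have w₄ : workVec n s₄ = workVec n s₃ := by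
    funext i
    rw [workVec, hf₄.ra 2 rfl]
    rfl
  rw [← l₃, ← hf₄.nv 3 rfl]
  refine Runs.seq' (runs_quad hs₄ hB₄ hsup hsym hz (w₄ ▸ c3)) fun s₅ hf₅ h₅ => ?_
  have hs₅ := hs₄.frame hf₅ rfl
  have hB₅ := hB₄.frame hf₅ rfl
  rw [h₄.1] at h₅
  refine (runs_threshold (cnt := st.cnt) hs₅ ?_).mono le_rfl fun s₆ hf₆ h₆ => ?_
  · rw [hf₅.rv 3 rfl, hf₄.rv 3 rfl, hf₃.rv 3 rfl, hf₂.rv 3 rfl, hf₁.rv 3 rfl, h.cnt]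
  have o₆ : outVec n s₆ = outVec n s₄ := by
    funext i
    rw [outVec, hf₆.ra 1 rfl, hf₅.ra 1 rfl]
    rfl
  have w₆ : workVec n s₆ = workVec n s₅ := by
    funext i
    rw [workVec, hf₆.ra 2 rfl]
    rfl
  refine ⟨⟨hs₅.frame hf₆ rfl, hB₅.frame hf₆ rfl, w₆ ▸ h₅.2, h₆.2, ?_, ?_, ?_, ?_, ?_⟩, ?_⟩
  · have := h.cnt_le
    simp only [recomp]
    split_ifs <;> omega
  · rw [hf₆.pos rfl, hf₅.pos rfl, hf₄.pos rfl, c4]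
    simp only [recomp, samplePos, numCand]
    split_ifs with e1 e2
    · ring
    · have : st.cnt + 1 = n ^ 16 := by omega
      rw [this, min_self, ← this]
      ring
    · rfl
  · rw [o₆, h₄.1]
    rfl
  · rw [o₆]
    exact h₄.2
  · rw [h₆.1, h₅.1]
    rfl
  · rw [hf₆.rv 1 rfl, h₅.1]
    rfl

end Subroutines

/-! ### Operation lists for rank-one updates and for dense matrices -/

section RepLemmas

variable {p : Params n} {B : Matrix (Fin n) (Fin n) ℝ}

/-- Appending the operations for `z += v ⬝ᵥ x` and `y -= z v`, with a fresh cell `z`, updates the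
represented matrix by `- v vᵀ`. -/
theorem Rep.append {len c zc : ℕ} {dst src dst' src' : ℕ → ℕ} {val val' : ℕ → ℝ}
    (h : Rep p B len dst src val zc) {v : Fin n → ℝ} {e : Fin c → Fin n}
    (he : Function.Injective e) (hv : ∀ i, (∀ k, e k ≠ i) → v i = 0)
    (h0 : ∀ q < len, dst' q = dst q ∧ src' q = src q ∧ val' q = val q)
    (h1 : ∀ k : Fin c, dst' (len + k) = zc ∧ src' (len + k) = e k ∧ val' (len + k) = v (e k))
    (h2 : ∀ k : Fin c, dst' (len + c + k) = n + e k ∧ src' (len + c + k) = zc ∧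
      val' (len + c + k) = -v (e k)) :
    Rep p (B - Matrix.vecMulVec v v) (len + c + c) dst' src' val' (zc + 1) := by
  have hzc := h.zc_ge
  have hcases : ∀ q < len + c + c, q < len ∨ (∃ k : Fin c, q = len + k) ∨
      ∃ k : Fin c, q = len + c + k := by
    intro q hq
    rcases lt_or_ge q len with hl | hl
    · exact Or.inl hl
    rcases lt_or_ge q (len + c) with hl' | hl'
    · exact Or.inr (Or.inl ⟨⟨q - len, by omega⟩, by simp only; omega⟩)
    · exact Or.inr (Or.inr ⟨⟨q - (len + c), by omega⟩, by simp only; omega⟩)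
  have hbnd : ∀ q < len + c + c, n ≤ dst' q ∧ dst' q < zc + 1 ∧ src' q < zc + 1 := by
    intro q hq
    rcases hcases q hq with hl | ⟨k, rfl⟩ | ⟨k, rfl⟩
    · obtain ⟨a1, a2, -⟩ := h0 q hl
      have := h.bnd q hl
      omega
    · obtain ⟨a1, a2, -⟩ := h1 k
      have := (e k).2
      omega
    · obtain ⟨a1, a2, -⟩ := h2 k
      have := (e k).2
      omega
  refine ⟨by omega, hbnd, fun X k => ?_⟩
  set X0 := writes dst' (fun _ => (0 : ℝ)) (len + c + c) X with hX0
  have hX0x : ∀ j : Fin n, X0 j = X j := fun j =>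
    writes_of_ne fun l hl => by
      have := (hbnd l hl).1
      omega
  have hX0z : ∀ q < len + c + c, X0 (dst' q) = 0 := fun q hq =>
    writes_of_eq (fun _ _ _ => rfl) ⟨q, hq, rfl⟩
  have hclear : writes dst (fun _ => (0 : ℝ)) len X0 = X0 := by
    funext a
    by_cases ha : ∃ q < len, dst q = a
    · obtain ⟨q, hq, rfl⟩ := ha
      rw [← (h0 q hq).1, hX0z q (by omega), (h0 q hq).1]
      exact writes_of_eq (fun _ _ _ => rfl) ⟨q, hq, rfl⟩
    · push Not at ha
      exact writes_of_ne ha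
  set Y := opsRun dst src val 0 len X0 with hY
  have hY' : opsRun dst' src' val' 0 len X0 = Y :=
    opsRun_congr fun q hq => h0 q (by omega)
  have hYx : ∀ j : Fin n, Y j = X j := fun j => by
    rw [hY, opsRun_of_ne, hX0x]
    intro q hq
    have := (h.bnd q (by omega)).1
    omega
  have hYy : Y (n + p.sup k) = ∑ j : Fin n, B (p.sup k) j * X j := by
    have := h.sem X0 k
    rw [hclear] at this
    rw [hY, this]
    exact Finset.sum_congr rfl fun j _ => by rw [hX0x]
  have hYz : 0 < c → Y zc = 0 := by
    intro hc
    rw [hY, opsRun_of_ne, ← (h1 ⟨0, hc⟩).1]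
    · exact hX0z _ (by simp only; omega)
    · intro q hq
      have := (h.bnd q (by omega)).2.1
      omega
  set Z := opsRun dst' src' val' len c Y with hZ
  have hbatch1 : ∀ a, Z a = Y a + ∑ q ∈ Finset.range c,
      if dst' (len + q) = a then val' (len + q) * Y (src' (len + q)) else 0 := by
    refine opsRun_batch fun q hq q' hq' => ?_
    have a1 := (h1 ⟨q, hq⟩).2.1
    have a2 := (h1 ⟨q', hq'⟩).1
    have := (e ⟨q, hq⟩).2
    simp only at a1 a2
    omega
  have hZz : 0 < c → Z zc = v ⬝ᵥ fun j => X j := by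
    intro hc
    rw [hbatch1, hYz hc, zero_add, Finset.sum_range, dotProduct,
      ← sum_sup_eq he (f := fun j => v j * X j) fun i hi => by rw [hv i hi, zero_mul]]
    refine Finset.sum_congr rfl fun q _ => ?_
    obtain ⟨a1, a2, a3⟩ := h1 q
    rw [if_pos a1, a2, a3, hYx]
  have hZy : ∀ i : Fin n, Z (n + i) = Y (n + i) := by
    intro i
    rw [hbatch1, Finset.sum_eq_zero, add_zero]
    intro q hq
    have a1 := (h1 ⟨q, Finset.mem_range.1 hq⟩).1
    have := i.2
    rw [if_neg]
    simp only at a1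
    omega
  have hbatch2 : ∀ a, opsRun dst' src' val' (len + c) c Z a = Z a + ∑ q ∈ Finset.range c,
      if dst' (len + c + q) = a then val' (len + c + q) * Z (src' (len + c + q)) else 0 := by
    refine opsRun_batch fun q hq q' hq' => ?_
    have a1 := (h2 ⟨q, hq⟩).2.1
    have a2 := (h2 ⟨q', hq'⟩).1
    have := (e ⟨q', hq'⟩).2
    simp only at a1 a2
    omega
  rw [add_assoc, opsRun_add, zero_add, opsRun_add, hY', ← hZ, hbatch2, hZy, hYy,
    Finset.sum_range]
  have e3 : ∀ q : Fin c, (if dst' (len + c + q) = n + p.sup k then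
      val' (len + c + q) * Z (src' (len + c + q)) else 0)
      = (fun i => if i = p.sup k then -v i * (v ⬝ᵥ fun j => X j) else 0) (e q) := by
    intro q
    obtain ⟨a1, a2, a3⟩ := h2 q
    rw [a1, a2, a3, hZz (lt_of_le_of_lt (Nat.zero_le _) q.2)]
    simp only [Nat.add_left_cancel_iff, Fin.val_inj]
  have e4 : ∑ q : Fin c, (if dst' (len + c + q) = n + p.sup k then
      val' (len + c + q) * Z (src' (len + c + q)) else 0)
      = -v (p.sup k) * (v ⬝ᵥ fun j => X j) := by
    rw [Finset.sum_congr rfl fun q _ => e3 q, sum_sup_eq he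
      (f := fun i => if i = p.sup k then -v i * (v ⬝ᵥ fun j => X j) else 0) fun i hi => by
        rw [hv i hi]
        simp]
    simp
  rw [e4]
  simp only [Matrix.sub_apply, Matrix.vecMulVec_apply, sub_mul, Finset.sum_sub_distrib, dotProduct,
    mul_assoc, ← Finset.mul_sum]
  ring

/-- The dense list of all entries on the support. -/
theorem Rep.dense {zc : ℕ} (hzc : n + n ≤ zc) (hsup : Function.Injective p.sup)
    (hz : ∀ i, (∀ k, p.sup k ≠ i) → ∀ r, B r i = 0) {dst src : ℕ → ℕ} {val : ℕ → ℝ}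
    (h : ∀ j l : Fin p.d, dst (j * p.d + l) = n + p.sup l ∧ src (j * p.d + l) = p.sup j ∧
      val (j * p.d + l) = B (p.sup l) (p.sup j)) :
    Rep p B (p.d * p.d) dst src val zc := by
  have hq : ∀ q < p.d * p.d, ∃ j l : Fin p.d, q = j * p.d + l := by
    intro q hq
    have hd : 0 < p.d := Nat.pos_of_ne_zero fun h0 => by simp [h0] at hq
    refine ⟨⟨q / p.d, Nat.div_lt_of_lt_mul hq⟩, ⟨q % p.d, Nat.mod_lt _ hd⟩, ?_⟩
    simp only
    rw [mul_comm]
    exact (Nat.div_add_mod q p.d).symm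
  have hlt : ∀ j l : Fin p.d, j * p.d + l < p.d * p.d := by
    intro j l
    have : ((j : ℕ) + 1) * p.d ≤ p.d * p.d := Nat.mul_le_mul_right _ j.2
    have := l.2
    rw [add_mul, one_mul] at *
    omega
  have hbnd : ∀ q < p.d * p.d, n ≤ dst q ∧ dst q < zc ∧ src q < zc := by
    intro q hq'
    obtain ⟨j, l, rfl⟩ := hq q hq'
    obtain ⟨a1, a2, -⟩ := h j l
    have := (p.sup j).2
    have := (p.sup l).2
    omega
  refine ⟨hzc, hbnd, fun X k => ?_⟩
  rw [opsRun_batch]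
  · have hx : ∀ j : Fin n, writes dst (fun _ => (0 : ℝ)) (p.d * p.d) X j = X j := fun j =>
      writes_of_ne fun l hl => by
        have := (hbnd l hl).1
        omega
    rw [writes_of_eq (r := 0) (fun _ _ _ => rfl) ⟨_, hlt k k, (h k k).1⟩, zero_add,
      Finset.sum_range, ← finProdFinEquiv.sum_comp, Fintype.sum_prod_type,
      ← sum_sup_eq hsup (f := fun j => B (p.sup k) j * X j) fun i hi => by rw [hz i hi, zero_mul]]
    refine Finset.sum_congr rfl fun j _ => ?_
    rw [Finset.sum_eq_single k]
    · have e1 : 0 + ((finProdFinEquiv (j, k) : Fin (p.d * p.d)) : ℕ) = j * p.d + k := by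
        simp only [finProdFinEquiv_apply_val, zero_add]
        ring
      rw [e1]
      obtain ⟨a1, a2, a3⟩ := h j k
      rw [if_pos a1, a2, a3, hx]
    · intro l _ hl
      have e1 : 0 + ((finProdFinEquiv (j, l) : Fin (p.d * p.d)) : ℕ) = j * p.d + l := by
        simp only [finProdFinEquiv_apply_val, zero_add]
        ring
      rw [e1, if_neg]
      rw [(h j l).1]
      intro e
      exact hl (hsup (Fin.ext (Nat.add_left_cancel e)))
    · intro hk
      exact absurd (Finset.mem_univ k) hk
  · intro q hq1 q' hq2
    obtain ⟨j, l, rfl⟩ := hq q hq1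
    have := (hbnd q' hq2).1
    obtain ⟨-, a2, -⟩ := h j l
    have := (p.sup j).2
    rw [zero_add, zero_add]
    omega

end RepLemmas

/-! ### Processing an update -/

open Instr Cmd Test in
/-- Subtracts `(v ⬝ᵥ w) ^ 2` from the value of the quadratic form. -/
def dotCmd : Cmd := seq (instr (rConst 7 0))
  (seq (forUp 5 1 (block [nRead 6 0 5, rRead 5 0 5, rRead 6 1 6, rMul 6 6 5, rAdd 7 7 6]))
    (block [rMul 7 7 7, rSub 1 1 7]))

open Instr Cmd Test in
/-- Appends the operations for the update vector. -/
def pushCmd : Cmd := seq (forUp 5 1 (block [nRead 6 0 5, rRead 5 0 5, nWrite 2 3 13, nWrite 3 3 6,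
    rWrite 3 3 5, nAdd 3 3 2]))
  (seq (forUp 5 1 (block [nRead 6 0 5, nAdd 6 6 0, rRead 5 0 5, rSub 5 9 5, nWrite 2 3 6,
    nWrite 3 3 13, rWrite 3 3 5, nAdd 3 3 2])) (instr (nAdd 13 13 2)))

open Instr Cmd Test in
/-- Appends one column of the represented matrix to the second list. -/
def columnCmd : Cmd := seq (instr (nRead 8 4 11)) (forUp 5 4 (block [nRead 6 4 5, nAdd 7 6 0,
  rRead 5 2 7, nWrite 5 16 7, nWrite 6 16 8, rWrite 5 16 5, nAdd 16 16 2]))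

open Instr Cmd Test in
/-- Makes the second list the operation list. -/
def copyListCmd : Cmd := seq (forUp 5 16 (block [nRead 6 5 5, nWrite 2 5 6, nRead 6 6 5,
  nWrite 3 5 6, rRead 5 5 5, rWrite 3 5 5])) (block [nConst 6 0, nAdd 3 16 6])

open Instr Cmd Test in
/-- Replaces the operation list by the dense list of the same matrix.  This is only used when the
starting vectors written by `sampleCmd` are the unit coordinate vectors. -/
def denseCmd : Cmd := seq (instr (nConst 16 0))
  (seq (forUp 11 4 (seq sampleCmd (seq mulCmd columnCmd))) copyListCmd)

open Instr Cmd Test in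
/-- Processes an update vector. -/
def updateCmd : Cmd := seq dotCmd (seq pushCmd (seq (ite (rLt 3 4) skip denseCmd)
  (ite (rLt 1 2) recompCmd skip)))

/-- The input area of the memory lists the nonzero entries of `v`, at the positions `e`. -/
structure Listed {c : ℕ} (v : Fin n → ℝ) (e : Fin c → Fin n) (s : State) : Prop where
  inj : Function.Injective e
  full : ∀ i, (∀ k, e k ≠ i) → v i = 0
  count : s.nv 1 = c
  pos : ∀ k : Fin c, s.na 0 k = e k
  val : ∀ k : Fin c, s.ra 0 k = v (e k)

section Update

variable {p : Params n} {B : Matrix (Fin n) (Fin n) ℝ} {ω : ℕ → ℝ} {s : State} {c : ℕ}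
  {v : Fin n → ℝ} {e : Fin c → Fin n}

theorem runs_dot (hs : Static p s) (hl : Listed v e s) :
    Runs ω dotCmd s (1 + ((c * 8 + 2) + 3)) fun s' =>
      s'.rv 1 = s.rv 1 - (v ⬝ᵥ outVec n s) ^ 2 := by
  refine Runs.seq' (R := fun t => t = (Instr.rConst 7 0).exec ω s) (Runs.instr rfl) ?_
  rintro s₁ hf₁ rfl
  have hs₁ := hs.frame hf₁ rfl
  refine Runs.seq' (R := fun t => t.rv 7 = v ⬝ᵥ outVec n s)
    ((Runs.forUp (B := 6) (Inv := fun k s' => s'.rv 7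
      = ∑ l ∈ Finset.range k, s.ra 1 (s.na 0 l) * s.ra 0 l)
      (show ((Instr.rConst 7 0).exec ω s).nv 1 = c from hl.count) hs₁.one rfl (fun _ _ _ h => h)
      (by simp [Instr.exec]) fun k hk s' hf hi _ hinv => ?_).mono le_rfl fun s' hf h => ?_)
      fun s₂ hf₂ h₂ => Runs.block ?_
  · refine Runs.block ?_
    have e0 := hf.na 0 rfl
    have e1 := hf.ra 0 rfl
    have e2 := hf.ra 1 rfl
    simp only [Instr.exec, State.setR_na, State.setR_ra] at e0 e1 e2
    simp [Instr.exec, hinv, hi, e0, e1, e2, Finset.sum_range_succ]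
  · rw [h, Finset.sum_range, dotProduct,
      ← sum_sup_eq hl.inj (f := fun i => v i * outVec n s i) fun i hi => by
        rw [hl.full i hi, zero_mul]]
    refine Finset.sum_congr rfl fun k _ => ?_
    rw [hl.pos, hl.val, mul_comm]
    rfl
  · have e1 := hf₂.rv 1 rfl
    simp only [Instr.exec, State.setR_rv] at e1
    simp [e1, h₂, sq, Instr.exec]

theorem runs_push (hs : Static p s) (hl : Listed v e s) (hB : OpsRep p B s) :
    Runs ω pushCmd s ((c * 9 + 2) + ((c * 11 + 2) + 1)) fun s' =>
      OpsRep p (B - Matrix.vecMulVec v v) s' ∧ s'.nv 3 = s.nv 3 + c + c := by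
  set len := s.nv 3 with hlen
  refine Runs.seq' (R := fun t => t.nv 3 = len + c ∧
      t.na 2 = writes (fun l => len + l) (fun _ => s.nv 13) c (s.na 2) ∧
      t.na 3 = writes (fun l => len + l) (s.na 0) c (s.na 3) ∧
      t.ra 3 = writes (fun l => len + l) (s.ra 0) c (s.ra 3))
    (Runs.forUp (B := 7) (Inv := fun k t => t.nv 3 = len + k ∧
      t.na 2 = writes (fun l => len + l) (fun _ => s.nv 13) k (s.na 2) ∧
      t.na 3 = writes (fun l => len + l) (s.na 0) k (s.na 3) ∧
      t.ra 3 = writes (fun l => len + l) (s.ra 0) k (s.ra 3))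
      hl.count hs.one rfl (fun _ _ _ h => h) ⟨rfl, rfl, rfl, rfl⟩
      fun k hk s' hf hi h2 hinv => Runs.block ?_) fun s₁ hf₁ h₁ => ?_
  · have e0 := hf.na 0 rfl
    have e1 := hf.ra 0 rfl
    have e2 := hf.nv 13 rfl
    obtain ⟨a1, a2, a3, a4⟩ := hinv
    simp [Instr.exec, a1, a2, a3, a4, hi, e0, e1, e2, h2, writes, add_assoc]
  have hs₁ := hs.frame hf₁ rfl
  obtain ⟨b1, b2, b3, b4⟩ := h₁
  have c1 : s₁.nv 13 = s.nv 13 := hf₁.nv 13 rfl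
  have c2 : s₁.na 0 = s.na 0 := hf₁.na 0 rfl
  have c3 : s₁.ra 0 = s.ra 0 := hf₁.ra 0 rfl
  refine Runs.seq' (R := fun t => t.nv 3 = len + c + c ∧
      t.na 2 = writes (fun l => len + c + l) (fun l => n + s.na 0 l) c (s₁.na 2) ∧
      t.na 3 = writes (fun l => len + c + l) (fun _ => s.nv 13) c (s₁.na 3) ∧
      t.ra 3 = writes (fun l => len + c + l) (fun l => -s.ra 0 l) c (s₁.ra 3))
    (Runs.forUp (B := 9) (Inv := fun k t => t.nv 3 = len + c + k ∧
      t.na 2 = writes (fun l => len + c + l) (fun l => n + s.na 0 l) k (s₁.na 2) ∧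
      t.na 3 = writes (fun l => len + c + l) (fun _ => s.nv 13) k (s₁.na 3) ∧
      t.ra 3 = writes (fun l => len + c + l) (fun l => -s.ra 0 l) k (s₁.ra 3))
      ((hf₁.nv 1 rfl).trans hl.count) hs₁.one rfl (fun _ _ _ h => h) ⟨b1, rfl, rfl, rfl⟩
      fun k hk s' hf hi h2 hinv => Runs.block ?_) fun s₂ hf₂ h₂ => Runs.instr ?_
  · have e0 := (hf.na 0 rfl).trans c2
    have e1 := (hf.ra 0 rfl).trans c3
    have e2 := (hf.nv 13 rfl).trans c1
    have e3 := (hs₁.frame hf rfl).dim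
    have e4 := (hs₁.frame hf rfl).zero
    obtain ⟨a1, a2, a3, a4⟩ := hinv
    simp [Instr.exec, a1, a2, a3, a4, hi, e0, e1, e2, e3, e4, h2, writes, add_assoc, add_comm _ n]
  obtain ⟨d1, d2, d3, d4⟩ := h₂
  have e13 : s₂.nv 13 = s.nv 13 := (hf₂.nv 13 rfl).trans c1
  have e2 : s₂.nv 2 = 1 := (hf₂.nv 2 rfl).trans hs₁.one
  refine ⟨?_, by simpa [Instr.exec] using d1⟩
  have goal : Rep p (B - Matrix.vecMulVec v v) (len + c + c) (s₂.na 2) (s₂.na 3) (s₂.ra 3)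
      (s.nv 13 + 1) := by
    rw [d2, d3, d4, b2, b3, b4]
    refine Rep.append hB hl.inj hl.full (fun q hq => ?_) (fun k => ?_) fun k => ?_
    · refine ⟨?_, ?_, ?_⟩ <;>
      rw [writes_shift_of_lt (show q < s.nv 3 + c by omega), writes_shift_of_lt hq]
    · have hk := k.2
      refine ⟨?_, ?_, ?_⟩
      · rw [writes_shift_of_lt (by omega), writes_shift hk]
      · rw [writes_shift_of_lt (by omega), writes_shift hk, hl.pos]
      · rw [writes_shift_of_lt (by omega), writes_shift hk, hl.val]
    · have hk := k.2
      refine ⟨?_, ?_, ?_⟩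
      · rw [writes_shift hk, hl.pos]
      · rw [writes_shift hk]
      · rw [writes_shift hk, hl.val]
  simpa [OpsRep, Instr.exec, d1, e13, e2] using goal

/-- Steps for replacing the operation list by a dense one. -/
def denseTime (d len : ℕ) : ℕ :=
  1 + ((d * (((d * 8 + 2) + ((len * 17 + 4) + (1 + (d * 10 + 2)))) + 2) + 2)
    + ((d * d * 9 + 2) + 3))

theorem runs_dense (hsup : Function.Injective p.sup)
    (hz : ∀ i, (∀ k, p.sup k ≠ i) → ∀ r, B r i = 0) {st : AState n} (h : Holds p B st s)
    (hcnt : ¬ st.cnt < n ^ 16) :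
    Runs ω denseCmd s (denseTime p.d (s.nv 3)) fun s' => Holds p B st s' ∧
      s'.nv 3 = p.d * p.d := by
  have hs := h.static
  refine Runs.seq' (R := fun t => t.nv 16 = 0) (Runs.instr (by simp [Instr.exec]))
    fun s₁ hf₁ h₁ => ?_
  have hs₁ := hs.frame hf₁ rfl
  have hB₁ := h.ops.frame hf₁ rfl
  have hlen₁ : s₁.nv 3 = s.nv 3 := hf₁.nv 3 rfl
  -- The entries of the second list that are in place after some columns.
  set Done : ℕ → State → Prop := fun q t => t.nv 16 = q ∧ ∀ j l : Fin p.d, j * p.d + l < q →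
      t.na 5 (j * p.d + l) = n + p.sup l ∧ t.na 6 (j * p.d + l) = p.sup j ∧
      t.ra 5 (j * p.d + l) = B (p.sup l) (p.sup j) with hDone
  have hsp : ∀ j, samplePos p st.cnt j = samplePos p st.cnt 0 := fun j => by
    rw [samplePos, samplePos, if_neg hcnt, if_neg hcnt]
  refine Runs.seq' (R := fun t => Supported p (workVec n t) ∧ t.pos = samplePos p st.cnt 0 ∧
      Done (p.d * p.d) t) ?_ fun s₂ hf₂ h₂ => ?_
  · refine Runs.forUp (Inv := fun j t => Supported p (workVec n t) ∧
      t.pos = samplePos p st.cnt 0 ∧ Done (j * p.d) t)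
      hs₁.d hs₁.one rfl (fun _ _ _ h => h) ⟨?_, ?_, by simpa using h₁, ?_⟩
      fun j hj s' hf hi _ hinv => ?_
    · have : workVec n s₁ = workVec n s := by
        funext i
        rw [workVec, hf₁.ra 2 rfl]
        rfl
      exact this ▸ h.work
    · exact (hf₁.pos rfl).trans h.pos
    · intro j l hjl
      omega
    obtain ⟨i1, i2, i3, i4⟩ := hinv
    have hs' := hs₁.frame hf rfl
    have hB' := hB₁.frame hf rfl
    refine Runs.seq' (runs_sample (cnt := st.cnt) hs' hsup ?_ ?_ i1) fun t₁ hg₁ k₁ => ?_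
    · exact ((hf.rv 3 rfl).trans (hf₁.rv 3 rfl)).trans h.cnt
    · rw [i2, hsp (s'.nv 11)]
    rw [hi] at k₁
    obtain ⟨k1, k2, k3⟩ := k₁
    have ht₁ := hs'.frame hg₁ rfl
    have hC₁ := hB'.frame hg₁ rfl
    rw [← hlen₁, ← (hg₁.nv 3 rfl).trans (hf.nv 3 rfl)]
    refine Runs.seq' (runs_mul ht₁ hC₁) fun t₂ hg₂ k₂ => ?_
    have ht₂ := ht₁.frame hg₂ rfl
    have hcand : cand p ω st.cnt j = Pi.single (p.sup ⟨j, hj⟩) 1 := by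
      rw [cand, if_neg hcnt]
      funext i
      simp only [hj, exists_true_left, Pi.single_apply, eq_comm]
    have hcol : ∀ l : Fin p.d, t₂.ra 2 (n + p.sup l) = B (p.sup l) (p.sup ⟨j, hj⟩) := by
      intro l
      rw [k₂.2, k1, hcand, Matrix.mulVec_single_one]
      rfl
    have e11 : t₂.nv 11 = j := (hg₂.nv 11 rfl).trans ((hg₁.nv 11 rfl).trans hi)
    refine Runs.seq' (R := fun t => t.nv 8 = p.sup ⟨j, hj⟩) (Runs.instr ?_) fun t₃ hg₃ k₃ => ?_
    · simp only [Instr.exec, State.setN_nv, Function.update_self, e11]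
      exact ht₂.sup ⟨j, hj⟩
    have ht₃ := ht₂.frame hg₃ rfl
    refine (Runs.forUp (B := 8) (Inv := fun l t => Done (j * p.d + l) t) ht₃.d ht₃.one rfl
      (by intro _ _ _ h; exact h) ⟨?_, ?_⟩ fun l hl t hf' hi' h2 hinv => Runs.block ?_).mono le_rfl
      fun t hf' k₄ => ⟨?_, ?_, ?_⟩
    · rw [hg₃.nv 16 rfl, hg₂.nv 16 rfl, hg₁.nv 16 rfl, i3, add_zero]
    · intro j' l' hjl
      rw [hg₃.na 5 rfl, hg₂.na 5 rfl, hg₁.na 5 rfl, hg₃.na 6 rfl, hg₂.na 6 rfl, hg₁.na 6 rfl,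
        hg₃.ra 5 rfl, hg₂.ra 5 rfl, hg₁.ra 5 rfl]
      exact i4 j' l' hjl
    · obtain ⟨q1, q2⟩ := hinv
      have u4 : t.na 4 l = p.sup ⟨l, hl⟩ := (ht₃.frame hf' rfl).sup ⟨l, hl⟩
      have u0 := (ht₃.frame hf' rfl).dim
      have u8 := (hf'.nv 8 rfl).trans k₃
      have u2 : t.ra 2 = t₂.ra 2 := (hf'.ra 2 rfl).trans (hg₃.ra 2 rfl)
      have uc := hcol ⟨l, hl⟩
      refine ⟨by simp [Instr.exec, q1, h2, add_assoc], ?_⟩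
      intro j' l' hjl
      simp only [List.foldl, Instr.exec, State.setN_nv, State.setN_na, State.setN_ra, State.setN_rv,
        State.setR_nv, State.setR_na, State.setR_ra, State.setR_rv, State.setNA_nv, State.setNA_na,
        State.setNA_ra, State.setNA_rv, State.setRA_nv, State.setRA_na, State.setRA_ra,
        Function.update_self]
      by_cases hq : (j' : ℕ) * p.d + l' = j * p.d + l
      · have ej : (j' : ℕ) = j ∧ (l' : ℕ) = l := by
          have hd : 0 < p.d := lt_of_le_of_lt (Nat.zero_le _) hj
          have z1 : ((j' : ℕ) * p.d + l') / p.d = j' := by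
            rw [add_comm, Nat.add_mul_div_right _ _ hd, Nat.div_eq_of_lt l'.2, zero_add]
          have z2 : (j * p.d + l) / p.d = j := by
            rw [add_comm, Nat.add_mul_div_right _ _ hd, Nat.div_eq_of_lt hl, zero_add]
          have ej : (j' : ℕ) = j := by rw [← z1, ← z2, hq]
          rw [ej] at hq
          exact ⟨ej, Nat.add_left_cancel hq⟩
        obtain ⟨ej, el⟩ := ej
        have ej' : j' = ⟨j, hj⟩ := Fin.ext ej
        have el' : l' = ⟨l, hl⟩ := Fin.ext el
        subst ej' el'
        simp [q1, u4, u0, u8, u2, hi', add_comm _ n, uc]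
      · have := q2 j' l' (by omega)
        simp [q1, u4, u0, u8, u2, hi', add_comm _ n, hq, this]
    · have : workVec n t = workVec n t₁ := by
        rw [← k₂.1]
        funext i
        rw [workVec, hf'.ra 2 rfl, hg₃.ra 2 rfl]
        rfl
      rw [this]
      exact k2
    · rw [hf'.pos rfl, hg₃.pos rfl, hg₂.pos rfl, k3, hsp]
    · rw [add_mul, one_mul]
      exact k₄
  · obtain ⟨j1, j2, j3, j4⟩ := h₂
    have hs₂ := hs₁.frame hf₂ rfl
    refine Runs.seq' (R := fun t => (∀ q < p.d * p.d, t.na 2 q = s₂.na 5 q ∧ t.na 3 q = s₂.na 6 q ∧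
        t.ra 3 q = s₂.ra 5 q)) (Runs.forUp (B := 7) (Inv := fun k t => (∀ q < k,
          t.na 2 q = s₂.na 5 q ∧ t.na 3 q = s₂.na 6 q ∧ t.ra 3 q = s₂.ra 5 q))
      j3 hs₂.one rfl (fun _ _ _ h => h) (fun q hq => by omega)
      fun k hk t hf' hi' h2 hinv => Runs.block ?_) fun s₃ hf₃ h₃ => Runs.block ?_
    · have u5 := hf'.na 5 rfl
      have u6 := hf'.na 6 rfl
      have u7 := hf'.ra 5 rfl
      intro q hq
      rcases Nat.lt_succ_iff_lt_or_eq.1 hq with hq | rfl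
      · have := hinv q hq
        simp [Instr.exec, hi', u5, u6, u7, this, hq.ne]
      · simp [Instr.exec, hi', u5, u6, u7]
    · have hs₃ := hs₂.frame hf₃ rfl
      have e16 : s₃.nv 16 = p.d * p.d := (hf₃.nv 16 rfl).trans j3
      have e13 : s₃.nv 13 = s.nv 13 :=
        (hf₃.nv 13 rfl).trans ((hf₂.nv 13 rfl).trans (hf₁.nv 13 rfl))
      set s₄ := List.foldl (fun s i => Instr.exec ω i s) s₃
        [Instr.nConst 6 0, Instr.nAdd 3 16 6] with hs₄
      have n3 : s₄.nv 3 = p.d * p.d := by simp [hs₄, Instr.exec, e16]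
      have a2 : s₄.na = s₃.na := rfl
      have a3 : s₄.ra = s₃.ra := rfl
      have a4 : s₄.rv = s₃.rv := rfl
      have a13 : s₄.nv 13 = s.nv 13 := by simp [hs₄, Instr.exec, e13]
      have o₄ : outVec n s₄ = outVec n s := by
        funext i
        rw [outVec, a3, hf₃.ra 1 rfl, hf₂.ra 1 rfl, hf₁.ra 1 rfl]
        rfl
      have w₄ : workVec n s₄ = workVec n s₂ := by
        funext i
        rw [workVec, a3, hf₃.ra 2 rfl]
        rfl
      refine ⟨⟨?_, ?_, w₄ ▸ j1, ?_, h.cnt_le, ?_, o₄.trans h.vec, o₄ ▸ h.supp, ?_⟩, n3⟩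
      · refine ⟨?_, ?_, ?_, ?_, ?_, ?_, ?_, ?_, ?_⟩
        · simpa [hs₄, Instr.exec] using hs₃.dim
        · simpa [hs₄, Instr.exec] using hs₃.one
        · simpa [hs₄, Instr.exec] using hs₃.d
        · simpa [hs₄, Instr.exec] using hs₃.K
        · simpa [hs₄, Instr.exec] using hs₃.m
        · exact hs₃.eps
        · exact hs₃.cap
        · exact hs₃.zero
        · exact hs₃.sup
      · rw [OpsRep, n3, a2, a3, a13]
        refine Rep.dense h.ops.zc_ge hsup hz fun j l => ?_
        have hlt : (j : ℕ) * p.d + l < p.d * p.d := by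
          have : ((j : ℕ) + 1) * p.d ≤ p.d * p.d := Nat.mul_le_mul_right _ j.2
          have := l.2
          rw [add_mul, one_mul] at *
          omega
        obtain ⟨z1, z2, z3⟩ := h₃ _ hlt
        rw [z1, z2, z3]
        exact j4 j l hlt
      · rw [a4, hf₃.rv 3 rfl, hf₂.rv 3 rfl, hf₁.rv 3 rfl, h.cnt]
      · exact (hf₃.pos rfl).trans j2
      · rw [a4, hf₃.rv 2 rfl, hf₂.rv 2 rfl, hf₁.rv 2 rfl, h.thr]

open Classical in
/-- Steps for an update with `c` nonzero entries. -/
noncomputable def updateTime (p : Params n) (B : Matrix (Fin n) (Fin n) ℝ) (st : AState n)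
    (len c : ℕ) : ℕ :=
  60 * (c + 1) + (if st.cnt < n ^ 16 then 0 else denseTime p.d (len + c + c))
    + if Trig B st then recompTime p.d p.K (numCand p st.cnt)
        (if st.cnt < n ^ 16 then len + c + c else p.d * p.d) else 0

theorem quad_sub_vecMulVec (w v : Fin n → ℝ) (B : Matrix (Fin n) (Fin n) ℝ) :
    w ⬝ᵥ ((B - Matrix.vecMulVec v v) *ᵥ w) = w ⬝ᵥ (B *ᵥ w) - (v ⬝ᵥ w) ^ 2 := by
  rw [Matrix.sub_mulVec, dotProduct_sub, Matrix.vecMulVec_mulVec, dotProduct_comm w (_ • _)]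
  simp [sq, smul_dotProduct]

open Classical in
theorem runs_update (hsup : Function.Injective p.sup) (hK : 0 < p.K)
    (hsym : (B - Matrix.vecMulVec v v)ᵀ = B - Matrix.vecMulVec v v)
    (hz : ∀ i, (∀ k, p.sup k ≠ i) → ∀ r, (B - Matrix.vecMulVec v v) r i = 0) {st : AState n}
    (h : Holds p B st s) (hq : s.rv 1 = st.w ⬝ᵥ (B *ᵥ st.w)) (hl : Listed v e s) :
    Runs ω updateCmd s (updateTime p (B - Matrix.vecMulVec v v) st (s.nv 3) c) fun s' =>
      (Holds p (B - Matrix.vecMulVec v v) (stepState p ω (B - Matrix.vecMulVec v v) st) s' ∧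
      s'.rv 1 = (stepState p ω (B - Matrix.vecMulVec v v) st).w ⬝ᵥ ((B - Matrix.vecMulVec v v) *ᵥ
        (stepState p ω (B - Matrix.vecMulVec v v) st).w)) ∧
      s'.nv 3 = if st.cnt < n ^ 16 then s.nv 3 + c + c else p.d * p.d := by
  set B' := B - Matrix.vecMulVec v v with hB'
  have htime : (1 + ((c * 8 + 2) + 3)) + (((c * 9 + 2) + ((c * 11 + 2) + 1))
      + (((if st.cnt < n ^ 16 then 1 else denseTime p.d (s.nv 3 + c + c)) + 1)
      + ((if Trig B' st then recompTime p.d p.K (numCand p st.cnt)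
        (if st.cnt < n ^ 16 then s.nv 3 + c + c else p.d * p.d) else 1) + 1)))
      ≤ updateTime p B' st (s.nv 3) c := by
    rw [updateTime]
    split_ifs <;> omega
  refine Runs.mono ?_ htime fun _ _ h => h
  refine Runs.seq' (runs_dot h.static hl) fun s₁ hf₁ h₁ => ?_
  have hs₁ := h.static.frame hf₁ rfl
  have hl₁ : Listed v e s₁ := ⟨hl.inj, hl.full, (hf₁.nv 1 rfl).trans hl.count,
    fun k => by rw [hf₁.na 0 rfl]; exact hl.pos k, fun k => by rw [hf₁.ra 0 rfl]; exact hl.val k⟩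
  refine Runs.seq' (runs_push hs₁ hl₁ (h.ops.frame hf₁ rfl)) fun s₂ hf₂ h₂ => ?_
  have hs₂ := hs₁.frame hf₂ rfl
  have q₂ : s₂.rv 1 = st.w ⬝ᵥ (B' *ᵥ st.w) := by
    rw [hf₂.rv 1 rfl, h₁, hq, hB', quad_sub_vecMulVec, h.vec]
  have o₂ : outVec n s₂ = outVec n s := by
    funext i
    rw [outVec, hf₂.ra 1 rfl, hf₁.ra 1 rfl]
    rfl
  have w₂ : workVec n s₂ = workVec n s := by
    funext i
    rw [workVec, hf₂.ra 2 rfl, hf₁.ra 2 rfl]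
    rfl
  have len₂ : s₂.nv 3 = s.nv 3 + c + c := by rw [h₂.2, hf₁.nv 3 rfl]
  have H₂ : Holds p B' st s₂ := by
    refine ⟨hs₂, h₂.1, w₂ ▸ h.work, ?_, h.cnt_le, ?_, o₂.trans h.vec, o₂ ▸ h.supp, ?_⟩
    · rw [hf₂.rv 3 rfl, hf₁.rv 3 rfl, h.cnt]
    · rw [hf₂.pos rfl, hf₁.pos rfl, h.pos]
    · rw [hf₂.rv 2 rfl, hf₁.rv 2 rfl, h.thr]
  refine Runs.seq' (R := fun t => Holds p B' st t ∧ t.rv 1 = st.w ⬝ᵥ (B' *ᵥ st.w) ∧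
    t.nv 3 = if st.cnt < n ^ 16 then s.nv 3 + c + c else p.d * p.d)
    (Runs.ite (fun hb => ?_) fun hb => ?_) fun s₃ hf₃ h₃ => ?_
  · rw [holds_cap hs₂ H₂.cnt] at hb
    rw [if_pos hb, if_pos hb]
    exact Runs.skip ⟨H₂, q₂, len₂⟩
  · rw [holds_cap hs₂ H₂.cnt] at hb
    rw [if_neg hb, if_neg hb, ← len₂]
    exact (runs_dense hsup hz H₂ hb).mono le_rfl fun t hf ht =>
      ⟨ht.1, (hf.rv 1 rfl).trans q₂, ht.2⟩
  obtain ⟨H₃, q₃, len₃⟩ := h₃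
  have htest : (Test.rLt 1 2).Holds s₃ ↔ Trig B' st := by
    rw [Test.Holds, q₃, H₃.thr, Trig]
  rw [← len₃]
  refine Runs.ite (fun hb => ?_) fun hb => ?_
  · rw [htest] at hb
    rw [if_pos hb, stepState, if_pos hb]
    refine (runs_recomp hsup hK hsym hz H₃).mono le_rfl fun t hf ht => ⟨ht, ?_⟩
    rw [hf.nv 3 rfl]
  · rw [htest] at hb
    rw [if_neg hb, stepState, if_neg hb]
    exact Runs.skip ⟨⟨H₃, q₃⟩, rfl⟩

end Update

/-! ### Initialization -/

/-- The positions on the diagonal among the first `k` listed positions, as a list of row numbers. -/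
def diagRows {N : ℕ} (e : Fin N → Fin n × Fin n) : ℕ → List (Fin n)
  | 0 => []
  | k + 1 => if h : ∃ h : k < N, (e ⟨k, h⟩).1 = (e ⟨k, h⟩).2 then
      diagRows e k ++ [(e ⟨k, h.1⟩).1] else diagRows e k

theorem mem_diagRows {N : ℕ} {e : Fin N → Fin n × Fin n} {k : ℕ} {i : Fin n} :
    i ∈ diagRows e k ↔ ∃ l : Fin N, (l : ℕ) < k ∧ e l = (i, i) := by
  induction k with
  | zero => simp [diagRows]
  | succ k ih =>
    have hsplit : (∃ l : Fin N, (l : ℕ) < k + 1 ∧ e l = (i, i)) ↔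
        (∃ l : Fin N, (l : ℕ) < k ∧ e l = (i, i)) ∨ ∃ h : k < N, e ⟨k, h⟩ = (i, i) := by
      constructor
      · rintro ⟨l, hl, h⟩
        rcases Nat.lt_succ_iff_lt_or_eq.1 hl with hl | hl
        · exact Or.inl ⟨l, hl, h⟩
        · subst hl
          exact Or.inr ⟨l.2, h⟩
      · rintro (⟨l, hl, h⟩ | ⟨h, h'⟩)
        · exact ⟨l, by omega, h⟩
        · exact ⟨⟨k, h⟩, by simp, h'⟩
    rw [hsplit, diagRows, ← ih]
    split_ifs with h
    · obtain ⟨h1, h2⟩ := h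
      rw [List.mem_append, List.mem_singleton]
      refine or_congr_right ⟨fun hi => ⟨h1, ?_⟩, fun ⟨_, hi⟩ => by rw [hi]⟩
      rw [hi]
      exact Prod.ext rfl h2.symm
    · refine (or_iff_left ?_).symm
      rintro ⟨h1, h2⟩
      exact h ⟨h1, by rw [h2]⟩

theorem length_diagRows_le {N : ℕ} (e : Fin N → Fin n × Fin n) (k : ℕ) :
    (diagRows e k).length ≤ k := by
  induction k with
  | zero => simp [diagRows]
  | succ k ih =>
    rw [diagRows]
    split_ifs
    · simpa using ih
    · omega

theorem nodup_diagRows {N : ℕ} {e : Fin N → Fin n × Fin n} (he : Function.Injective e) (k : ℕ) :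
    (diagRows e k).Nodup := by
  induction k with
  | zero => simp [diagRows]
  | succ k ih =>
    rw [diagRows]
    split_ifs with h
    · refine List.nodup_append.2 ⟨ih, List.nodup_singleton _, ?_⟩
      intro a ha b hb hab
      rw [List.mem_singleton] at hb
      obtain ⟨l, hl, hl'⟩ := mem_diagRows.1 ha
      have : l = ⟨k, h.1⟩ := he (by
        rw [hl', hab, hb]
        exact Prod.ext rfl h.2)
      rw [this] at hl
      exact lt_irrefl _ hl
    · exact ih

/-- The parameters used for the input `ε`, `A`, listed in the order `e`.  The support is the set of
nonzero diagonal positions.  The constants `32` and `64` make the bounds `failure_le` and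
`exp_power_lt` hold. -/
noncomputable def initParams (ε : ℝ) {A : Matrix (Fin n) (Fin n) ℝ} (e : MatListing A) :
    Params n where
  d := (diagRows (fun k => (e k).1) (nnzMat A)).length
  m := 32 * Nat.clog 2 n
  K := ⌈64 * (Nat.clog 2 n : ℝ) / ε⌉₊
  sup k := (diagRows (fun k => (e k).1) (nnzMat A))[k]
  ε := ε

section Init

variable {A : Matrix (Fin n) (Fin n) ℝ} (e : MatListing A) (ε : ℝ)

theorem injective_listing : Function.Injective fun k => (e k).1 :=
  Subtype.val_injective.comp e.injective

theorem injective_initParams_sup : Function.Injective (initParams ε e).sup := by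
  intro i j h
  exact Fin.ext ((nodup_diagRows (injective_listing e) _).getElem_inj_iff.1 h)

theorem initParams_d_le : (initParams ε e).d ≤ nnzMat A := length_diagRows_le _ _

theorem exists_initParams_sup {i : Fin n} :
    (∃ k, (initParams ε e).sup k = i) ↔ A i i ≠ 0 := by
  have h1 : (∃ k, (initParams ε e).sup k = i) ↔ i ∈ diagRows (fun k => (e k).1) (nnzMat A) := by
    rw [List.mem_iff_getElem]
    exact ⟨fun ⟨k, hk⟩ => ⟨k, k.2, hk⟩, fun ⟨k, hk, h⟩ => ⟨⟨k, hk⟩, h⟩⟩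
  rw [h1, mem_diagRows]
  constructor
  · rintro ⟨l, -, h⟩
    have := (e l).2
    rwa [h] at this
  · intro h
    refine ⟨e.symm ⟨(i, i), h⟩, Fin.is_lt _, by simp⟩

/-- The listed entries represent `A`.  Every support coordinate `i` has the listed entry `(i, i)`,
whence its cell `n + i` is cleared. -/
theorem Rep.ofListing {dst src : ℕ → ℕ} {val : ℕ → ℝ}
    (h : ∀ k : Fin (nnzMat A), dst k = n + (e k).1.1 ∧ src k = (e k).1.2 ∧
      val k = A (e k).1.1 (e k).1.2) :
    Rep (initParams ε e) A (nnzMat A) dst src val (n + n) := by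
  have hbnd : ∀ q < nnzMat A, n ≤ dst q ∧ dst q < n + n ∧ src q < n := by
    intro q hq
    obtain ⟨a1, a2, -⟩ := h ⟨q, hq⟩
    have := (e ⟨q, hq⟩).1.1.2
    have := (e ⟨q, hq⟩).1.2.2
    simp only at a1 a2
    omega
  refine ⟨le_rfl, fun q hq => ?_, fun X k => ?_⟩
  · have := hbnd q hq
    omega
  have hk : A ((initParams ε e).sup k) ((initParams ε e).sup k) ≠ 0 :=
    (exists_initParams_sup e ε).1 ⟨k, rfl⟩
  generalize (initParams ε e).sup k = i at hk ⊢
  rw [opsRun_batch]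
  · have hx : ∀ j : Fin n, writes dst (fun _ => (0 : ℝ)) (nnzMat A) X j = X j := fun j =>
      writes_of_ne fun l hl => by
        have := (hbnd l hl).1
        omega
    have hex : ∃ l < nnzMat A, dst l = n + i := by
      refine ⟨e.symm ⟨(i, i), hk⟩, Fin.is_lt _, ?_⟩
      rw [(h _).1]
      simp
    rw [writes_of_eq (r := 0) (fun _ _ _ => rfl) hex, zero_add, Finset.sum_range]
    have e1 : ∀ q : Fin (nnzMat A), (if dst (0 + q) = n + i then val (0 + q) *
        writes dst (fun _ => (0 : ℝ)) (nnzMat A) X (src (0 + q)) else 0)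
        = (fun z : Fin n × Fin n => if z.1 = i then A z.1 z.2 * X z.2 else 0) (e q).1 := by
      intro q
      obtain ⟨a1, a2, a3⟩ := h q
      rw [zero_add, a1, a2, a3, hx]
      simp only [Nat.add_left_cancel_iff, Fin.val_inj]
    rw [Finset.sum_congr rfl fun q _ => e1 q, sum_sup_eq (injective_listing e)
      (f := fun z : Fin n × Fin n => if z.1 = i then A z.1 z.2 * X z.2 else 0),
      Fintype.sum_prod_type]
    · rw [Finset.sum_eq_single i]
      · simp
      · intro b _ hb
        simp [hb]
      · intro hi
        exact absurd (Finset.mem_univ i) hi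
    · intro z hz
      have : A z.1 z.2 = 0 := by
        by_contra hne
        exact hz (e.symm ⟨z, hne⟩) (by simp)
      simp [this]
  · intro q hq q' hq'
    have := hbnd q hq
    have := hbnd q' hq'
    rw [zero_add, zero_add]
    omega

open Instr Cmd Test in
/-- Turns the listed entries into operations, and collects the support from the diagonal. -/
def entriesCmd : Cmd := forUp 5 1 (seq (block [nRead 6 0 5, nRead 7 1 5, nAdd 8 6 0, rRead 5 0 5,
  nWrite 2 5 8, nWrite 3 5 7, rWrite 3 5 5])
  (ite (nLe 6 7) (ite (nLe 7 6) (block [nWrite 4 4 6, nAdd 4 4 2]) skip) skip))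

open Instr Cmd Test in
/-- Computes the number of candidates and the number of power steps. -/
def paramsCmd : Cmd := seq (block [nConst 6 0, nAdd 3 1 6, nAdd 13 0 0, nConst 6 1])
  (seq (loop (nLt 6 0) (block [nAdd 6 6 6, nAdd 12 12 2]))
  (seq (block [nAdd 12 12 12, nAdd 12 12 12, nAdd 12 12 12, nAdd 12 12 12, nAdd 12 12 12,
    rOfNat 5 12, rAdd 5 5 5, rDiv 5 5 0, rConst 6 0, rConst 7 1])
  (seq (loop (rLt 6 5) (block [rAdd 6 6 7, nAdd 10 10 2]))
  (block [rOfNat 4 0, rMul 4 4 4, rMul 4 4 4, rMul 4 4 4, rMul 4 4 4, nConst 6 0, rWrite 1 6 7]))))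

open Instr Cmd in
/-- Processes the input and finds a first vector. -/
def initCmd : Cmd := seq (instr (nConst 2 1)) (seq entriesCmd (seq paramsCmd recompCmd))

variable {ω : ℕ → ℝ} {s : State}

theorem runs_entries (h0 : s.nv 0 = n) (h1 : s.nv 1 = nnzMat A) (h2 : s.nv 2 = 1) (h4 : s.nv 4 = 0)
    (hr : ∀ k : Fin (nnzMat A), s.na 0 k = (e k).1.1)
    (hc : ∀ k : Fin (nnzMat A), s.na 1 k = (e k).1.2)
    (hv : ∀ k : Fin (nnzMat A), s.ra 0 k = A (e k).1.1 (e k).1.2) :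
    Runs ω entriesCmd s (nnzMat A * 15 + 2) fun s' =>
      (∀ k : Fin (nnzMat A), s'.na 2 k = n + (e k).1.1 ∧ s'.na 3 k = (e k).1.2 ∧
        s'.ra 3 k = A (e k).1.1 (e k).1.2) ∧
      s'.nv 4 = (initParams ε e).d ∧
        ∀ k : Fin (initParams ε e).d, s'.na 4 k = (initParams ε e).sup k := by
  set L := diagRows fun k => (e k).1 with hL
  refine (Runs.forUp (B := 13) (Inv := fun k t => (∀ l : Fin (nnzMat A), (l : ℕ) < k →
      t.na 2 l = n + (e l).1.1 ∧ t.na 3 l = (e l).1.2 ∧ t.ra 3 l = A (e l).1.1 (e l).1.2) ∧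
      t.nv 4 = (L k).length ∧ ∀ (q : ℕ) (hq : q < (L k).length), t.na 4 q = (L k)[q])
    h1 h2 rfl (by intro _ _ _ h; exact h) ⟨fun l hl => by omega, h4,
      fun q hq => by simp [hL, diagRows] at hq⟩
    fun k hk t hf hi ht2 hinv => ?_).mono le_rfl fun t _ h =>
      ⟨fun l => h.1 l l.2, h.2.1, fun k => h.2.2 k k.2⟩
  obtain ⟨i1, i2, i3⟩ := hinv
  have n0 : t.nv 0 = n := (hf.nv 0 rfl).trans h0
  have r0 : t.na 0 k = (e ⟨k, hk⟩).1.1 := by rw [hf.na 0 rfl]; exact hr ⟨k, hk⟩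
  have r1 : t.na 1 k = (e ⟨k, hk⟩).1.2 := by rw [hf.na 1 rfl]; exact hc ⟨k, hk⟩
  have r2 : t.ra 0 k = A (e ⟨k, hk⟩).1.1 (e ⟨k, hk⟩).1.2 := by rw [hf.ra 0 rfl]; exact hv ⟨k, hk⟩
  refine Runs.seq' (B := 8) (B' := 4 + 1) (R := fun u => (∀ l : Fin (nnzMat A), (l : ℕ) < k + 1 →
      u.na 2 l = n + (e l).1.1 ∧ u.na 3 l = (e l).1.2 ∧ u.ra 3 l = A (e l).1.1 (e l).1.2) ∧
      u.nv 6 = (e ⟨k, hk⟩).1.1 ∧ u.nv 7 = (e ⟨k, hk⟩).1.2) (Runs.block ?_) fun u hg hu => ?_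
  · refine ⟨fun l hl => ?_, by simp [Instr.exec, hi, r0], by simp [Instr.exec, hi, r1]⟩
    rcases Nat.lt_succ_iff_lt_or_eq.1 hl with hl | hl
    · have := i1 l hl
      simp [Instr.exec, hi, this, hl.ne]
    · subst hl
      simp [Instr.exec, hi, r0, r1, r2, n0, add_comm _ n]
  obtain ⟨u1, u6, u7⟩ := hu
  have u4 : u.nv 4 = (L k).length := (hg.nv 4 rfl).trans i2
  have ua : u.na 4 = t.na 4 := hg.na 4 rfl
  have hskip : ¬ (e ⟨k, hk⟩).1.1 = (e ⟨k, hk⟩).1.2 → L (k + 1) = L k := by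
    intro hne
    rw [hL, diagRows, dif_neg]
    rintro ⟨_, h⟩
    exact hne h
  have hQ : ¬ (e ⟨k, hk⟩).1.1 = (e ⟨k, hk⟩).1.2 → (∀ l : Fin (nnzMat A), (l : ℕ) < k + 1 →
      u.na 2 l = n + (e l).1.1 ∧ u.na 3 l = (e l).1.2 ∧ u.ra 3 l = A (e l).1.1 (e l).1.2) ∧
      u.nv 4 = (L (k + 1)).length ∧
        ∀ (q : ℕ) (hq : q < (L (k + 1)).length), u.na 4 q = (L (k + 1))[q] := by
    intro hne
    rw [hskip hne, ua]
    exact ⟨u1, u4, i3⟩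
  refine Runs.ite (fun ha => Runs.ite (B := 3) (fun hb => Runs.block ?_) fun hb =>
    (Runs.skip (hQ ?_)).mono (by omega) fun _ _ h => h) fun ha =>
    (Runs.skip (hQ ?_)).mono (by omega) fun _ _ h => h
  · simp only [Test.Holds, u6, u7] at ha hb
    have heq : (e ⟨k, hk⟩).1.1 = (e ⟨k, hk⟩).1.2 := Fin.ext (le_antisymm ha hb)
    have hLk : L (k + 1) = L k ++ [(e ⟨k, hk⟩).1.1] := by
      rw [hL, diagRows, dif_pos ⟨hk, heq⟩]
    have u2 : u.nv 2 = 1 := (hg.nv 2 rfl).trans ht2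
    refine ⟨fun l hl => by simpa [Instr.exec] using u1 l hl, by simp [Instr.exec, u4, u2, hLk], ?_⟩
    intro q hq
    simp only [hLk] at hq ⊢
    rw [List.length_append, List.length_singleton] at hq
    rcases Nat.lt_succ_iff_lt_or_eq.1 hq with hq' | hq'
    · rw [List.getElem_append_left hq', ← i3 q hq', ← ua]
      simp [Instr.exec, u4, hq'.ne]
    · subst hq'
      simp [Instr.exec, u4, u6]
  · simp only [Test.Holds, u6, u7] at hb
    exact fun h => hb (by rw [h])
  · simp only [Test.Holds, u6, u7] at ha
    exact fun h => ha (by rw [h])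

theorem runs_params {l : ℕ} (hl : l = Nat.clog 2 n) (h0 : s.nv 0 = n) (h2 : s.nv 2 = 1)
    (h10 : s.nv 10 = 0) (h12 : s.nv 12 = 0) (hε : s.rv 0 = ε) (hr1 : s.ra 1 = fun _ => 0) :
    Runs ω paramsCmd s (5 + ((l * 4 + 1) + (11 + ((⌈64 * (l : ℝ) / ε⌉₊ * 4 + 1) + 8)))) fun s' =>
      s'.nv 3 = s.nv 1 ∧ s'.nv 13 = n + n ∧ s'.nv 12 = 32 * l ∧ s'.nv 10 = ⌈64 * (l : ℝ) / ε⌉₊ ∧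
      s'.rv 4 = (n : ℝ) ^ 16 ∧ s'.ra 1 = Function.update (fun _ => 0) 0 1 := by
  refine Runs.seq' (R := fun t => t.nv 3 = s.nv 1 ∧ t.nv 13 = n + n ∧ t.nv 6 = 1)
    (Runs.block (by simp [Instr.exec, h0])) fun s₁ hf₁ h₁ => ?_
  refine Runs.seq' (R := fun t => t.nv 12 = l) ((Runs.while (N := l) (B := 3) (Inv := fun k t =>
      t.nv 6 = 2 ^ k ∧ t.nv 12 = k ∧ t.nv 0 = n ∧ t.nv 2 = 1)
      ⟨h₁.2.2, (hf₁.nv 12 rfl).trans h12, (hf₁.nv 0 rfl).trans h0, (hf₁.nv 2 rfl).trans h2⟩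
      ?_ ?_).mono le_rfl fun t _ h => h.2.1) fun s₂ hf₂ h₂ => ?_
  · rintro t ⟨a1, -, a3, -⟩
    rw [Test.Holds, a1, a3, hl, not_lt]
    exact Nat.le_pow_clog one_lt_two n
  · rintro k hk t ⟨a1, a2, a3, a4⟩
    refine ⟨?_, Runs.block ?_⟩
    · rw [Test.Holds, a1, a3]
      exact (Nat.lt_clog_iff_pow_lt one_lt_two).1 (hl ▸ hk)
    · simp [Instr.exec, a1, a2, a3, a4, pow_succ, mul_two]
  refine Runs.seq' (R := fun t => t.nv 12 = 32 * l ∧ t.rv 5 = 64 * (l : ℝ) / ε ∧ t.rv 6 = 0 ∧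
    t.rv 7 = 1) (Runs.block ?_) fun s₃ hf₃ h₃ => ?_
  · have e0 : s₂.rv 0 = ε := (hf₂.rv 0 rfl).trans ((hf₁.rv 0 rfl).trans hε)
    simp only [List.foldl, Instr.exec, State.setN_nv, State.setN_rv, State.setR_nv, State.setR_rv,
      Function.update_self, h₂]
    refine ⟨?_, ?_, by simp, by simp⟩
    · ring
    · simp [e0]
      ring
  obtain ⟨b1, b2, b3, b4⟩ := h₃
  refine Runs.seq' (R := fun t => t.nv 10 = ⌈64 * (l : ℝ) / ε⌉₊) ((Runs.while
      (N := ⌈64 * (l : ℝ) / ε⌉₊) (B := 3) (Inv := fun k t => t.rv 6 = k ∧ t.nv 10 = k ∧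
        t.rv 5 = 64 * (l : ℝ) / ε ∧ t.rv 7 = 1 ∧ t.nv 2 = 1)
      ⟨?_, ?_, b2, b4, ?_⟩ ?_ ?_).mono le_rfl fun t _ h => h.2.1) fun s₄ hf₄ h₄ => Runs.block ?_
  · simp [b3]
  · rw [hf₃.nv 10 rfl, hf₂.nv 10 rfl, hf₁.nv 10 rfl, h10]
  · rw [hf₃.nv 2 rfl, hf₂.nv 2 rfl, hf₁.nv 2 rfl, h2]
  · rintro t ⟨a1, -, a3, -⟩
    rw [Test.Holds, a1, a3, not_lt]
    exact Nat.le_ceil _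
  · rintro k hk t ⟨a1, a2, a3, a4, a5⟩
    refine ⟨?_, Runs.block ?_⟩
    · rw [Test.Holds, a1, a3]
      exact Nat.lt_ceil.1 hk
    · simp [Instr.exec, a1, a2, a3, a4, a5]
  · have c0 : s₄.nv 0 = n := by rw [hf₄.nv 0 rfl, hf₃.nv 0 rfl, hf₂.nv 0 rfl, hf₁.nv 0 rfl, h0]
    have c3 : s₄.nv 3 = s.nv 1 := by rw [hf₄.nv 3 rfl, hf₃.nv 3 rfl, hf₂.nv 3 rfl, h₁.1]
    have c13 : s₄.nv 13 = n + n := by rw [hf₄.nv 13 rfl, hf₃.nv 13 rfl, hf₂.nv 13 rfl, h₁.2.1]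
    have c12 : s₄.nv 12 = 32 * l := by rw [hf₄.nv 12 rfl, b1]
    have c7 : s₄.rv 7 = 1 := (hf₄.rv 7 rfl).trans b4
    have c1 : s₄.ra 1 = fun _ => 0 := by
      rw [hf₄.ra 1 rfl, hf₃.ra 1 rfl, hf₂.ra 1 rfl, hf₁.ra 1 rfl, hr1]
    simp [Instr.exec, c0, c3, c13, c12, c7, c1, h₄]
    ring

/-- Steps for the initialization. -/
noncomputable def initTime (p : Params n) (N : ℕ) : ℕ :=
  100 + 15 * N + p.m + 4 * p.K + recompTime p.d p.K p.m N

theorem runs_init [NeZero n] (hK : 0 < (initParams ε e).K) (hsym : Aᵀ = A)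
    (hz : ∀ i, (∀ k, (initParams ε e).sup k ≠ i) → ∀ r, A r i = 0) {thr : ℝ} :
    Runs ω initCmd (initState ε A e) (initTime (initParams ε e) (nnzMat A)) fun s' =>
      Holds (initParams ε e) A (recomp (initParams ε e) ω A ⟨0, Pi.single 0 1, thr⟩) s' ∧
      s'.rv 1 = (recomp (initParams ε e) ω A ⟨0, Pi.single 0 1, thr⟩).w ⬝ᵥ
        (A *ᵥ (recomp (initParams ε e) ω A ⟨0, Pi.single 0 1, thr⟩).w) ∧
      s'.nv 3 = nnzMat A := by
  set p := initParams ε e with hp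
  have hn : 0 < n := Nat.pos_of_ne_zero (NeZero.ne n)
  have hcap : (0 : ℕ) < n ^ 16 := pow_pos hn 16
  have htime : 1 + ((nnzMat A * 15 + 2) + ((5 + ((Nat.clog 2 n * 4 + 1)
      + (11 + ((⌈64 * (Nat.clog 2 n : ℝ) / ε⌉₊ * 4 + 1) + 8))))
        + recompTime p.d p.K p.m (nnzMat A)))
      ≤ initTime p (nnzMat A) := by
    have e1 : p.m = 32 * Nat.clog 2 n := rfl
    have e2 : p.K = ⌈64 * (Nat.clog 2 n : ℝ) / ε⌉₊ := rfl
    rw [initTime, ← e2]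
    omega
  refine Runs.mono ?_ htime fun _ _ h => h
  set s₀ := initState ε A e with hs₀
  refine Runs.seq' (R := fun t => t.nv 2 = 1) (Runs.instr (by simp [Instr.exec]))
    fun s₁ hf₁ h₁ => ?_
  refine Runs.seq' (runs_entries e ε ((hf₁.nv 0 rfl).trans ?_) ((hf₁.nv 1 rfl).trans ?_) h₁
    ((hf₁.nv 4 rfl).trans ?_) (fun k => ?_) (fun k => ?_) fun k => ?_) fun s₂ hf₂ h₂ => ?_
  · simp [hs₀, initState]
  · simp [hs₀, initState]
  · simp [hs₀, initState]
  · rw [hf₁.na 0 rfl]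
    simp [hs₀, initState]
  · rw [hf₁.na 1 rfl]
    simp [hs₀, initState]
  · rw [hf₁.ra 0 rfl]
    simp [hs₀, initState]
  obtain ⟨g1, g2, g3⟩ := h₂
  have n2 : s₂.nv 2 = 1 := (hf₂.nv 2 rfl).trans h₁
  refine Runs.seq' (runs_params ε (n := n) rfl ?_ n2 ?_ ?_ ?_ ?_) fun s₃ hf₃ h₃ => ?_
  · rw [hf₂.nv 0 rfl, hf₁.nv 0 rfl]
    simp [hs₀, initState]
  · rw [hf₂.nv 10 rfl, hf₁.nv 10 rfl]
    simp [hs₀, initState]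
  · rw [hf₂.nv 12 rfl, hf₁.nv 12 rfl]
    simp [hs₀, initState]
  · rw [hf₂.rv 0 rfl, hf₁.rv 0 rfl]
    simp [hs₀, initState]
  · rw [hf₂.ra 1 rfl, hf₁.ra 1 rfl]
    simp [hs₀, initState]
  obtain ⟨k1, k2, k3, k4, k5, k6⟩ := h₃
  have l₃ : s₃.nv 3 = nnzMat A := by
    rw [k1, hf₂.nv 1 rfl, hf₁.nv 1 rfl]
    simp [hs₀, initState]
  have o₃ : outVec n s₃ = Pi.single 0 1 := by
    funext i
    rw [outVec, k6, Pi.single_apply, Function.update_apply]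
    exact if_congr (by rw [Fin.ext_iff, Fin.val_zero]) rfl rfl
  have H₃ : Holds p A ⟨0, Pi.single 0 1, s₃.rv 2⟩ s₃ := by
    refine ⟨⟨?_, ?_, ?_, k4, k3, ?_, k5, ?_, fun k => ?_⟩, ?_, ?_, ?_, hcap.le, ?_, o₃, ?_, rfl⟩
    · rw [hf₃.nv 0 rfl, hf₂.nv 0 rfl, hf₁.nv 0 rfl]
      simp [hs₀, initState]
    · rw [hf₃.nv 2 rfl, n2]
    · rw [hf₃.nv 4 rfl, g2]
    · rw [hf₃.rv 0 rfl, hf₂.rv 0 rfl, hf₁.rv 0 rfl]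
      simp [hs₀, initState, hp, initParams]
    · rw [hf₃.rv 9 rfl, hf₂.rv 9 rfl, hf₁.rv 9 rfl]
      simp [hs₀, initState]
    · rw [hf₃.na 4 rfl, g3]
    · rw [OpsRep, l₃, k2, hf₃.na 2 rfl, hf₃.na 3 rfl, hf₃.ra 3 rfl]
      exact Rep.ofListing e ε g1
    · intro i _
      rw [workVec, hf₃.ra 2 rfl, hf₂.ra 2 rfl, hf₁.ra 2 rfl]
      simp [hs₀, initState]
    · rw [hf₃.rv 3 rfl, hf₂.rv 3 rfl, hf₁.rv 3 rfl]
      simp [hs₀, initState]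
    · rw [hf₃.pos rfl, hf₂.pos rfl, hf₁.pos rfl]
      simp [hs₀, initState, samplePos]
    · intro i hi _
      rw [o₃, Pi.single_apply, if_neg]
      rintro rfl
      exact hi (Fin.val_zero n)
  have hM : numCand p (⟨0, Pi.single 0 1, s₃.rv 2⟩ : AState n).cnt = p.m := if_pos hcap
  have hrun := runs_recomp (ω := ω) (injective_initParams_sup e ε) hK hsym hz H₃
  rw [hM, l₃] at hrun
  have hrec : recomp p ω A ⟨0, Pi.single 0 1, s₃.rv 2⟩ = recomp p ω A ⟨0, Pi.single 0 1, thr⟩ := rfl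
  rw [hrec] at hrun
  exact hrun.mono le_rfl fun t hf ht => ⟨ht.1, ht.2, (hf.nv 3 rfl).trans l₃⟩

end Init

/-! ### The sequence of matrices -/

section MatAt

variable {A₀ : Matrix (Fin n) (Fin n) ℝ} {v : ℕ → Fin n → ℝ} {T : ℕ}

theorem matAt_zero : matAt A₀ v 0 = A₀ := by simp [matAt]

theorem matAt_succ (t : ℕ) :
    matAt A₀ v (t + 1) = matAt A₀ v t - Matrix.vecMulVec (v t) (v t) := by
  rw [matAt, matAt, Finset.sum_range_succ, sub_sub]

theorem matAt_sub_posSemidef {t t' : ℕ} (h : t ≤ t') :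
    (matAt A₀ v t - matAt A₀ v t').PosSemidef := by
  induction t', h using Nat.le_induction with
  | base =>
    rw [sub_self]
    exact Matrix.PosSemidef.zero
  | succ k _ ih =>
    rw [matAt_succ, ← sub_add]
    refine ih.add ?_
    have := Matrix.posSemidef_vecMulVec_self_star (v k)
    rwa [star_trivial] at this

/-- A coordinate whose diagonal entry vanishes initially stays isolated. -/
theorem matAt_eq_zero (hpsd : ∀ t ≤ T, (matAt A₀ v t).PosSemidef) {i : Fin n} (hi : A₀ i i = 0)
    {t : ℕ} (ht : t ≤ T) (r : Fin n) : matAt A₀ v t r i = 0 := by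
  have h1 : 0 ≤ matAt A₀ v t i i := (hpsd t ht).diag_nonneg
  have h2 : 0 ≤ (matAt A₀ v 0 - matAt A₀ v t) i i :=
    (matAt_sub_posSemidef (Nat.zero_le t)).diag_nonneg
  rw [Matrix.sub_apply, matAt_zero, hi] at h2
  have h3 : matAt A₀ v t *ᵥ Pi.single i 1 = 0 := by
    rw [← (hpsd t ht).dotProduct_mulVec_zero_iff]
    rw [star_trivial, Matrix.mulVec_single_one, single_one_dotProduct]
    exact le_antisymm (by simpa using h2) h1
  have := congrFun h3 r
  rwa [Matrix.mulVec_single_one] at this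

end MatAt

/-! ### Arrival of an update -/

theorem Listed.loadUpdate {v : Fin n → ℝ} (e : VecListing v) (s : State) :
    Listed v (fun k => (e k).1) (DecEig.loadUpdate s v e) := by
  refine ⟨Subtype.val_injective.comp e.injective, fun i hi => ?_, ?_, fun k => ?_, fun k => ?_⟩
  · by_contra h
    exact hi (e.symm ⟨i, h⟩) (by simp)
  · simp [DecEig.loadUpdate]
  · simp [DecEig.loadUpdate]
  · simp [DecEig.loadUpdate]

theorem Holds.loadUpdate {p : Params n} {B : Matrix (Fin n) (Fin n) ℝ} {st : AState n} {s : State}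
    (h : Holds p B st s) {v : Fin n → ℝ} (e : VecListing v) :
    Holds p B st (DecEig.loadUpdate s v e) := by
  obtain ⟨⟨a1, a2, a3, a4, a5, a6, a7, a8, a9⟩, h2, h3, h4, h5, h6, h7, h8, h9⟩ := h
  exact ⟨⟨a1, a2, a3, a4, a5, a6, a7, a8, a9⟩, h2, h3, h4, h5, h6, h7, h8, h9⟩

/-! ### Total running time -/

section Cost

/-- Length of the operation list after `t` updates. -/
def opsLen (p : Params n) (N : ℕ) (c : ℕ → ℕ) (cnt : ℕ → ℕ) : ℕ → ℕ
  | 0 => N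
  | t + 1 => if cnt t < n ^ 16 then opsLen p N c cnt t + c t + c t else p.d * p.d

/-- Number of entries that have been listed after `t` updates, each update counting at least `1`. -/
def inputSize (N : ℕ) (c : ℕ → ℕ) (t : ℕ) : ℕ := N + ∑ i ∈ Finset.range t, max 1 (c i)

theorem recompTime_mono {d K M len len' : ℕ} (h : len ≤ len') :
    recompTime d K M len ≤ recompTime d K M len' := by
  unfold recompTime candTime
  gcongr

/-- Steps for an update after the limit of randomized recomputations is reached, besides those that
depend on the length of the old operation list or on the update vector. -/
def denseStep (p : Params n) : ℕ :=
  27 * (p.d * p.d) + 11 * p.d + 8 + 17 * p.d * (p.d * p.d) + recompTime p.d p.K p.d (p.d * p.d)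

theorem denseTime_eq (d len : ℕ) : denseTime d len = 17 * d * len + 27 * (d * d) + 11 * d + 8 := by
  unfold denseTime
  ring

variable {p : Params n} {N : ℕ} {c cnt : ℕ → ℕ} {τ : ℕ → ℕ} {T : ℕ}

/-- Amortized bound on the running time `τ 0 + … + τ t`.  After the limit of randomized
recomputations, the potential `17 * d * len` pays for making the operation list dense. -/
theorem amortized (hcnt0 : 1 ≤ cnt 0)
    (h0 : τ 0 ≤ initTime p N)
    (hτ : ∀ t < T, ∃ r : ℕ, cnt (t + 1) = (if cnt t < n ^ 16 then cnt t + r else cnt t) ∧ r ≤ 1 ∧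
      τ (t + 1) ≤ 60 * (c t + 1)
        + (if cnt t < n ^ 16 then 0 else denseTime p.d (opsLen p N c cnt t + c t + c t))
        + r * recompTime p.d p.K (numCand p (cnt t))
          (if cnt t < n ^ 16 then opsLen p N c cnt t + c t + c t else p.d * p.d))
    {t : ℕ} (ht : t ≤ T) :
    (∑ i ∈ Finset.range (t + 1), τ i) + 17 * p.d * opsLen p N c cnt t ≤
      100 + p.m + 4 * p.K + (120 + 34 * p.d) * inputSize N c t
        + recompTime p.d p.K p.m (2 * inputSize N c T) * cnt t + denseStep p * t ∧
    (cnt t < n ^ 16 → (∑ i ∈ Finset.range (t + 1), τ i) ≤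
      100 + p.m + 4 * p.K + 120 * inputSize N c t
        + recompTime p.d p.K p.m (2 * inputSize N c T) * cnt t) ∧
    (cnt t < n ^ 16 → opsLen p N c cnt t ≤ 2 * inputSize N c t) := by
  set R := recompTime p.d p.K p.m (2 * inputSize N c T) with hR
  have hmono : ∀ t ≤ T, inputSize N c t ≤ inputSize N c T := fun t ht => by
    unfold inputSize
    gcongr
  induction t with
  | zero =>
    have hN : N ≤ 2 * inputSize N c T := by
      have := hmono 0 ht
      simp only [inputSize, Finset.range_zero, Finset.sum_empty] at this ⊢
      omega
    have h1 : recompTime p.d p.K p.m N ≤ R * cnt 0 :=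
      (recompTime_mono hN).trans (Nat.le_mul_of_pos_right _ hcnt0)
    have h2 : inputSize N c 0 = N := by simp [inputSize]
    have h3 : τ 0 ≤ 100 + p.m + 4 * p.K + 120 * N + R * cnt 0 := by
      rw [initTime] at h0
      omega
    rw [h2, Finset.sum_range_one, opsLen]
    refine ⟨?_, fun _ => h3, fun _ => by omega⟩
    have : (120 + 34 * p.d) * N = 120 * N + 17 * p.d * N + 17 * p.d * N := by ring
    omega
  | succ t ih =>
    obtain ⟨i1, i2, i3⟩ := ih (by omega)
    obtain ⟨r, hr, hr1, hτt⟩ := hτ t (by omega)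
    have hs : inputSize N c (t + 1) = inputSize N c t + max 1 (c t) := by
      rw [inputSize, Finset.sum_range_succ, ← add_assoc]
      rfl
    have hmax : c t ≤ max 1 (c t) := le_max_right _ _
    have hmax1 : 1 ≤ max 1 (c t) := le_max_left _ _
    generalize max 1 (c t) = x at hs hmax hmax1
    rw [Finset.sum_range_succ, opsLen, hs]
    have e1 : (120 + 34 * p.d) * (inputSize N c t + x)
        = (120 + 34 * p.d) * inputSize N c t + 120 * x + 17 * p.d * (x + x) := by ring
    have e3 : 17 * p.d * (c t + c t) ≤ 17 * p.d * (x + x) := by gcongr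
    by_cases hc : cnt t < n ^ 16
    · simp only [if_pos hc] at hr hτt ⊢
      have hlen : opsLen p N c cnt t + c t + c t ≤ 2 * inputSize N c T := by
        have := i3 hc
        have := hmono (t + 1) ht
        omega
      have hM : numCand p (cnt t) = p.m := if_pos hc
      rw [hM] at hτt
      have h4 : r * recompTime p.d p.K p.m (opsLen p N c cnt t + c t + c t) ≤ R * r := by
        rw [mul_comm]
        exact Nat.mul_le_mul_right _ (recompTime_mono hlen)
      have e2 : 17 * p.d * (opsLen p N c cnt t + c t + c t)
          = 17 * p.d * opsLen p N c cnt t + 17 * p.d * (c t + c t) := by ring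
      rw [hr, mul_add R, e2, e1, mul_add 120, mul_add (denseStep p)]
      have := i2 hc
      have := i3 hc
      exact ⟨by omega, fun _ => by omega, fun _ => by omega⟩
    · simp only [if_neg hc] at hr hτt ⊢
      rw [hr]
      refine ⟨?_, fun h => absurd h hc, fun h => absurd h hc⟩
      have hM : numCand p (cnt t) = p.d := if_neg hc
      rw [hM, denseTime_eq] at hτt
      have h4 : r * recompTime p.d p.K p.d (p.d * p.d) ≤ recompTime p.d p.K p.d (p.d * p.d) := by
        calc _ ≤ 1 * recompTime p.d p.K p.d (p.d * p.d) := Nat.mul_le_mul_right _ hr1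
          _ = _ := one_mul _
      have e2 : 17 * p.d * (opsLen p N c cnt t + c t + c t)
          = 17 * p.d * opsLen p N c cnt t + 17 * p.d * (c t + c t) := by ring
      rw [e2] at hτt
      have e4 : denseStep p * (t + 1) = denseStep p * t + (27 * (p.d * p.d) + 11 * p.d + 8
        + 17 * p.d * (p.d * p.d) + recompTime p.d p.K p.d (p.d * p.d)) := by
        rw [mul_add, mul_one]
        rfl
      rw [e1, e4]
      omega

theorem recompTime_le {d K m N : ℕ} (hd : d ≤ N) (hK : 1 ≤ K) (hm : 1 ≤ m) (hN : 1 ≤ N) :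
    recompTime d K m (2 * N) ≤ 300 * (m * K * N) := by
  have h1 : N ≤ K * N := Nat.le_mul_of_pos_left _ hK
  have h2 : candTime d K (2 * N) ≤ 100 * (K * N) := by
    have : K * (2 * N * 17 + 4 + (d * 7 + 2) + 2) ≤ K * (49 * N) :=
      Nat.mul_le_mul_left _ (by omega)
    have e : K * (49 * N) = 49 * (K * N) := by ring
    unfold candTime
    omega
  have h3 : m * (candTime d K (2 * N) + 2) ≤ m * (102 * (K * N)) :=
    Nat.mul_le_mul_left _ (by omega)
  have e : m * (102 * (K * N)) = 102 * (m * K * N) := by ring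
  have h4 : K * N ≤ m * K * N := by
    rw [mul_assoc]
    exact Nat.le_mul_of_pos_left _ hm
  unfold recompTime
  omega

theorem denseStep_le (hd : p.d ≤ n) (hK : 1 ≤ p.K) (hn : 1 ≤ n) :
    denseStep p ≤ 300 * (p.K * n ^ 3) := by
  have h1 : p.d * p.d ≤ n ^ 2 := by
    rw [sq]
    exact Nat.mul_le_mul hd hd
  have h2 : n ≤ n ^ 2 := Nat.le_self_pow (by norm_num) n
  have h3 : n ^ 2 ≤ n ^ 3 := Nat.pow_le_pow_right hn (by norm_num)
  have h4 : p.d * (p.d * p.d) ≤ n ^ 3 := by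
    rw [pow_succ' n 2]
    exact Nat.mul_le_mul hd h1
  have h5 : candTime p.d p.K (p.d * p.d) ≤ 70 * (p.K * n ^ 2) := by
    have a1 : p.K * (p.d * p.d * 17 + 4 + (p.d * 7 + 2) + 2) ≤ p.K * (32 * n ^ 2) :=
      Nat.mul_le_mul_left _ (by omega)
    have a2 : p.K * (32 * n ^ 2) = 32 * (p.K * n ^ 2) := by ring
    have a3 : n ^ 2 ≤ p.K * n ^ 2 := Nat.le_mul_of_pos_left _ hK
    unfold candTime
    omega
  have h6 : p.d * (candTime p.d p.K (p.d * p.d) + 2) ≤ n * (72 * (p.K * n ^ 2)) := by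
    refine Nat.mul_le_mul hd ?_
    have : 1 ≤ p.K * n ^ 2 := Nat.mul_pos hK (pow_pos hn 2)
    omega
  have e : n * (72 * (p.K * n ^ 2)) = 72 * (p.K * n ^ 3) := by ring
  have h7 : n ^ 3 ≤ p.K * n ^ 3 := Nat.le_mul_of_pos_left _ hK
  have e' : 17 * p.d * (p.d * p.d) = 17 * (p.d * (p.d * p.d)) := by ring
  unfold denseStep recompTime
  omega

/-- The total time is at most proportional to (number of recomputations) × (number of candidates)
× (number of power steps) × (size of the input): once the limit of randomized recomputations is
reached, their number exceeds the price of an update in dense form. -/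
theorem total_le (hcnt0 : 1 ≤ cnt 0) (hmono : Monotone cnt)
    (h0 : τ 0 ≤ initTime p N)
    (hτ : ∀ t < T, ∃ r : ℕ, cnt (t + 1) = (if cnt t < n ^ 16 then cnt t + r else cnt t) ∧ r ≤ 1 ∧
      τ (t + 1) ≤ 60 * (c t + 1)
        + (if cnt t < n ^ 16 then 0 else denseTime p.d (opsLen p N c cnt t + c t + c t))
        + r * recompTime p.d p.K (numCand p (cnt t))
          (if cnt t < n ^ 16 then opsLen p N c cnt t + c t + c t else p.d * p.d))
    (hn : 1 ≤ n) (hd : p.d ≤ n) (hdN : p.d ≤ N) (hK : 1 ≤ p.K) (hm : 1 ≤ p.m) (hN : 1 ≤ N) :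
    ∑ i ∈ Finset.range (T + 1), τ i ≤ 1000 * (p.m * p.K * inputSize N c T * cnt T) := by
  obtain ⟨a1, a2, -⟩ := amortized (p := p) hcnt0 h0 hτ le_rfl
  set S := inputSize N c T with hS
  have hNS : N ≤ S := Nat.le_add_right _ _
  have hTS : T ≤ S := by
    have : ∑ i ∈ Finset.range T, 1 ≤ ∑ i ∈ Finset.range T, max 1 (c i) :=
      Finset.sum_le_sum fun i _ => le_max_left _ _
    rw [Finset.sum_const, Finset.card_range, smul_eq_mul, mul_one] at this
    exact this.trans (Nat.le_add_left _ _)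
  have hcT : 1 ≤ cnt T := hcnt0.trans (hmono (Nat.zero_le T))
  have hR := recompTime_le (hdN.trans hNS) hK hm (hN.trans hNS)
  set X := p.m * p.K * S * cnt T with hX
  have hS1 : 1 ≤ S := hN.trans hNS
  have b1 : p.m ≤ X := by
    calc p.m = p.m * 1 * 1 * 1 := by ring
      _ ≤ X := by rw [hX]; gcongr
  have b2 : p.K ≤ X := by
    calc p.K = 1 * p.K * 1 * 1 := by ring
      _ ≤ X := by rw [hX]; gcongr
  have b3 : S ≤ X := by
    calc S = 1 * 1 * S * 1 := by ring
      _ ≤ X := by rw [hX]; gcongr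
  have b4 : recompTime p.d p.K p.m (2 * S) * cnt T ≤ 300 * X := by
    calc _ ≤ 300 * (p.m * p.K * S) * cnt T := Nat.mul_le_mul_right _ hR
      _ = 300 * X := by rw [hX]; ring
  by_cases hc : cnt T < n ^ 16
  · have := a2 hc
    omega
  · have hcn : n ^ 3 ≤ cnt T :=
      (Nat.pow_le_pow_right hn (by norm_num)).trans (not_lt.1 hc)
    have hn3 : n ≤ n ^ 3 := Nat.le_self_pow (by norm_num) n
    have b5 : p.d * S ≤ X := by
      calc p.d * S ≤ cnt T * S := Nat.mul_le_mul_right _ (by omega)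
        _ = 1 * 1 * S * cnt T := by ring
        _ ≤ X := by rw [hX]; gcongr
    have b6 : denseStep p * T ≤ 300 * X := by
      calc denseStep p * T ≤ (300 * (p.K * n ^ 3)) * S :=
            Nat.mul_le_mul (denseStep_le hd hK hn) hTS
        _ ≤ (300 * (p.K * cnt T)) * S := by gcongr
        _ = 300 * (1 * p.K * S * cnt T) := by ring
        _ ≤ 300 * X := by rw [hX]; gcongr
    have e : (120 + 34 * p.d) * S = 120 * S + 34 * (p.d * S) := by ring
    omega

end Cost

/-! ### The choice of parameters -/

section Constants

theorem natCast_le_two_pow_clog (n : ℕ) : (n : ℝ) ≤ 2 ^ Nat.clog 2 n := by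
  exact_mod_cast Nat.le_pow_clog one_lt_two n

theorem one_le_clog (hn : 2 ≤ n) : 1 ≤ Nat.clog 2 n := Nat.clog_pos one_lt_two hn

/-- The inequality `2 ^ 7 ≤ e ^ 5`, which serves to compare exponentials with powers of
`2 ^ l ≥ n`. -/
theorem two_pow_le_exp (l : ℕ) : ((2 : ℝ) ^ l) ^ 7 ≤ Real.exp (5 * l) := by
  have h1 : (2 : ℝ) ^ 7 ≤ Real.exp 1 ^ 5 := by
    calc (2 : ℝ) ^ 7 ≤ 2.7 ^ 5 := by norm_num
      _ ≤ Real.exp 1 ^ 5 := by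
        have := Real.exp_one_gt_d9
        gcongr
        linarith
  calc ((2 : ℝ) ^ l) ^ 7 = (2 ^ 7) ^ l := by rw [← pow_mul, ← pow_mul, mul_comm]
    _ ≤ (Real.exp 1 ^ 5) ^ l := pow_le_pow_left₀ (by norm_num) h1 _
    _ = Real.exp (5 * l) := by
      rw [← pow_mul, ← Real.exp_nat_mul]
      push_cast
      ring_nf

theorem exp_neg_le {l k : ℕ} {x : ℝ} (hx : 5 * (k * l : ℝ) ≤ x) :
    Real.exp (-x) * ((2 : ℝ) ^ l) ^ (7 * k) ≤ 1 := by
  have h1 : ((2 : ℝ) ^ l) ^ (7 * k) ≤ Real.exp x := by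
    calc ((2 : ℝ) ^ l) ^ (7 * k) = (((2 : ℝ) ^ l) ^ 7) ^ k := pow_mul _ _ _
      _ ≤ Real.exp (5 * l) ^ k := pow_le_pow_left₀ (by positivity) (two_pow_le_exp l) _
      _ = Real.exp (k * (5 * l)) := (Real.exp_nat_mul _ _).symm
      _ ≤ Real.exp x := Real.exp_le_exp.2 (by linarith)
  calc _ ≤ Real.exp (-x) * Real.exp x := by gcongr
    _ = 1 := by rw [← Real.exp_add, neg_add_cancel, Real.exp_zero]

/-- The number of power steps suffices. -/
theorem exp_power_lt (hn : 2 ≤ n) {x : ℝ} (hx : 16 * (Nat.clog 2 n : ℝ) ≤ x) :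
    Real.exp (-x) * (80 * Nat.clog 2 n * n) < 1 / 10 := by
  set l := Nat.clog 2 n with hl
  -- Everything is expressed by `u = 2 ^ l`, which is at least `n`, `l` and `2`.
  have h1 := exp_neg_le (l := l) (k := 3) (x := x) (by push_cast; linarith)
  set u : ℝ := 2 ^ l with hu
  have hu2 : 2 ≤ u := by
    calc (2 : ℝ) = 2 ^ 1 := (pow_one _).symm
      _ ≤ u := pow_le_pow_right₀ one_le_two (one_le_clog hn)
  have hnu : (n : ℝ) ≤ u := natCast_le_two_pow_clog n
  have hlu : (l : ℝ) ≤ u := by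
    rw [hu]
    exact_mod_cast (Nat.lt_two_pow_self (n := l)).le
  have hE := Real.exp_pos (-x)
  have h2 : Real.exp (-x) * (80 * l * n) ≤ Real.exp (-x) * (80 * u * u) := by gcongr
  have h3 : (2 : ℝ) ^ 19 ≤ u ^ 19 := pow_le_pow_left₀ (by norm_num) hu2 _
  have h4 : Real.exp (-x) * (u * u) * 2 ^ 19 ≤ 1 := by
    calc _ ≤ Real.exp (-x) * (u * u) * u ^ 19 := by gcongr
      _ = Real.exp (-x) * u ^ (7 * 3) := by ring
      _ ≤ 1 := h1
  norm_num at h4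
  linarith

/-- The number of candidates suffices, for `n ^ 16` recomputations. -/
theorem failure_le (hn : 2 ≤ n) :
    ((n ^ 16 : ℕ) : ℝ) * ((1 / 2) ^ (32 * Nat.clog 2 n)
      + ((32 * Nat.clog 2 n : ℕ) : ℝ) * (4 * Real.exp (-(80 * (Nat.clog 2 n : ℝ) / 4))))
      ≤ 1 / n := by
  set l := Nat.clog 2 n with hl
  have h1 := exp_neg_le (l := l) (k := 4) (x := 80 * (l : ℝ) / 4) (by push_cast; linarith)
  have e0 : ((1 : ℝ) / 2) ^ (32 * l) * (2 ^ l) ^ 32 = 1 := by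
    rw [← pow_mul, mul_comm l 32, ← mul_pow]
    norm_num
  set u : ℝ := 2 ^ l with hu
  have hu2 : 2 ≤ u := by
    calc (2 : ℝ) = 2 ^ 1 := (pow_one _).symm
      _ ≤ u := pow_le_pow_right₀ one_le_two (one_le_clog hn)
  have hnu : (n : ℝ) ≤ u := natCast_le_two_pow_clog n
  have hlu : (l : ℝ) ≤ u := by
    rw [hu]
    exact_mod_cast (Nat.lt_two_pow_self (n := l)).le
  have hn0 : (0 : ℝ) < n := by exact_mod_cast (by omega : 0 < n)
  set E := Real.exp (-(80 * (l : ℝ) / 4)) with hE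
  have hE0 : 0 < E := Real.exp_pos _
  set D := ((1 : ℝ) / 2) ^ (32 * l) with hD
  have hD0 : 0 < D := by positivity
  rw [le_div_iff₀ hn0]
  have h3 : (2 : ℝ) ^ 15 ≤ u ^ 15 := pow_le_pow_left₀ (by norm_num) hu2 _
  have h4 : (2 : ℝ) ^ 10 ≤ u ^ 10 := pow_le_pow_left₀ (by norm_num) hu2 _
  have a1 : D * u ^ 17 * 2 ^ 15 ≤ 1 := by
    calc _ ≤ D * u ^ 17 * u ^ 15 := by gcongr
      _ = D * u ^ 32 := by ring
      _ ≤ 1 := e0.le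
  have a2 : E * u ^ 18 * 2 ^ 10 ≤ 1 := by
    calc _ ≤ E * u ^ 18 * u ^ 10 := by gcongr
      _ = E * u ^ (7 * 4) := by ring
      _ ≤ 1 := h1
  push_cast
  calc (n : ℝ) ^ 16 * (D + 32 * l * (4 * E)) * n = n ^ 17 * D + 128 * (n ^ 17 * l * E) := by ring
    _ ≤ u ^ 17 * D + 128 * (u ^ 17 * u * E) := by gcongr
    _ = D * u ^ 17 + 128 * (E * u ^ 18) := by ring
    _ ≤ 1 := by
      norm_num at a1 a2
      linarith

theorem clog_le_log (hn : 2 ≤ n) : (Nat.clog 2 n : ℝ) ≤ 3 * Real.log n := by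
  have hl := one_le_clog hn
  have h1 : 2 ^ (Nat.clog 2 n - 1) < n :=
    (Nat.lt_clog_iff_pow_lt one_lt_two).1 (by omega)
  have h2 : (2 : ℝ) ^ (Nat.clog 2 n - 1) ≤ n := by exact_mod_cast h1.le
  have h3 := Real.log_le_log (by positivity) h2
  rw [Real.log_pow, Nat.cast_sub hl, Nat.cast_one] at h3
  have h4 : Real.log 2 ≤ Real.log n := Real.log_le_log (by norm_num) (by exact_mod_cast hn)
  have h5 := Real.log_two_gt_d9
  have h6 : (1 : ℝ) ≤ Nat.clog 2 n := by exact_mod_cast hl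
  nlinarith

theorem log_le_clog (hn : 2 ≤ n) : Real.log n ≤ Nat.clog 2 n := by
  have h1 : Real.log n ≤ Real.log (2 ^ Nat.clog 2 n) :=
    Real.log_le_log (by exact_mod_cast (by omega : 0 < n)) (natCast_le_two_pow_clog n)
  rw [Real.log_pow] at h1
  have := Real.log_two_lt_d9
  have : (0 : ℝ) ≤ Nat.clog 2 n := Nat.cast_nonneg _
  nlinarith

/-- The bound on the number of steps, in terms of the parameters, implies the stated one. -/
theorem steps_le_timeBound (hn : 2 ≤ n) {ε : ℝ} (hε0 : 0 < ε) (hε1 : ε < 1) {cnt S Λ L : ℝ}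
    (hcnt0 : 0 ≤ cnt) (hS : 0 ≤ S) (hΛ1 : 1 ≤ Λ) (hΛ : L ≤ Λ)
    (hcnt : (cnt - 1) * (1 / (80 * (80 * (Nat.clog 2 n : ℝ))) * ε)
      ≤ Real.log n + (2 * (⌈64 * (Nat.clog 2 n : ℝ) / ε⌉₊ : ℝ) + 1) * L) :
    1000 * (32 * Nat.clog 2 n * ⌈64 * (Nat.clog 2 n : ℝ) / ε⌉₊ * S * cnt)
      ≤ 10 ^ 18 * (Real.log n ^ 3 * Real.log (n / ε) ^ 6 * Λ / ε ^ 4 * S) := by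
  have hln := log_le_clog hn
  have hcl := clog_le_log hn
  have hl1 : (1 : ℝ) ≤ Nat.clog 2 n := by exact_mod_cast one_le_clog hn
  have hK : (⌈64 * (Nat.clog 2 n : ℝ) / ε⌉₊ : ℝ) < 64 * (Nat.clog 2 n : ℝ) / ε + 1 :=
    Nat.ceil_lt_add_one (by positivity)
  have hK0 : (0 : ℝ) ≤ (⌈64 * (Nat.clog 2 n : ℝ) / ε⌉₊ : ℝ) := Nat.cast_nonneg _
  generalize (⌈64 * (Nat.clog 2 n : ℝ) / ε⌉₊ : ℝ) = K at *
  generalize (Nat.clog 2 n : ℝ) = l at *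
  have hy2 : Real.log 2 ≤ Real.log n := Real.log_le_log (by norm_num) (by exact_mod_cast hn)
  have hn0 : (0 : ℝ) < n := by exact_mod_cast (by omega : 0 < n)
  have hyz : Real.log n ≤ Real.log (n / ε) := by
    refine Real.log_le_log hn0 ?_
    rw [le_div_iff₀ hε0]
    nlinarith
  have hlog2 := Real.log_two_gt_d9
  -- From here on `l`, `y`, `z`, `r` stand for `clog 2 n`, `log n`, `log (n / ε)`, `1 / ε`; the
  -- number of recomputations is of order `(l r) ^ 2 Λ`, and the product with the numbers of
  -- candidates and of power steps is of order `l ^ 4 r ^ 3 Λ`.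
  generalize Real.log n = y at *
  generalize Real.log (n / ε) = z at *
  have hy0 : 0.69 ≤ y := by linarith
  set r := 1 / ε with hr
  have hr1 : 1 ≤ r := by
    rw [hr, le_div_iff₀ hε0]
    linarith
  have hrε : r * ε = 1 := by
    rw [hr]
    field_simp
  have eK : 64 * l / ε = 64 * l * r := by rw [hr]; ring
  have hlr : l ≤ l * r := le_mul_of_one_le_right (by linarith) hr1
  have hK' : K ≤ 65 * (l * r) := by
    rw [eK] at hK
    linarith
  have hcnt1 : cnt - 1 ≤ 6400 * (l * r) * (132 * (l * r) * Λ) := by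
    have e1 : (cnt - 1) * (1 / (80 * (80 * l)) * ε) * (6400 * (l * r)) = cnt - 1 := by
      have hl0 : l ≠ 0 := by linarith
      calc _ = (cnt - 1) * (l / l) * (r * ε) := by ring
        _ = cnt - 1 := by rw [hrε, div_self hl0]; ring
    have h1 : (2 * K + 1) * L ≤ (131 * (l * r)) * Λ := by
      calc (2 * K + 1) * L ≤ (2 * K + 1) * Λ := by gcongr
        _ ≤ (131 * (l * r)) * Λ := by
          gcongr
          linarith
    have h2 : y ≤ l * r * Λ := by
      calc y ≤ l * r * 1 := by linarith
        _ ≤ l * r * Λ := by gcongr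
    have h3 : (cnt - 1) * (1 / (80 * (80 * l)) * ε) ≤ 132 * (l * r) * Λ := by linarith
    calc cnt - 1 = (cnt - 1) * (1 / (80 * (80 * l)) * ε) * (6400 * (l * r)) := e1.symm
      _ ≤ 132 * (l * r) * Λ * (6400 * (l * r)) := by gcongr
      _ = _ := by ring
  have hcnt2 : cnt ≤ 844801 * ((l * r) ^ 2 * Λ) := by
    have : 1 * 1 ≤ (l * r) ^ 2 * Λ := by
      gcongr
      exact one_le_pow₀ (by linarith)
    nlinarith
  have hz : 0.15 ≤ z ^ 5 := by
    calc (0.15 : ℝ) ≤ 0.69 ^ 5 := by norm_num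
      _ ≤ z ^ 5 := by
        gcongr
        linarith
  have hy3 : l ^ 4 * r ^ 3 ≤ 540 * (y ^ 3 * z ^ 6 * r ^ 4) := by
    have hz6 : 0.15 * y ≤ z ^ 6 := by
      calc 0.15 * y ≤ z ^ 5 * z := by gcongr
        _ = z ^ 6 := by ring
    calc l ^ 4 * r ^ 3 ≤ (3 * y) ^ 4 * r ^ 4 := by
          gcongr
          norm_num
      _ = 540 * (y ^ 3 * (0.15 * y) * r ^ 4) := by ring
      _ ≤ 540 * (y ^ 3 * z ^ 6 * r ^ 4) := by gcongr
  have hT : y ^ 3 * z ^ 6 * Λ / ε ^ 4 * S = y ^ 3 * z ^ 6 * r ^ 4 * (Λ * S) := by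
    rw [hr]
    field_simp
  rw [hT]
  calc 1000 * (32 * l * K * S * cnt)
      ≤ 1000 * (32 * l * (65 * (l * r)) * S * (844801 * ((l * r) ^ 2 * Λ))) := by gcongr
    _ = 1000 * 32 * 65 * 844801 * (l ^ 4 * r ^ 3) * (Λ * S) := by ring
    _ ≤ 1000 * 32 * 65 * 844801 * (540 * (y ^ 3 * z ^ 6 * r ^ 4)) * (Λ * S) := by gcongr
    _ = 1000 * 32 * 65 * 844801 * 540 * (y ^ 3 * z ^ 6 * r ^ 4 * (Λ * S)) := by ring
    _ ≤ 10 ^ 18 * (y ^ 3 * z ^ 6 * r ^ 4 * (Λ * S)) := by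
      have : 0 ≤ z := by linarith
      gcongr
      norm_num

end Constants

/-! ### The algorithm -/

/-- The dynamic power method as a program. -/
def decEigAlg : DynAlg where
  init := initCmd
  update := updateCmd

section Main

variable {ε : ℝ} {A₀ : Matrix (Fin n) (Fin n) ℝ} {v : ℕ → Fin n → ℝ} {T : ℕ}

theorem initParams_K_pos (hn : 2 ≤ n) (hε0 : 0 < ε) (e : MatListing A₀) :
    0 < (initParams ε e).K := by
  have : (0 : ℝ) < Nat.clog 2 n := by exact_mod_cast one_le_clog hn
  exact Nat.ceil_pos.2 (by positivity)

theorem matAt_eq_zero_of_initParams (hpsd : ∀ t ≤ T, (matAt A₀ v t).PosSemidef)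
    (e : MatListing A₀) :
    ∀ t ≤ T, ∀ i, (∀ k, (initParams ε e).sup k ≠ i) → ∀ r, matAt A₀ v t r i = 0 := by
  intro t ht i hi r
  refine matAt_eq_zero hpsd ?_ ht r
  by_contra h
  obtain ⟨k, hk⟩ := (exists_initParams_sup e ε).2 h
  exact hi k hk

theorem succeeds_of_goodRun [NeZero n] (hn : 2 ≤ n) (hε0 : 0 < ε) (hε1 : ε < 1)
    (hpsd : ∀ t ≤ T, (matAt A₀ v t).PosSemidef) (e : MatListing A₀) (f : ∀ t, VecListing (v t))
    {ω : ℕ → ℝ}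
    (hgood : GoodRun (initParams ε e) (80 * Nat.clog 2 n) (matAt A₀ v) T ω) :
    Succeeds decEigAlg ω ε A₀ e v f T (10 ^ 18 * timeBound ε A₀ v T) := by
  classical
  set p := initParams ε e with hp
  set A := matAt A₀ v with hA
  have hsup : Function.Injective p.sup := injective_initParams_sup e ε
  have hmono : ∀ t t', t ≤ t' → t' ≤ T → (A t - A t').PosSemidef := fun t t' h _ =>
    matAt_sub_posSemidef h
  have hz := matAt_eq_zero_of_initParams (ε := ε) hpsd e
  have hK : 0 < p.K := initParams_K_pos hn hε0 e
  have hl1 : (1 : ℝ) ≤ Nat.clog 2 n := by exact_mod_cast one_le_clog hn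
  have hs : (1 : ℝ) ≤ 80 * Nat.clog 2 n := by linarith
  have hexp : Real.exp (-(2 * p.K * (p.ε / 8))) * (80 * Nat.clog 2 n * n) < 1 / 10 := by
    refine exp_power_lt hn ?_
    have h1 : 64 * (Nat.clog 2 n : ℝ) / ε ≤ p.K := Nat.le_ceil _
    rw [div_le_iff₀ hε0] at h1
    have h2 : p.ε = ε := rfl
    rw [h2]
    linarith
  have hrun := fun t ht => exists_runInv (t := t) hn hsup hpsd hmono hz hK hε0 hε1 hs hexp hgood ht
  set st : ℕ → AState n := fun t => seqState p A ω (t + 1) with hst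
  set cnt : ℕ → ℕ := fun t => (st t).cnt with hcnt
  set c : ℕ → ℕ := fun t => nnzVec (v t) with hc
  set len : ℕ → ℕ := opsLen p (nnzMat A₀) c cnt with hlen
  have hst0 : st 0 = recomp p ω (A 0) (seqState p A ω 0) := by
    have hT : Trig (A 0) (seqState p A ω 0) := by
      simp only [Trig, seqState]
      linarith
    exact if_pos hT
  have hA0 : A 0 = A₀ := matAt_zero
  have hcap : 0 < n ^ 16 := pow_pos (by omega) 16
  obtain ⟨s, k, h1, h2, h3⟩ := exists_run (ω := ω) (P := decEigAlg) (s₀ := initState ε A₀ e)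
    (load := fun t s => loadUpdate s (v t) (f t)) (T := T)
    (Inv := fun t s => (Holds p (A t) (st t) s ∧ s.rv 1 = (st t).w ⬝ᵥ (A t *ᵥ (st t).w)) ∧
      s.nv 3 = len t)
    (b := fun t => Nat.rec (initTime p (nnzMat A₀))
      (fun t _ => updateTime p (A (t + 1)) (st t) (len t) (c t)) t) (by
      have hsym : A₀ᵀ = A₀ := by
        rw [← hA0]
        exact PosSemidef.transpose_eq (hpsd 0 (Nat.zero_le T))
      have hz0 : ∀ i, (∀ k, p.sup k ≠ i) → ∀ r, A₀ r i = 0 := by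
        rw [← hA0]
        exact hz 0 (Nat.zero_le T)
      refine (runs_init e ε hK hsym hz0 (thr := (seqState p A ω 0).thr)).mono le_rfl
        fun s' _ h => ?_
      rw [hst0, hA0]
      exact ⟨⟨h.1, h.2.1⟩, h.2.2⟩) (by
      rintro t ht s ⟨⟨i1, i2⟩, i3⟩
      have hA1 : A (t + 1) = A t - Matrix.vecMulVec (v t) (v t) := matAt_succ t
      have hsym : (A t - Matrix.vecMulVec (v t) (v t))ᵀ = A t - Matrix.vecMulVec (v t) (v t) := by
        rw [← hA1]
        exact PosSemidef.transpose_eq (hpsd (t + 1) ht)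
      have hz1 : ∀ i, (∀ k, p.sup k ≠ i) → ∀ r, (A t - Matrix.vecMulVec (v t) (v t)) r i = 0 := by
        rw [← hA1]
        exact hz (t + 1) ht
      have := runs_update (ω := ω) hsup hK hsym hz1 (i1.loadUpdate (f t)) i2
        (Listed.loadUpdate (f t) s)
      have e3 : (loadUpdate s (v t) (f t)).nv 3 = len t := i3
      rw [e3, ← hA1] at this
      exact this)
  refine ⟨s, k, h1, h2, fun t ht => ?_, fun hpos => ?_⟩
  · obtain ⟨t₀, hinv⟩ := hrun t ht
    have := hinv.isApprox hpsd hmono hε0 hε1 ht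
    obtain ⟨⟨⟨i1, i2⟩, -⟩, -⟩ := h3 t ht
    rw [outVal, i2, i1.vec]
    exact this
  · have hcmono : Monotone cnt := fun a b hab => cnt_mono p A ω (Nat.add_le_add_right hab 1)
    have hcnt0 : 1 ≤ cnt 0 := by
      obtain ⟨t₀, hinv⟩ := hrun 0 (Nat.zero_le T)
      exact hinv.cnt_pos
    -- The zero matrix has `lamMax = 0`, so that there is at least one listed entry.
    have hN : 1 ≤ nnzMat A₀ := by
      rw [Nat.one_le_iff_ne_zero]
      intro h0
      have hzero : A₀ = 0 := by
        ext i j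
        by_contra h
        have := e.symm ⟨(i, j), h⟩
        rw [h0] at this
        exact this.elim0
      have hle := lamMax_mono (hmono 0 T (Nat.zero_le T) le_rfl)
      have h00 : lamMax (0 : Matrix (Fin n) (Fin n) ℝ) ≤ 0 := by
        refine lamMax_le (fun u hu => ?_)
        simp
      rw [hA0, hzero] at hle
      linarith
    have hd : p.d ≤ n := by
      have := Fintype.card_le_of_injective p.sup hsup
      simpa using this
    have hdN : p.d ≤ nnzMat A₀ := initParams_d_le e ε
    have hm : 1 ≤ p.m := by
      have := one_le_clog hn
      have : p.m = 32 * Nat.clog 2 n := rfl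
      omega
    have htot := total_le (p := p) (N := nnzMat A₀) (c := c) (cnt := cnt) (T := T)
      (τ := k) hcnt0 hcmono (h3 0 (Nat.zero_le T)).2 (fun t ht => ?_) (by omega) hd hdN hK hm hN
    · obtain ⟨t₀, hinv⟩ := hrun T le_rfl
      have hcl := hinv.cnt_le hpsd hmono hε0 hε1 hs hpos
      rw [hA0] at hcl
      have hS : (0 : ℝ) ≤ (inputSize (nnzMat A₀) c T : ℝ) := Nat.cast_nonneg _
      have hfin := steps_le_timeBound hn hε0 hε1 (cnt := cnt T) (Nat.cast_nonneg _) hS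
        (le_max_left 1 (Real.log (lamMax A₀ / lamMax (A T)))) (le_max_right _ _) hcl
      have hcast : (inputSize (nnzMat A₀) c T : ℝ)
          = (nnzMat A₀ : ℝ) + ∑ t ∈ Finset.range T, max 1 (nnzVec (v t) : ℝ) := by
        simp [inputSize, hc]
      rw [hcast] at hfin
      refine le_trans ?_ hfin
      rw [← hcast]
      calc ((∑ t ∈ Finset.range (T + 1), k t : ℕ) : ℝ)
          ≤ ((1000 * (p.m * p.K * inputSize (nnzMat A₀) c T * cnt T) : ℕ) : ℝ) := by
            exact_mod_cast htot
        _ = _ := by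
          have e1 : p.m = 32 * Nat.clog 2 n := rfl
          have e2 : p.K = ⌈64 * (Nat.clog 2 n : ℝ) / ε⌉₊ := rfl
          rw [e1, e2]
          push_cast
          ring
    · have hk := (h3 (t + 1) ht).2
      have hstep : st (t + 1) = stepState p ω (A (t + 1)) (st t) := rfl
      by_cases hT : Trig (A (t + 1)) (st t)
      · refine ⟨1, ?_, le_rfl, ?_⟩
        · simp only [hcnt, hstep, stepState, if_pos hT, recomp]
        · simp only [updateTime, if_pos hT] at hk
          rw [one_mul]
          exact hk
      · refine ⟨0, ?_, Nat.zero_le _, ?_⟩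
        · simp only [hcnt, hstep, stepState, if_neg hT]
          simp
        · simp only [updateTime, if_neg hT] at hk
          rw [zero_mul]
          exact hk

theorem measure_not_succeeds_le (hn : 2 ≤ n) (hε0 : 0 < ε) (hε1 : ε < 1)
    (hpsd : ∀ t ≤ T, (matAt A₀ v t).PosSemidef) (e : MatListing A₀) (f : ∀ t, VecListing (v t)) :
    sampleLaw {ω | ¬ Succeeds decEigAlg ω ε A₀ e v f T (10 ^ 18 * timeBound ε A₀ v T)}
      ≤ ENNReal.ofReal (1 / (n : ℝ)) := by
  have : NeZero n := ⟨by omega⟩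
  have hsub : {ω | ¬ Succeeds decEigAlg ω ε A₀ e v f T (10 ^ 18 * timeBound ε A₀ v T)} ⊆
      {ω | ¬ GoodRun (initParams ε e) (80 * Nat.clog 2 n) (matAt A₀ v) T ω} := by
    intro ω hω
    simp only [Set.mem_ofPred_eq] at hω ⊢
    exact fun hgood => hω (succeeds_of_goodRun hn hε0 hε1 hpsd e f hgood)
  refine (MeasureTheory.measure_mono hsub).trans
    ((measure_not_goodRun_le (injective_initParams_sup e ε) (by positivity)
      (initParams_K_pos hn hε0 e) (matAt_eq_zero_of_initParams hpsd e)).trans ?_)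
  rw [← ENNReal.ofReal_natCast, ← ENNReal.ofReal_mul (Nat.cast_nonneg _)]
  exact ENNReal.ofReal_le_ofReal (failure_le hn)

end Main

end DecEig

theorem theorem1 :
    ∃ (P : RealRAM.DynAlg) (C : ℝ), 0 < C ∧
      ∀ (n : ℕ) (ε : ℝ), 0 < n → 1 / (n : ℝ) < ε → ε < 1 →
      ∀ (A₀ : Matrix (Fin n) (Fin n) ℝ) (v : ℕ → Fin n → ℝ) (T : ℕ),
        (∀ t ≤ T, (DecEig.matAt A₀ v t).PosSemidef) →
      ∀ (e : DecEig.MatListing A₀) (f : ∀ t, DecEig.VecListing (v t)),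
        RealRAM.sampleLaw
            {ω | ¬ DecEig.Succeeds P ω ε A₀ e v f T (C * DecEig.timeBound ε A₀ v T)}
          ≤ ENNReal.ofReal (1 / (n : ℝ)) := by
  refine ⟨DecEig.decEigAlg, 10 ^ 18, by norm_num, ?_⟩
  intro n ε hn0 hε hε1 A₀ v T hpsd e f
  have hε0 : 0 < ε := lt_trans (by positivity) hε
  -- The range of `ε` is empty for `n = 1`.
  have hn : 2 ≤ n := by
    by_contra h
    have h1 : n = 1 := by omega
    rw [h1, Nat.cast_one, div_one] at hε
    linarith
  exact DecEig.measure_not_succeeds_le hn hε0 hε1 hpsd e f
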